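/- **Model.** Let $U$ be a finite universe of items. We work in the two-level I/O model: the disk consists of blocks of $B\ge 1$ cells; a cell has room for one item of $U$ and one integer smaller than $A$ (a pointer or a counter). A procedure has a cache of $m$ blocks, which initially holds only its arguments; computation in the cache, random choices and the evaluation of the hash functions are free. The cost of a procedure is its number of I/Os, i.e. of block transfers between disk and cache; replacing a hash function by a fresh fully random one (rehashing) is charged one I/O as well. Only the disk and the hash functions persist between operations. **Cuckoo tables.** An external-memory cuckoo table of size $N$ is a dictionary for at most $N$ keys, with integer values, stored in two tables $T_0,T_1$ of buckets, a bucket being one block (and possibly some auxiliary blocks), such that each key $x$ that is present is kept, with its value, in exactly one cell, lying in $T_0[h_0(x)]$ or $T_1[h_1(x)]$, where $h_0(x),h_1(x)$ are determined by the values at $x$ of finitely many independent fully random hash functions. Removing a key or changing its value affects only its own cell; insertions are done by some procedure (for instance breadth-first search or a random walk in the cuckoo graph, with rehashing) that stops with probability one and restores this state. Let $t(N)\in[0,\infty]$ be the expected number of I/Os of an insertion, i.e. the supremum, over all sequences of dictionary operations that are fixed in advance, keep at most $N$ keys present and end in an insertion, of the expected cost of this last insertion. **Multiqueues.** A location-aware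 multiqueue with $K$ queues and capacity $N$ maintains $K$ pairwise disjoint, initially empty, sets (queues) of elements of $U$ with at most $N$ elements in total, under the operations - $\mathrm{enqueue}(x,H)$: add the element $x$, which is in no queue, to the queue with header $H$; - $\mathrm{remove}(x)$: remove $x$ from its queue, and report whether it was in some queue; - $\mathrm{isMember}(x)$: determine whether $x$ is in some queue. The queues must be stored in such a way that the elements of a queue with $s$ elements can be listed, each exactly once, from its header with $O(1+s/B)$ I/Os, and that (location-awareness) for each element $x$ of a queue a disk block storing $x$ can be found with $O(1)$ I/Os, where the blocks thus assigned to the elements of a queue of size $s$ are $O(1+s/B)$ in number, and those assigned to all $n$ elements currently present are $O(1+(n+K)/B)$ in number; these bounds are worst-case. **Theorem.** There is an absolute constant $C$ such that the following holds for all $U$, $B\ge1$, $N$, $K$, $\gamma\in\mathbb N$ and all $A\ge C(\gamma+1)(N+K+B+1)$. Given any external-memory cuckoo table of size $N$ with at most $\gamma(\lfloor N/B\rfloor+1)$ blocks, whose insertions use a cache of $m$ blocks and cost $t(N)$ in expectation, there is a location-aware multiqueue with $K$ queues and capacity $N$, using the same kind of hash functions, such that 1. it occupies in total (headers, elements, dictionary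 and free blocks) at most $C(\gamma+1)\left(\lfloor (N+K)/B\rfloor+1\right)$ blocks of disk, i.e. $O(N/B)$ blocks if $K=O(N)$, $N \geq B$ and $\gamma=O(1)$, and it uses a cache of at most $m+C$ blocks; 2. each $\mathrm{remove}(x)$ and each $\mathrm{isMember}(x)$ uses at most $C$ I/Os in the worst case; 3. in each sequence of operations that is fixed in advance, each $\mathrm{enqueue}(x,H)$ stops with probability one and uses at most $C\,(1+t(N))$ I/Os in expectation; 4. after each such sequence, whatever the random choices were, all answers are correct, and the listing and location bounds hold with the constant $C$. All bounds are per operation, i.e. unamortized. -/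

import Mathlib

open scoped ENNReal

noncomputable section

namespace ExtMem

/-! ## The two-level input/output model

Data on disk consists of blocks of `B` cells.  A cell has room for one item of the universe `U`
and for one integer smaller than `A` (a pointer, a counter, ...).  The cache holds `m` blocks.
Computation in the cache is free, as is the evaluation of the hash functions; every transfer of
one block between the disk and the cache costs one unit. -/

/-- A cell: room for one item and one integer word. -/
abbrev Cell (U : Type) (A : ℕ) : Type := Option U × Fin A

/-- A block of `B` cells. -/
abbrev Block (U : Type) (A B : ℕ) : Type := Fin B → Cell U A

/-- The content of a disk whose blocks have the addresses `Addr`. -/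
abbrev Disk (U : Type) (A B : ℕ) (Addr : Type) : Type := Addr → Block U A B

/-- The content of a cache of `m` blocks. -/
abbrev Cache (U : Type) (A B m : ℕ) : Type := Fin m → Block U A B

/-- `g` hash functions on `U` with `r + 1` possible values each. -/
abbrev Hashes (U : Type) (g r : ℕ) : Type := Fin g → U → Fin (r + 1)

/-- What persists between two operations: the disk and the hash functions in use.
The content of the cache does not persist. -/
abbrev State (U : Type) (A B g r : ℕ) (Addr : Type) : Type :=
  Disk U A B Addr × Hashes U g r

/-- The instruction that ends a step of a procedure. -/
inductive Instr (Addr : Type) (m g : ℕ) (β : Type) : Type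
  /-- copy the block at address `a` to the `j`-th block of the cache -/
  | read (a : Addr) (j : Fin m)
  /-- copy the `j`-th block of the cache to the address `a` -/
  | write (j : Fin m) (a : Addr)
  /-- replace the `i`-th hash function by a fresh uniformly random function -/
  | rehash (i : Fin g)
  /-- stop with the answer `b` -/
  | halt (b : β)

/-- A randomized procedure with arguments in `α` and answers in `β`, running with a cache of `m`
blocks.  The cache is loaded with the argument only.  In each step, the procedure, which sees
nothing but the cache and the hash functions, rewrites the cache, outputs a list of items, and
issues an instruction. -/
structure Proc (U : Type) (A B g r : ℕ) (Addr : Type) (m : ℕ) (α β : Type) where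
  load : α → Cache U A B m
  step : Hashes U g r → Cache U A B m → PMF (Cache U A B m × List U × Instr Addr m g β)

/-- A configuration of a running procedure. -/
structure Conf (U : Type) (A B g r : ℕ) (Addr : Type) (m : ℕ) where
  cache : Cache U A B m
  state : State U A B g r Addr
  /-- the items that have been output so far -/
  out : List U

/-- What a procedure that has stopped leaves: the state, the answer, and the items output. -/
structure Outcome (U : Type) (A B g r : ℕ) (Addr : Type) (β : Type) where
  state : State U A B g r Addr
  answer : β
  out : List U

section Run

variable {U : Type} [Fintype U] [DecidableEq U] {A B g r m : ℕ} {Addr : Type} [DecidableEq Addr]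
  {α β : Type}

/-- The effect of the step `a = (new cache, output, instruction)` on the configuration `c`. -/
def Conf.advance (c : Conf U A B g r Addr m) (a : Cache U A B m × List U × Instr Addr m g β) :
    PMF (Conf U A B g r Addr m ⊕ Outcome U A B g r Addr β) :=
  match a with
  | (cache, e, .read a j) =>
      PMF.pure (.inl ⟨Function.update cache j (c.state.1 a), c.state, c.out ++ e⟩)
  | (cache, e, .write j a) =>
      PMF.pure (.inl ⟨cache, (Function.update c.state.1 a (cache j), c.state.2), c.out ++ e⟩)
  | (cache, e, .rehash i) =>
      (PMF.uniformOfFintype (U → Fin (r + 1))).map fun f =>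
        .inl ⟨cache, (c.state.1, Function.update c.state.2 i f), c.out ++ e⟩
  | (_, e, .halt b) => PMF.pure (.inr ⟨c.state, b, c.out ++ e⟩)

namespace Proc

variable (P : Proc U A B g r Addr m α β)

/-- The law of the situation one step after the configuration `c`. -/
def next (c : Conf U A B g r Addr m) : PMF (Conf U A B g r Addr m ⊕ Outcome U A B g r Addr β) :=
  (P.step c.state.2 c.cache).bind c.advance

/-- The probability of having stopped with outcome `o` after at most `n` steps. -/
def haltBy : ℕ → Conf U A B g r Addr m → Outcome U A B g r Addr β → ℝ≥0∞
  | 0, _, _ => 0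
  | n + 1, c, o =>
      ∑' s, P.next c s * Sum.elim (fun c₁ => haltBy n c₁ o) (fun o₁ => PMF.pure o₁ o) s

/-- The expected number of instructions other than `halt` (each of them costs one unit)
during the first `n` steps. -/
def costBy : ℕ → Conf U A B g r Addr m → ℝ≥0∞
  | 0, _ => 0
  | n + 1, c => ∑' s, P.next c s * Sum.elim (fun c₁ => 1 + costBy n c₁) (fun _ => 0) s

/-- Every run from the given configuration stops after at most `k` units of cost. -/
def HaltsWithin : ℕ → Conf U A B g r Addr m → Prop
  | 0, c => ∀ s ∈ (P.next c).support, Sum.elim (fun _ => False) (fun _ => True) s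
  | k + 1, c => ∀ s ∈ (P.next c).support, Sum.elim (fun c₁ => HaltsWithin k c₁) (fun _ => True) s

/-- The configuration at the start of a call with argument `x` in the state `s`. -/
def start (x : α) (s : State U A B g r Addr) : Conf U A B g r Addr m := ⟨P.load x, s, []⟩

/-- The probability that the call with argument `x` in the state `s` stops with outcome `o`.
These numbers add up to the probability that the call stops. -/
def law (x : α) (s : State U A B g r Addr) (o : Outcome U A B g r Addr β) : ℝ≥0∞ :=
  ⨆ n, P.haltBy n (P.start x s) o

/-- The probability that the call with argument `x` in the state `s` stops in the state `s₁`. -/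
def stateLaw (x : α) (s s₁ : State U A B g r Addr) : ℝ≥0∞ :=
  ∑' p : β × List U, P.law x s ⟨s₁, p.1, p.2⟩

/-- The expected cost of the call with argument `x` in the state `s`. -/
def expectedCost (x : α) (s : State U A B g r Addr) : ℝ≥0∞ :=
  ⨆ n, P.costBy n (P.start x s)

/-- The worst-case cost of the call with argument `x` in the state `s` is at most `k`. -/
def WorstCase (x : α) (s : State U A B g r Addr) (k : ℕ) : Prop :=
  P.HaltsWithin k (P.start x s)

end Proc

/-- Start with the disk `d` and with independent, uniformly random hash functions. -/
def initialLaw (d : Disk U A B Addr) : State U A B g r Addr → ℝ≥0∞ :=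
  (PMF.uniformOfFintype (Hashes U g r)).map fun h => (d, h)

end Run

/-- The law of the state after a sequence of operations, where `T o s s₁` is the probability that
the operation `o` turns the state `s` into `s₁`. -/
def lawAfter {Op S : Type} (T : Op → S → S → ℝ≥0∞) : List Op → (S → ℝ≥0∞) → S → ℝ≥0∞
  | [], μ => μ
  | o :: os, μ => lawAfter T os fun s₁ => ∑' s, μ s * T o s s₁

/-- Every operation of the sequence is allowed at the moment when it is called, where `q` is the
abstract state at the beginning. -/
def AllowedSeq {Op Q : Type} (apply : Q → Op → Q) (ok : Q → Op → Prop) : List Op → Q → Prop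
  | [], _ => True
  | o :: os, q => ok q o ∧ AllowedSeq apply ok os (apply q o)

/-- The number of items to which a partial map assigns a value. -/
def count {U V : Type} [Fintype U] (f : U → Option V) : ℕ :=
  (Finset.univ.filter fun x => (f x).isSome = true).card

/-! ## External-memory cuckoo tables -/

/-- The operations that change a dictionary with integer values. -/
inductive DictOp (U : Type) (A : ℕ) : Type
  /-- insert the new key `x` with value `v` -/
  | insert (x : U) (v : Fin A)
  /-- remove the key `x`, if it is present -/
  | erase (x : U)
  /-- change the value of the key `x` to `v`, if it is present -/
  | assign (x : U) (v : Fin A)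

/-- The effect on the dictionary. -/
def DictOp.apply {U : Type} [DecidableEq U] {A : ℕ} (f : U → Option (Fin A)) :
    DictOp U A → U → Option (Fin A)
  | .insert x v => Function.update f x (some v)
  | .erase x => Function.update f x none
  | .assign x v => Function.update f x ((f x).map fun _ => v)

/-- Only keys that are not present are inserted, and only while there are fewer than `N` keys. -/
def DictOp.Ok {U : Type} [Fintype U] {A : ℕ} (N : ℕ) (f : U → Option (Fin A)) :
    DictOp U A → Prop
  | .insert x _ => f x = none ∧ count f < N
  | .erase _ => True
  | .assign _ _ => True

/-- The data of an external-memory cuckoo table: two tables of `side` buckets each (a bucket is a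
block), some auxiliary blocks, hash functions, and an insertion procedure (for instance by
breadth-first search or by a random walk in the cuckoo graph). -/
structure CuckooData (U : Type) (A B : ℕ) where
  /-- number of buckets in each of the two tables -/
  side : ℕ
  /-- number of auxiliary blocks -/
  aux : ℕ
  /-- number of hash functions (two, or more if the items are distributed over subtables) -/
  g : ℕ
  /-- each hash function has `r + 1` values -/
  r : ℕ
  /-- number of blocks of cache that an insertion uses -/
  m : ℕ
  /-- the two buckets of an item, one in each table, as computed from its hash values -/
  choice : (Fin g → Fin (r + 1)) → Fin 2 → Fin side
  /-- the disk at the beginning -/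
  empty : Disk U A B ((Fin 2 × Fin side) ⊕ Fin aux)
  /-- the insertion procedure; its argument is a key with its value -/
  insert : Proc U A B g r ((Fin 2 × Fin side) ⊕ Fin aux) m (U × Fin A) Unit

namespace CuckooData

variable {U : Type} [Fintype U] [DecidableEq U] {A B : ℕ} (D : CuckooData U A B)

/-- The addresses: the buckets of the two tables, and the auxiliary blocks. -/
abbrev Addr : Type := (Fin 2 × Fin D.side) ⊕ Fin D.aux

/-- The number of blocks of the table. -/
def blocks : ℕ := 2 * D.side + D.aux

/-- The bucket of the item `x` in the table `T₀` (for `j = 0`) or `T₁` (for `j = 1`). -/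
def bucket (h : Hashes U D.g D.r) (x : U) (j : Fin 2) : D.Addr :=
  .inl (j, D.choice (fun i => h i x) j)

/-- Rewrite in place, in all buckets, the cell of the key `x`. -/
def rewrite (x : U) (φ : Cell U A → Cell U A) (d : Disk U A B D.Addr) : Disk U A B D.Addr
  | .inl b => fun c => if (d (.inl b) c).1 = some x then φ (d (.inl b) c) else d (.inl b) c
  | .inr b => d (.inr b)

/-- The probability that an operation turns the state `s` into `s₁`.  Removing a key or changing
its value only affects the cell where the key is stored. -/
def trans : DictOp U A → State U A B D.g D.r D.Addr → State U A B D.g D.r D.Addr → ℝ≥0∞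
  | .insert x v, s => D.insert.stateLaw (x, v) s
  | .erase x, s => PMF.pure (D.rewrite x (fun c => (none, c.2)) s.1, s.2)
  | .assign x v, s => PMF.pure (D.rewrite x (fun c => (c.1, v)) s.1, s.2)

/-- The law of the state after a sequence of operations on the table, empty at first. -/
def law (ops : List (DictOp U A)) : State U A B D.g D.r D.Addr → ℝ≥0∞ :=
  lawAfter D.trans ops (initialLaw D.empty)

/-- The state `s` stores the dictionary `f` by the rule of cuckoo hashing: each key has exactly
one cell, in one of its two buckets, and this cell holds its value. -/
def Stores (s : State U A B D.g D.r D.Addr) (f : U → Option (Fin A)) : Prop :=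
  (∀ b c x, (s.1 (.inl b) c).1 = some x →
    f x = some (s.1 (.inl b) c).2 ∧ ∃ j, D.bucket s.2 x j = .inl b) ∧
  ∀ x, (f x).isSome = true →
    ∃! p : (Fin 2 × Fin D.side) × Fin B, (s.1 (.inl p.1) p.2).1 = some x

/-- The sequences of dictionary operations with at most `N` keys present at any time. -/
def Allowed (N : ℕ) (ops : List (DictOp U A)) : Prop :=
  AllowedSeq DictOp.apply (DictOp.Ok N) ops fun _ => none

/-- `D` works as a cuckoo table of size `N`: as long as at most `N` keys are present, the
insertions stop with probability one and leave the right dictionary in the table. -/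
def IsCuckooTable (N : ℕ) : Prop :=
  ∀ ops : List (DictOp U A), Allowed N ops →
    ∑' s, D.law ops s = 1 ∧
    ∀ s, D.law ops s ≠ 0 → D.Stores s (ops.foldl DictOp.apply fun _ => none)

/-- `t(N)`: the expected cost of an insertion into the table of size `N` (for the worst sequence
of operations that ends in this insertion and does not depend on the random choices). -/
def insertionCost (N : ℕ) : ℝ≥0∞ :=
  ⨆ (ops : List (DictOp U A)) (x : U) (v : Fin A)
    (_ : Allowed N (ops ++ [DictOp.insert x v])),
    ∑' s, D.law ops s * D.insert.expectedCost (x, v) s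

end CuckooData

/-! ## Multiqueues -/

/-- The operations that change a collection of `K` queues. -/
inductive QueueOp (U : Type) (K : ℕ) : Type
  /-- add the new element `x` to the queue with header `i` -/
  | enqueue (x : U) (i : Fin K)
  /-- remove the element `x` from its queue, if it is in some queue -/
  | remove (x : U)

/-- The effect, where `q x` is the queue that contains `x`, if there is one. -/
def QueueOp.apply {U : Type} [DecidableEq U] {K : ℕ} (q : U → Option (Fin K)) :
    QueueOp U K → U → Option (Fin K)
  | .enqueue x i => Function.update q x (some i)
  | .remove x => Function.update q x none

/-- Only elements that are in no queue are enqueued, and only while the queues contain fewer than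
`N` elements in total. -/
def QueueOp.Ok {U : Type} [Fintype U] {K : ℕ} (N : ℕ) (q : U → Option (Fin K)) :
    QueueOp U K → Prop
  | .enqueue x _ => q x = none ∧ count q < N
  | .remove _ => True

/-- The queues after a sequence of operations, all of them being empty at first. -/
def queuesAfter {U : Type} [DecidableEq U] {K : ℕ} (ops : List (QueueOp U K)) :
    U → Option (Fin K) :=
  ops.foldl QueueOp.apply fun _ => none

/-- The sequences of operations with at most `N` elements in the queues at any time. -/
def AllowedOps {U : Type} [Fintype U] [DecidableEq U] {K : ℕ} (N : ℕ)
    (ops : List (QueueOp U K)) : Prop :=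
  AllowedSeq QueueOp.apply (QueueOp.Ok N) ops fun _ => none

/-- The elements of the queue `i`. -/
def elements {U : Type} [Fintype U] {K : ℕ} (q : U → Option (Fin K)) (i : Fin K) : Finset U :=
  Finset.univ.filter fun x => q x = some i

/-- The data of a location-aware multiqueue with `K` queues: a disk (with all that is stored:
headers, elements, dictionary, free blocks), and procedures for the operations. -/
structure Multiqueue (U : Type) (A B K g r : ℕ) where
  /-- number of blocks on disk -/
  blocks : ℕ
  /-- number of blocks of cache -/
  m : ℕ
  /-- the disk at the beginning, when all queues are empty -/
  empty : Disk U A B (Fin blocks)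
  /-- add an element to the queue with the given header -/
  enqueue : Proc U A B g r (Fin blocks) m (U × Fin K) Unit
  /-- remove an element from its queue; the answer tells whether it was in some queue -/
  remove : Proc U A B g r (Fin blocks) m U Bool
  /-- is the element in some queue? -/
  isMember : Proc U A B g r (Fin blocks) m U Bool
  /-- find the block in which the queues store the element -/
  locate : Proc U A B g r (Fin blocks) m U (Option (Fin blocks))
  /-- walk through the queue with the given header and output its elements -/
  traverse : Proc U A B g r (Fin blocks) m (Fin K) Unit

namespace Multiqueue

variable {U : Type} [Fintype U] [DecidableEq U] {A B K g r : ℕ} (M : Multiqueue U A B K g r)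

/-- The probability that an operation turns the state `s` into `s₁`. -/
def trans : QueueOp U K → State U A B g r (Fin M.blocks) → State U A B g r (Fin M.blocks) → ℝ≥0∞
  | .enqueue x i, s => M.enqueue.stateLaw (x, i) s
  | .remove x, s => M.remove.stateLaw x s

/-- The law of the state after a sequence of operations on the multiqueue, empty at first. -/
def law (ops : List (QueueOp U K)) : State U A B g r (Fin M.blocks) → ℝ≥0∞ :=
  lawAfter M.trans ops (initialLaw M.empty)

/-- In the state `s`, each element `x` of the queues is stored in a block `home x`, the procedure
`locate` finds this block at cost at most `C`, each queue occupies few blocks, and all the queues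
together occupy few blocks. -/
def LocationAware (C : ℕ) (s : State U A B g r (Fin M.blocks)) (q : U → Option (Fin K)) : Prop :=
  ∃ home : U → Option (Fin M.blocks),
    (∀ x, M.locate.WorstCase x s C ∧
      ∀ o, M.locate.law x s o ≠ 0 → o.state = s ∧ o.answer = home x) ∧
    (∀ x, q x = none → home x = none) ∧
    (∀ x, (q x).isSome = true → ∃ a c, home x = some a ∧ (s.1 a c).1 = some x) ∧
    (∀ i, ((elements q i).image home).card ≤ C * ((elements q i).card / B + 1)) ∧
    ((Finset.univ.filter fun x => (q x).isSome = true).image home).card ≤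
      C * ((count q + K) / B + 1)

end Multiqueue

end ExtMem

end

namespace ExtMem

noncomputable section

set_option linter.unusedSectionVars false

/-! ### Weights on states, laws of operation sequences, and deterministic runs -/

section

/-! ## Sums against laws -/

/-! Blocks owned by single queues would cost about `K` blocks, and a dictionary that stores the
block of every element would have to be changed in up to `B` places whenever a block is rearranged.
One indirection avoids both. The queues are divided into groups of `B`, so that the base pointers,
the counters and the stack tops of a group fill one block each. Up to `B` elements of a queue, its
base, lie in a block shared by queues of the group. Only a queue with exactly `B` elements in its
base has further elements; they are in a linked stack of blocks of its own, all full except possibly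
the top. For an element of a base the dictionary stores the queue, and the pointer table of the
group then gives the block; for an element of a stack it stores the block. So a whole base can move
without any change of the dictionary (`dict_split`, `dict_merge`): an enqueue needs one insertion, a
removal at most one change of a value in place and one erasure.

Space: no two shared blocks of a group may fit into one block. Then each group has at most one
shared block that is at most half full; a stack top that is at most half full is paid for by the
full base of its queue; all other blocks in use are more than half full. With `n` elements and `G`
groups this gives at most `G + 3n/B` blocks in use (`Linked.card_used_mul_le`), so the pool never
runs out. If a queue with fewer than `B` elements meets a full shared block, its base moves to a
free block; if an element leaves a base without a stack, one shared block shrinks. The pairs that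
thereby become mergeable are covered by an independent set of two blocks, respectively one, and each
merge shrinks such a cover (`dense_merge`), so two merges or one restore the invariant. A gap in a
queue with a stack is filled from the top of the stack.

Probability: everything outside the cuckoo table evolves deterministically, and so does the abstract
dictionary. A fixed sequence of queue operations therefore induces a fixed sequence of dictionary
operations, and the law of the multiqueue is the image of the law of the table (`Simulates`,
`push_step`). This gives `t(N)` plus a constant for an enqueue; all other procedures are
deterministic on every state that stores the right dictionary, hence their worst-case bounds.

The procedures of the model come from straight-line programs with at most 64 transfers per phase,
which may start a new phase or call the insertion of the table (`machine`). -/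

lemma tsum_pure_mul {S : Type} (a : S) (F : S → ℝ≥0∞) : ∑' s, PMF.pure a s * F s = F a := by
  classical
  rw [tsum_eq_single a]
  · simp
  · intro b hb
    simp [PMF.pure_apply, hb]

lemma tsum_mul_pure {S : Type} (a : S) (F : S → ℝ≥0∞) : ∑' s, F s * PMF.pure s a = F a := by
  classical
  rw [tsum_eq_single a]
  · simp
  · intro b hb
    simp [PMF.pure_apply, hb.symm]

lemma tsum_bind_mul {S T : Type} (p : PMF S) (f : S → PMF T) (F : T → ℝ≥0∞) :
    ∑' t, p.bind f t * F t = ∑' s, p s * ∑' t, f s t * F t := by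
  simp_rw [PMF.bind_apply, ← ENNReal.tsum_mul_right, ← ENNReal.tsum_mul_left]
  rw [ENNReal.tsum_comm]
  simp_rw [mul_assoc]

lemma tsum_map_mul {S T : Type} (p : PMF S) (f : S → T) (F : T → ℝ≥0∞) :
    ∑' t, p.map f t * F t = ∑' s, p s * F (f s) := by
  rw [PMF.map, tsum_bind_mul]
  simp

/-- The image of a (sub)probability weight under a map. -/
def push {S T : Type} (φ : S → T) (μ : S → ℝ≥0∞) (t : T) : ℝ≥0∞ := ∑' s, μ s * PMF.pure (φ s) t

lemma tsum_push_mul {S T : Type} (φ : S → T) (μ : S → ℝ≥0∞) (F : T → ℝ≥0∞) :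
    ∑' t, push φ μ t * F t = ∑' s, μ s * F (φ s) := by
  simp_rw [push, ← ENNReal.tsum_mul_right]
  rw [ENNReal.tsum_comm]
  simp_rw [mul_assoc, ENNReal.tsum_mul_left, tsum_pure_mul]

lemma tsum_push {S T : Type} (φ : S → T) (μ : S → ℝ≥0∞) : ∑' t, push φ μ t = ∑' s, μ s := by
  simpa using tsum_push_mul φ μ fun _ => 1

lemma exists_of_push_ne_zero {S T : Type} {φ : S → T} {μ : S → ℝ≥0∞} {t : T}
    (h : push φ μ t ≠ 0) : ∃ s, φ s = t ∧ μ s ≠ 0 := by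
  by_contra! hc
  refine h (ENNReal.tsum_eq_zero.2 fun s => ?_)
  by_cases hs : φ s = t
  · simp [hc s hs]
  · simp [PMF.pure_apply, Ne.symm hs]

lemma lawAfter_append {Op S : Type} (T : Op → S → S → ℝ≥0∞) (os₁ os₂ : List Op) (μ : S → ℝ≥0∞) :
    lawAfter T (os₁ ++ os₂) μ = lawAfter T os₂ (lawAfter T os₁ μ) := by
  induction os₁ generalizing μ with
  | nil => rfl
  | cons o os ih => exact ih _

/-- The law after a sequence of operations is linear in the initial weight, so it suffices to know
it from each single state. -/
lemma lawAfter_eq_tsum {Op S : Type} (T : Op → S → S → ℝ≥0∞) (os : List Op) (μ : S → ℝ≥0∞)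
    (s₁ : S) : lawAfter T os μ s₁ = ∑' s, μ s * lawAfter T os (PMF.pure s) s₁ := by
  induction os generalizing μ with
  | nil =>
    simp only [lawAfter]
    exact (tsum_mul_pure s₁ μ).symm
  | cons o os ih =>
    simp only [lawAfter]
    rw [ih]
    simp_rw [tsum_pure_mul, ← ENNReal.tsum_mul_right]
    rw [ENNReal.tsum_comm]
    simp_rw [mul_assoc, ENNReal.tsum_mul_left]
    refine tsum_congr fun s => ?_
    rw [ih]

/-- A simulation of one operation by a sequence of operations lifts to the laws. -/
lemma push_step {Op S T : Type} {TS : Op → S → S → ℝ≥0∞} {φ φ' : S → T} {μ : S → ℝ≥0∞}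
    {TT : T → T → ℝ≥0∞} {os : List Op}
    (h : ∀ s, μ s ≠ 0 → TT (φ s) = push φ' (lawAfter TS os (PMF.pure s))) :
    (fun t₁ => ∑' t, push φ μ t * TT t t₁) = push φ' (lawAfter TS os μ) := by
  funext t₁
  rw [tsum_push_mul, push]
  simp_rw [lawAfter_eq_tsum TS os μ, ← ENNReal.tsum_mul_right]
  rw [ENNReal.tsum_comm]
  refine tsum_congr fun s => ?_
  -- The simulation is only needed at states charged by `μ`; this is what allows invariants that
  -- hold almost surely to be used.
  by_cases hs : μ s = 0
  · simp [hs]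
  · rw [h s hs, push]
    simp_rw [mul_assoc, ENNReal.tsum_mul_left]

lemma allowedSeq_append {Op Q : Type} {apply : Q → Op → Q} {ok : Q → Op → Prop}
    {os₁ os₂ : List Op} {q : Q} :
    AllowedSeq apply ok (os₁ ++ os₂) q ↔
      AllowedSeq apply ok os₁ q ∧ AllowedSeq apply ok os₂ (os₁.foldl apply q) := by
  induction os₁ generalizing q with
  | nil => simp [AllowedSeq]
  | cons o os ih => simp [AllowedSeq, ih, and_assoc]

/-! ## Runs of procedures -/

namespace Proc

variable {U : Type} [Fintype U] [DecidableEq U] {A B g r m : ℕ} {Addr : Type} [DecidableEq Addr]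
  {α β : Type} {P : Proc U A B g r Addr m α β}

/-- The law of the outcome of a run that starts in a given configuration. -/
def lawFrom (P : Proc U A B g r Addr m α β) (c : Conf U A B g r Addr m)
    (o : Outcome U A B g r Addr β) : ℝ≥0∞ := ⨆ n, P.haltBy n c o

/-- The expected cost of a run that starts in a given configuration. -/
def costFrom (P : Proc U A B g r Addr m α β) (c : Conf U A B g r Addr m) : ℝ≥0∞ :=
  ⨆ n, P.costBy n c

/-- `n` steps that involve no random choice lead from one configuration to another. -/
inductive Steps (P : Proc U A B g r Addr m α β) :
    ℕ → Conf U A B g r Addr m → Conf U A B g r Addr m → Prop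
  | refl (c) : Steps P 0 c c
  | step {n c c₁ c₂} : P.next c = PMF.pure (.inl c₁) → Steps P n c₁ c₂ → Steps P (n + 1) c c₂

lemma Steps.trans {n k : ℕ} {c c₁ c₂ : Conf U A B g r Addr m} (h : P.Steps n c c₁)
    (h' : P.Steps k c₁ c₂) : P.Steps (n + k) c c₂ := by
  induction h with
  | refl c => simpa using h'
  | step h _ ih => rw [add_right_comm]; exact .step h (ih h')

/-- `haltBy` and `costBy` vanish for zero steps, so the suprema that define law and cost may start
after the first step. In this way a deterministic step is peeled off a run. -/
lemma iSup_nat_eq_succ {f : ℕ → ℝ≥0∞} (h : f 0 = 0) : ⨆ n, f n = ⨆ n, f (n + 1) := by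
  rw [← sup_iSup_nat_succ, h]
  simp

lemma Steps.lawFrom_eq {n : ℕ} {c c₁ : Conf U A B g r Addr m} (h : P.Steps n c c₁)
    (o : Outcome U A B g r Addr β) : P.lawFrom c o = P.lawFrom c₁ o := by
  induction h with
  | refl c => rfl
  | step h _ ih =>
    rw [← ih, lawFrom, lawFrom, iSup_nat_eq_succ rfl]
    refine iSup_congr fun n => ?_
    rw [haltBy, h, tsum_pure_mul, Sum.elim_inl]

lemma Steps.costFrom_eq {n : ℕ} {c c₁ : Conf U A B g r Addr m} (h : P.Steps n c c₁) :
    P.costFrom c = n + P.costFrom c₁ := by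
  induction h with
  | refl c => simp
  | step h _ ih =>
    rw [costFrom, iSup_nat_eq_succ rfl, Nat.cast_add, Nat.cast_one, add_comm _ (1 : ℝ≥0∞),
      add_assoc, ← ih, costFrom, ENNReal.add_iSup]
    refine iSup_congr fun n => ?_
    rw [costBy, h, tsum_pure_mul, Sum.elim_inl]

lemma Steps.haltsWithin {n k : ℕ} {c c₁ : Conf U A B g r Addr m} (h : P.Steps n c c₁)
    (h' : P.HaltsWithin k c₁) : P.HaltsWithin (k + n) c := by
  induction h with
  | refl c => exact h'
  | step h _ ih =>
    intro s hs
    rw [h, PMF.support_pure, Set.mem_singleton_iff] at hs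
    subst hs
    exact ih h'

lemma HaltsWithin.mono {n k : ℕ} {c : Conf U A B g r Addr m} (h : P.HaltsWithin n c)
    (hk : n ≤ k) : P.HaltsWithin k c := by
  induction k generalizing n c with
  | zero => obtain rfl : n = 0 := by omega
            exact h
  | succ k ih =>
    intro s hs
    cases n with
    | zero =>
      have := h s hs
      rcases s with c₁ | o
      · exact this.elim
      · trivial
    | succ n =>
      have := h s hs
      rcases s with c₁ | o
      · exact ih this (by omega)
      · trivial

lemma haltsWithin_of_halt {c : Conf U A B g r Addr m} {o : Outcome U A B g r Addr β}
    (h : P.next c = PMF.pure (.inr o)) : P.HaltsWithin 0 c := by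
  intro s hs
  rw [h, PMF.support_pure, Set.mem_singleton_iff] at hs
  subst hs
  trivial

lemma lawFrom_of_halt {c : Conf U A B g r Addr m} {o : Outcome U A B g r Addr β}
    (h : P.next c = PMF.pure (.inr o)) : P.lawFrom c = PMF.pure o := by
  funext o₁
  rw [lawFrom, iSup_nat_eq_succ rfl]
  have : ∀ n, P.haltBy (n + 1) c o₁ = PMF.pure o o₁ := fun n => by
    rw [haltBy, h, tsum_pure_mul, Sum.elim_inr]
  simp [this]

/-- From the configuration `c`, the run is deterministic, costs at most `k`, and ends in `o`. -/
def Yields (P : Proc U A B g r Addr m α β) (k : ℕ) (c : Conf U A B g r Addr m)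
    (o : Outcome U A B g r Addr β) : Prop :=
  P.HaltsWithin k c ∧ P.lawFrom c = PMF.pure o

lemma Yields.mono {n k : ℕ} {c : Conf U A B g r Addr m} {o : Outcome U A B g r Addr β}
    (h : P.Yields n c o) (hk : n ≤ k) : P.Yields k c o := ⟨h.1.mono hk, h.2⟩

lemma yields_of_halt {c : Conf U A B g r Addr m} {o : Outcome U A B g r Addr β}
    (h : P.next c = PMF.pure (.inr o)) : P.Yields 0 c o :=
  ⟨haltsWithin_of_halt h, lawFrom_of_halt h⟩

lemma Steps.yields {n k : ℕ} {c c₁ : Conf U A B g r Addr m} {o : Outcome U A B g r Addr β}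
    (h : P.Steps n c c₁) (h' : P.Yields k c₁ o) : P.Yields (k + n) c o :=
  ⟨h.haltsWithin h'.1, by rw [← h'.2]; exact funext h.lawFrom_eq⟩

lemma Yields.worstCase {k : ℕ} {x : α} {s : State U A B g r Addr}
    {o : Outcome U A B g r Addr β} (h : P.Yields k (P.start x s) o) : P.WorstCase x s k := h.1

/-- Turns a deterministic run into a statement on all outcomes of nonzero probability, the form in
which correctness is required. -/
lemma Yields.eq_of_law_ne_zero {k : ℕ} {x : α} {s : State U A B g r Addr}
    {o o₁ : Outcome U A B g r Addr β} (h : P.Yields k (P.start x s) o) (h₁ : P.law x s o₁ ≠ 0) :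
    o₁ = o := by
  classical
  have : P.law x s o₁ = PMF.pure o o₁ := congrFun h.2 o₁
  by_contra hne
  exact h₁ (by rw [this, PMF.pure_apply, if_neg hne])

lemma Yields.stateLaw_eq {k : ℕ} {x : α} {s : State U A B g r Addr}
    {o : Outcome U A B g r Addr β} (h : P.Yields k (P.start x s) o) :
    P.stateLaw x s = PMF.pure o.state := by
  classical
  funext s₁
  have : ∀ o₁, P.law x s o₁ = PMF.pure o o₁ := congrFun h.2
  simp only [stateLaw, this]
  by_cases hs : s₁ = o.state
  · rw [tsum_eq_single (o.answer, o.out)]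
    · simp [PMF.pure_apply, hs]
    · rintro ⟨b, e⟩ hne
      rw [PMF.pure_apply, if_neg]
      rintro rfl
      exact hne rfl
  · rw [PMF.pure_apply, if_neg hs, ENNReal.tsum_eq_zero]
    rintro ⟨b, e⟩
    rw [PMF.pure_apply, if_neg]
    rintro rfl
    exact hs rfl

end Proc

end

/-! ### Programs with block transfers, and their compilation to procedures -/

section

/-! ## Straight-line programs -/

/-- A deterministic program that reads and writes blocks. -/
inductive Prog (Addr Blk ρ : Type) : Type
  | ret (r : ρ)
  | read (a : Addr) (k : Blk → Prog Addr Blk ρ)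
  | write (a : Addr) (b : Blk) (k : Prog Addr Blk ρ)

namespace Prog

variable {Addr Blk ρ σ : Type}

def bind : Prog Addr Blk ρ → (ρ → Prog Addr Blk σ) → Prog Addr Blk σ
  | ret r, f => f r
  | read a k, f => read a fun b => (k b).bind f
  | write a b k, f => write a b (k.bind f)

instance : Monad (Prog Addr Blk) where
  pure := ret
  bind := bind

/-- Read a block and decode it. -/
def get (a : Addr) (dec : Blk → ρ) : Prog Addr Blk ρ := read a fun b => ret (dec b)

/-- Write a block. -/
def put (a : Addr) (b : Blk) : Prog Addr Blk Unit := write a b (ret ())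

variable [DecidableEq Addr]

/-- Run on the disk `d`, the program stops after `n` transfers with the disk `d'` and the
result `r`. -/
def Runs : Prog Addr Blk ρ → (Addr → Blk) → ℕ → (Addr → Blk) → ρ → Prop
  | ret r₀, d, n, d', r => n = 0 ∧ d' = d ∧ r = r₀
  | read a k, d, n, d', r => ∃ n', n = n' + 1 ∧ (k (d a)).Runs d n' d' r
  | write a b k, d, n, d', r => ∃ n', n = n' + 1 ∧ k.Runs (Function.update d a b) n' d' r

/-- The program stops after at most `n` transfers. -/
def RunsIn (p : Prog Addr Blk ρ) (d : Addr → Blk) (n : ℕ) (d' : Addr → Blk) (r : ρ) : Prop :=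
  ∃ k ≤ n, p.Runs d k d' r

lemma runsIn_pure (d : Addr → Blk) (r : ρ) : (pure r : Prog Addr Blk ρ).RunsIn d 0 d r :=
  ⟨0, le_rfl, rfl, rfl, rfl⟩

lemma Runs.bind {p : Prog Addr Blk ρ} {f : ρ → Prog Addr Blk σ} {d d₁ d₂ : Addr → Blk} {n k : ℕ}
    {r : ρ} {s : σ} (h : p.Runs d n d₁ r) (h' : (f r).Runs d₁ k d₂ s) :
    (p.bind f).Runs d (n + k) d₂ s := by
  induction p generalizing d n with
  | ret r₀ =>
    obtain ⟨rfl, rfl, rfl⟩ := h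
    simpa [Prog.bind] using h'
  | read a c ih =>
    obtain ⟨n', rfl, h⟩ := h
    exact ⟨n' + k, by omega, ih _ h⟩
  | write a b c ih =>
    obtain ⟨n', rfl, h⟩ := h
    exact ⟨n' + k, by omega, ih h⟩

lemma RunsIn.bind {p : Prog Addr Blk ρ} {f : ρ → Prog Addr Blk σ} {d d₁ d₂ : Addr → Blk} {n k : ℕ}
    {r : ρ} {s : σ} (h : p.RunsIn d n d₁ r) (h' : (f r).RunsIn d₁ k d₂ s) :
    (p >>= f).RunsIn d (n + k) d₂ s := by
  obtain ⟨n₁, hn, h⟩ := h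
  obtain ⟨k₁, hk, h'⟩ := h'
  exact ⟨n₁ + k₁, by omega, h.bind h'⟩

lemma RunsIn.mono {p : Prog Addr Blk ρ} {d d' : Addr → Blk} {n k : ℕ} {r : ρ}
    (h : p.RunsIn d n d' r) (hk : n ≤ k) : p.RunsIn d k d' r := by
  obtain ⟨n₁, hn, h⟩ := h
  exact ⟨n₁, hn.trans hk, h⟩

lemma runsIn_get (a : Addr) (dec : Blk → ρ) (d : Addr → Blk) :
    (get a dec).RunsIn d 1 d (dec (d a)) := ⟨1, le_rfl, 0, rfl, rfl, rfl, rfl⟩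

lemma runsIn_put (a : Addr) (b : Blk) (d : Addr → Blk) :
    (put a b).RunsIn d 1 (Function.update d a b) () := ⟨1, le_rfl, 0, rfl, rfl, rfl, rfl⟩

/-- The rest of the program after one step, where `b` is the block just read. -/
def advance : Prog Addr Blk ρ → Blk → Prog Addr Blk ρ
  | ret r, _ => ret r
  | read _ k, b => k b
  | write _ _ k, _ => k

/-- The rest of the program after `n` steps, where `s t` is the block read in step `t`. -/
def replay (p : Prog Addr Blk ρ) (s : ℕ → Blk) : ℕ → Prog Addr Blk ρ
  | 0 => p
  | n + 1 => (p.replay s n).advance (s n)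

omit [DecidableEq Addr] in
lemma replay_congr (p : Prog Addr Blk ρ) {s s' : ℕ → Blk} {n : ℕ} (h : ∀ t < n, s t = s' t) :
    p.replay s n = p.replay s' n := by
  induction n with
  | zero => rfl
  | succ n ih => rw [replay, replay, ih fun t ht => h t (by omega), h n (by omega)]

end Prog

/-! ## Compilation of programs to procedures -/

/-- What a program does at its end: stop, start again with another register, or call another
procedure with the argument `k`, whose answer becomes the answer. -/
inductive Exit (Reg κ β : Type) : Type
  | halt (b : β)
  | loop (c : Reg)
  | call (k : κ)

/-- Rename the addresses and the blocks of the cache. -/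
def Instr.map {Addr Addr' : Type} {m m' g : ℕ} {β : Type} (e : Addr → Addr') (i : Fin m → Fin m') :
    Instr Addr m g β → Instr Addr' m' g β
  | .read a j => .read (e a) (i j)
  | .write j a => .write (i j) (e a)
  | .rehash k => .rehash k
  | .halt b => .halt b

section Machine


variable {U : Type} {A B g r m L : ℕ} [NeZero A] [NeZero B] [NeZero L] {Addr₀ Addr : Type}
  {α β κ : Type}

/-- The parts of the cache: the cache of the called procedure, the program counter, the register,
and one block for each step. -/
abbrev Slot (m L : ℕ) : Type := Fin m ⊕ Unit ⊕ Unit ⊕ Fin L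

variable (m L) in
def slotEquiv : Slot m L ≃ Fin (m + (L + 2)) :=
  Fintype.equivFinOfCardEq (by simp; omega)

def counter (t : ℕ) : Block U A B := fun _ => (none, Fin.ofNat A t)

/-- A cache with given parts. -/
def pack (w : Cache U A B m) (t : ℕ) (c : Cell U A) (s : Fin L → Block U A B) :
    Cache U A B (m + (L + 2)) :=
  Sum.elim w (Sum.elim (fun _ => counter t) (Sum.elim (fun _ _ => c) s)) ∘ (slotEquiv m L).symm

def subcache (f : Cache U A B (m + (L + 2))) : Cache U A B m := fun j => f (slotEquiv m L (.inl j))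

def getCounter (f : Cache U A B (m + (L + 2))) : ℕ := (f (slotEquiv m L (.inr (.inl ()))) 0).2.val

def getReg (f : Cache U A B (m + (L + 2))) : Cell U A := f (slotEquiv m L (.inr (.inr (.inl ())))) 0

def stepSlot (m L : ℕ) [NeZero L] (t : ℕ) : Fin (m + (L + 2)) :=
  slotEquiv m L (.inr (.inr (.inr (Fin.ofNat L t))))

def getSlots (f : Cache U A B (m + (L + 2))) : Fin L → Block U A B :=
  fun j => f (slotEquiv m L (.inr (.inr (.inr j))))

@[simp] lemma subcache_pack (w : Cache U A B m) (t : ℕ) (c : Cell U A) (s : Fin L → Block U A B) :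
    subcache (pack w t c s) = w := by
  funext j; simp [subcache, pack]

@[simp] lemma getReg_pack (w : Cache U A B m) (t : ℕ) (c : Cell U A) (s : Fin L → Block U A B) :
    getReg (pack w t c s) = c := by
  simp [getReg, pack]

@[simp] lemma getSlots_pack (w : Cache U A B m) (t : ℕ) (c : Cell U A) (s : Fin L → Block U A B) :
    getSlots (pack w t c s) = s := by
  funext j; simp [getSlots, pack]

lemma getCounter_pack (w : Cache U A B m) {t : ℕ} (ht : t < A) (c : Cell U A)
    (s : Fin L → Block U A B) : getCounter (pack w t c s) = t := by
  simp [getCounter, pack, counter, Nat.mod_eq_of_lt ht]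

lemma pack_update_slot (w : Cache U A B m) (t : ℕ) (c : Cell U A) (s : Fin L → Block U A B)
    (n : ℕ) (b : Block U A B) : Function.update (pack w t c s) (stepSlot m L n) b =
      pack w t c (Function.update s (Fin.ofNat L n) b) := by
  rw [pack, pack, stepSlot, ← Sum.update_elim_inr, ← Sum.update_elim_inr, ← Sum.update_elim_inr,
    Function.update_comp_equiv]
  simp

lemma pack_update_subcache (w : Cache U A B m) (t : ℕ) (c : Cell U A) (s : Fin L → Block U A B)
    (j : Fin m) (b : Block U A B) :
    Function.update (pack w t c s) (slotEquiv m L (.inl j)) b =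
      pack (Function.update w j b) t c s := by
  rw [pack, pack, ← Sum.update_elim_inl, Function.update_comp_equiv]
  simp

lemma pack_stepSlot (w : Cache U A B m) (t : ℕ) (c : Cell U A) (s : Fin L → Block U A B)
    (n : ℕ) : pack w t c s (stepSlot m L n) = s (Fin.ofNat L n) := by
  simp [pack, stepSlot]

/-- One step of the procedure that runs the program `body`, followed, if the program says so, by
the procedure `I`. -/
def machineStep (I : Proc U A B g r Addr₀ m κ β) (e : Addr₀ → Addr) (dummy : Addr)
    (body : Hashes U g r → Cell U A → Prog Addr (Block U A B) (List U × Exit (Cell U A) κ β))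
    (h : Hashes U g r) (f : Cache U A B (m + (L + 2))) :
    PMF (Cache U A B (m + (L + 2)) × List U × Instr Addr (m + (L + 2)) g β) :=
  -- Counters up to `L` belong to the program itself; the value `L + 1` marks the phase in which `I`
  -- runs.
  if getCounter f = L + 1 then
    (I.step h (subcache f)).map fun a =>
      (pack a.1 (L + 1) (getReg f) (getSlots f), a.2.1,
        a.2.2.map e fun j => slotEquiv m L (.inl j))
  else
    PMF.pure <|
      -- A cache cannot hold a continuation. The rest of the program is recomputed in every step
      -- from the log of the blocks of the earlier steps.
      match (body h (getReg f)).replay (fun t => getSlots f (Fin.ofNat L t)) (getCounter f) with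
      | .read a _ =>
          (pack (subcache f) (getCounter f + 1) (getReg f) (getSlots f), [],
            .read a (stepSlot m L (getCounter f)))
      | .write a b _ =>
          (pack (subcache f) (getCounter f + 1) (getReg f)
            (Function.update (getSlots f) (Fin.ofNat L (getCounter f)) b), [],
            .write (stepSlot m L (getCounter f)) a)
      | .ret (out, .halt b) => (f, out, .halt b)
      -- A step must end with an instruction, so a new phase and a call each pay for one dummy read.
      | .ret (out, .loop c) =>
          (pack (subcache f) 0 c (getSlots f), out, .read dummy (stepSlot m L 0))
      | .ret (out, .call k) =>
          (pack (I.load k) (L + 1) (getReg f) (getSlots f), out, .read dummy (stepSlot m L 0))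

/-- The procedure that runs the program `body`, followed, if the program says so, by `I`. -/
def machine (L : ℕ) [NeZero L] (I : Proc U A B g r Addr₀ m κ β) (e : Addr₀ → Addr) (dummy : Addr)
    (arg : α → Cell U A)
    (body : Hashes U g r → Cell U A → Prog Addr (Block U A B) (List U × Exit (Cell U A) κ β)) :
    Proc U A B g r Addr (m + (L + 2)) α β where
  load x := pack (fun _ => counter 0) 0 (arg x) fun _ => counter 0
  step := machineStep I e dummy body

variable [Fintype U] [DecidableEq U] [DecidableEq Addr₀] [DecidableEq Addr]
  {I : Proc U A B g r Addr₀ m κ β} {e : Addr₀ → Addr} {dummy : Addr} {arg : α → Cell U A}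
  {body : Hashes U g r → Cell U A → Prog Addr (Block U A B) (List U × Exit (Cell U A) κ β)}

lemma ofNat_ne_ofNat_of_lt {t n : ℕ} (ht : t < n) (hn : n < L) :
    Fin.ofNat L t ≠ Fin.ofNat L n := by
  intro h
  have := congrArg Fin.val h
  simp only [Fin.ofNat_eq_cast, Fin.val_natCast, Nat.mod_eq_of_lt hn,
    Nat.mod_eq_of_lt (ht.trans hn)] at this
  omega

/-- A phase of the procedure executes the program up to its end. -/
lemma machine_steps (hA : L + 1 < A) {c : Cell U A} {h : Hashes U g r} (w : Cache U A B m)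
    (out : List U) {n : ℕ} {t : ℕ} {s : Fin L → Block U A B} {d d' : Disk U A B Addr}
    {x : List U × Exit (Cell U A) κ β} (ht : t + n ≤ L)
    (hr : ((body h c).replay (fun k => s (Fin.ofNat L k)) t).Runs d n d' x) :
    ∃ s' : Fin L → Block U A B,
      (body h c).replay (fun k => s' (Fin.ofNat L k)) (t + n) = .ret x ∧
      (machine L I e dummy arg body).Steps n ⟨pack w t c s, (d, h), out⟩
        ⟨pack w (t + n) c s', (d', h), out⟩ := by
  induction n generalizing t s d with
  | zero =>
    refine ⟨s, ?_⟩
    cases hp : (body h c).replay (fun k => s (Fin.ofNat L k)) t with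
    | ret y =>
      rw [hp] at hr
      obtain ⟨-, rfl, rfl⟩ := hr
      exact ⟨rfl, .refl _⟩
    | read a k => rw [hp] at hr; obtain ⟨_, h0, _⟩ := hr; omega
    | write a b k => rw [hp] at hr; obtain ⟨_, h0, _⟩ := hr; omega
  | succ n ih =>
    have htA : t < A := by omega
    -- Step `t` only touches slot `t`, which differs from the earlier slots since `t < L`; the
    -- replay of the first `t` steps is therefore unaffected.
    have hre : ∀ b : Block U A B, (body h c).replay
        (fun k => Function.update s (Fin.ofNat L t) b (Fin.ofNat L k)) (t + 1) =
          ((body h c).replay (fun k => s (Fin.ofNat L k)) t).advance b := by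
      intro b
      rw [Prog.replay, Function.update_self]
      congr 1
      refine Prog.replay_congr _ fun k hk => ?_
      rw [Function.update_of_ne (ofNat_ne_ofNat_of_lt hk (by omega))]
    have hstep : ∀ b d₁,
        (((body h c).replay (fun k => s (Fin.ofNat L k)) t).advance b).Runs d₁ n d' x →
        (machine L I e dummy arg body).next ⟨pack w t c s, (d, h), out⟩ = PMF.pure (.inl
          ⟨pack w (t + 1) c (Function.update s (Fin.ofNat L t) b), (d₁, h), out⟩) →
        ∃ s' : Fin L → Block U A B,
          (body h c).replay (fun k => s' (Fin.ofNat L k)) (t + (n + 1)) = .ret x ∧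
          (machine L I e dummy arg body).Steps (n + 1) ⟨pack w t c s, (d, h), out⟩
            ⟨pack w (t + (n + 1)) c s', (d', h), out⟩ := by
      intro b d₁ hb hn
      obtain ⟨s', h1, h2⟩ := ih (t := t + 1) (s := Function.update s (Fin.ofNat L t) b) (d := d₁)
        (by omega) (by rw [hre]; exact hb)
      rw [show t + (n + 1) = t + 1 + n by omega]
      exact ⟨s', h1, .step hn h2⟩
    cases hp : (body h c).replay (fun k => s (Fin.ofNat L k)) t with
    | ret y => rw [hp] at hr; obtain ⟨h0, _⟩ := hr; omega
    | read a k =>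
      rw [hp] at hr hstep
      obtain ⟨_, h0, hr⟩ := hr
      obtain rfl := Nat.succ_injective h0
      refine hstep (d a) d hr ?_
      rw [Proc.next]
      simp only [machine, machineStep, getCounter_pack _ htA, show t ≠ L + 1 by omega, if_false,
        getReg_pack, getSlots_pack, subcache_pack, hp, PMF.pure_bind, Conf.advance,
        pack_update_slot, List.append_nil]
    | write a b k =>
      rw [hp] at hr hstep
      obtain ⟨_, h0, hr⟩ := hr
      obtain rfl := Nat.succ_injective h0
      refine hstep b _ hr ?_
      rw [Proc.next]
      simp only [machine, machineStep, getCounter_pack _ htA, show t ≠ L + 1 by omega, if_false,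
        getReg_pack, getSlots_pack, subcache_pack, hp, PMF.pure_bind, Conf.advance,
        pack_stepSlot, Function.update_self, List.append_nil]

lemma machine_yields_of_halt (hA : L + 1 < A) {c : Cell U A} {h : Hashes U g r}
    (w : Cache U A B m) (out : List U) (s : Fin L → Block U A B) {d d' : Disk U A B Addr}
    {out' : List U} {b : β} (hr : (body h c).RunsIn d L d' (out', .halt b)) :
    (machine L I e dummy arg body).Yields L ⟨pack w 0 c s, (d, h), out⟩
      ⟨(d', h), b, out ++ out'⟩ := by
  obtain ⟨n, hn, hr⟩ := hr
  obtain ⟨s', h1, h2⟩ := machine_steps (I := I) (e := e) (dummy := dummy) (arg := arg)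
    (t := 0) (s := s) hA w out (by omega) hr
  rw [zero_add] at h1 h2
  refine (h2.yields (Proc.yields_of_halt (o := ⟨(d', h), b, out ++ out'⟩) ?_)).mono (by omega)
  rw [Proc.next]
  simp only [machine, machineStep, getCounter_pack _ (show n < A by omega),
    show n ≠ L + 1 by omega, if_false, getReg_pack, getSlots_pack, h1, PMF.pure_bind, Conf.advance]

lemma machine_steps_of_loop (hA : L + 1 < A) {c c' : Cell U A} {h : Hashes U g r}
    (w : Cache U A B m) (out : List U) (s : Fin L → Block U A B) {d d' : Disk U A B Addr} {k : ℕ}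
    (hk : k ≤ L) {out' : List U} (hr : (body h c).RunsIn d k d' (out', .loop c')) :
    ∃ n ≤ k + 1, ∃ s', (machine L I e dummy arg body).Steps n ⟨pack w 0 c s, (d, h), out⟩
      ⟨pack w 0 c' s', (d', h), out ++ out'⟩ := by
  obtain ⟨n, hn, hr⟩ := hr
  obtain ⟨s', h1, h2⟩ := machine_steps (I := I) (e := e) (dummy := dummy) (arg := arg)
    (t := 0) (s := s) hA w out (by omega) hr
  rw [zero_add] at h1 h2
  -- The additional step is the dummy read. It spoils slot 0, which is harmless: the new phase
  -- starts with counter 0 and rewrites each slot before it is replayed.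
  refine ⟨n + 1, by omega, Function.update s' (Fin.ofNat L 0) (d' dummy),
    h2.trans (.step ?_ (.refl _))⟩
  rw [Proc.next]
  simp only [machine, machineStep, getCounter_pack _ (show n < A by omega),
    show n ≠ L + 1 by omega, if_false, getReg_pack, getSlots_pack, h1, PMF.pure_bind, Conf.advance,
    subcache_pack, pack_update_slot]

lemma machine_steps_of_call (hA : L + 1 < A) {c : Cell U A} {h : Hashes U g r}
    (w : Cache U A B m) (s : Fin L → Block U A B) {d d' : Disk U A B Addr} {x : κ}
    (hr : (body h c).RunsIn d L d' ([], .call x)) :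
    ∃ n ≤ L + 1, ∃ s', (machine L I e dummy arg body).Steps n ⟨pack w 0 c s, (d, h), []⟩
      ⟨pack (I.load x) (L + 1) c s', (d', h), []⟩ := by
  obtain ⟨n, hn, hr⟩ := hr
  obtain ⟨s', h1, h2⟩ := machine_steps (I := I) (e := e) (dummy := dummy) (arg := arg)
    (t := 0) (s := s) hA w [] (by omega) hr
  rw [zero_add] at h1 h2
  refine ⟨n + 1, by omega, Function.update s' (Fin.ofNat L 0) (d' dummy),
    h2.trans (.step ?_ (.refl _))⟩
  rw [Proc.next]
  simp only [machine, machineStep, getCounter_pack _ (show n < A by omega),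
    show n ≠ L + 1 by omega, if_false, getReg_pack, getSlots_pack, h1, PMF.pure_bind, Conf.advance,
    pack_update_slot, List.append_nil]

/-! ### The called procedure -/

/-- `φ` embeds the disk of the called procedure. -/
structure Embeds (e : Addr₀ → Addr) (φ : Disk U A B Addr₀ → Disk U A B Addr) : Prop where
  read (d a) : φ d (e a) = d a
  write (d a b) : φ (Function.update d a b) = Function.update (φ d) (e a) b

variable {φ : Disk U A B Addr₀ → Disk U A B Addr}

omit [DecidableEq U] [Fintype U] [NeZero A] [NeZero B] [DecidableEq Addr] in
lemma Embeds.injective {Addr : Type} [DecidableEq Addr] {e : Addr₀ → Addr}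
    {φ : Disk U A B Addr₀ → Disk U A B Addr} (hφ : Embeds e φ) : Function.Injective φ := by
  intro d d' h
  funext a
  rw [← hφ.read d, h, hφ.read]

def mapState (φ : Disk U A B Addr₀ → Disk U A B Addr) (s : State U A B g r Addr₀) :
    State U A B g r Addr := (φ s.1, s.2)

def liftConf (φ : Disk U A B Addr₀ → Disk U A B Addr) (c : Cell U A) (s : Fin L → Block U A B)
    (x : Conf U A B g r Addr₀ m) : Conf U A B g r Addr (m + (L + 2)) :=
  ⟨pack x.cache (L + 1) c s, mapState φ x.state, x.out⟩

def liftOutcome (φ : Disk U A B Addr₀ → Disk U A B Addr) (o : Outcome U A B g r Addr₀ β) :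
    Outcome U A B g r Addr β := ⟨mapState φ o.state, o.answer, o.out⟩

/-- In the calling phase the machine does what `I` does, on the part of the cache and of the disk
that belongs to `I`. So even the randomness is the same, and one step of the machine is the image of
one step of `I`. Law and cost of a call follow by induction on the number of steps. -/
lemma machine_next_lift (hA : L + 1 < A) (hφ : Embeds e φ) (c : Cell U A)
    (s : Fin L → Block U A B) (x : Conf U A B g r Addr₀ m) :
    (machine L I e dummy arg body).next (liftConf φ c s x) =
      (I.next x).map (Sum.map (liftConf φ c s) (liftOutcome φ)) := by
  rw [Proc.next, Proc.next, PMF.map_bind]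
  simp only [machine, machineStep, liftConf, getCounter_pack _ hA, if_true, getReg_pack,
    getSlots_pack, subcache_pack, mapState, PMF.bind_map]
  congr 1
  funext a
  obtain ⟨w, out, i⟩ := a
  cases i with
  | read a j => simp [Instr.map, Conf.advance, PMF.pure_map, hφ.read, pack_update_subcache,
      liftConf, mapState]
  | write j a =>
    have : pack w (L + 1) c s (slotEquiv m L (.inl j)) = w j := by simp [pack]
    simp [Instr.map, Conf.advance, PMF.pure_map, hφ.write, liftConf, mapState, this]
  | rehash k =>
    simp [Instr.map, Conf.advance, PMF.map_comp, Function.comp_def, liftConf, mapState]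
  | halt b => simp [Instr.map, Conf.advance, PMF.pure_map, liftOutcome, mapState]

lemma liftOutcome_injective (hφ : Embeds e φ) :
    Function.Injective (liftOutcome φ : Outcome U A B g r Addr₀ β → _) := by
  rintro ⟨⟨d, h⟩, b, o⟩ ⟨⟨d', h'⟩, b', o'⟩ heq
  simp only [liftOutcome, mapState, Outcome.mk.injEq, Prod.mk.injEq] at heq
  obtain ⟨⟨h1, rfl⟩, rfl, rfl⟩ := heq
  rw [hφ.injective h1]

lemma machine_haltBy_lift (hA : L + 1 < A) (hφ : Embeds e φ) (c : Cell U A)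
    (s : Fin L → Block U A B) (n : ℕ) (x : Conf U A B g r Addr₀ m)
    (o : Outcome U A B g r Addr₀ β) :
    (machine L I e dummy arg body).haltBy n (liftConf φ c s x) (liftOutcome φ o) =
      I.haltBy n x o := by
  classical
  induction n generalizing x with
  | zero => rfl
  | succ n ih =>
    rw [Proc.haltBy, Proc.haltBy, machine_next_lift hA hφ, tsum_map_mul]
    refine tsum_congr fun y => ?_
    rcases y with y | y
    · simp only [Sum.map_inl, Sum.elim_inl, ih]
    · simp only [Sum.map_inr, Sum.elim_inr, PMF.pure_apply, (liftOutcome_injective hφ).eq_iff]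

/-- The complement of the preceding lemma: a call never ends outside the image of `liftOutcome φ`,
so its law is entirely determined by that of `I`. -/
lemma machine_haltBy_lift_of_forall_ne (hA : L + 1 < A) (hφ : Embeds e φ) (c : Cell U A)
    (s : Fin L → Block U A B) (n : ℕ) (x : Conf U A B g r Addr₀ m)
    (o : Outcome U A B g r Addr β) (ho : ∀ o₀, liftOutcome φ o₀ ≠ o) :
    (machine L I e dummy arg body).haltBy n (liftConf φ c s x) o = 0 := by
  classical
  induction n generalizing x with
  | zero => rfl
  | succ n ih =>
    rw [Proc.haltBy, machine_next_lift hA hφ, tsum_map_mul, ENNReal.tsum_eq_zero]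
    rintro (y | y)
    · simp only [Sum.map_inl, Sum.elim_inl, ih, mul_zero]
    · simp [PMF.pure_apply, (ho y).symm]

lemma machine_costFrom_lift (hA : L + 1 < A) (hφ : Embeds e φ) (c : Cell U A)
    (s : Fin L → Block U A B) (x : Conf U A B g r Addr₀ m) :
    (machine L I e dummy arg body).costFrom (liftConf φ c s x) = I.costFrom x := by
  refine iSup_congr fun n => ?_
  induction n generalizing x with
  | zero => rfl
  | succ n ih =>
    rw [Proc.costBy, Proc.costBy, machine_next_lift hA hφ, tsum_map_mul]
    refine tsum_congr fun y => ?_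
    rcases y with y | y
    · simp only [Sum.map_inl, Sum.elim_inl, ih]
    · simp

/-- The law of the state after a program that calls `I`. -/
lemma machine_call_stateLaw (hA : L + 1 < A) (hφ : Embeds e φ) {a : α} {h : Hashes U g r}
    {d : Disk U A B Addr} {d₀ : Disk U A B Addr₀} {x : κ}
    (hr : (body h (arg a)).RunsIn d L (φ d₀) ([], .call x)) :
    (machine L I e dummy arg body).stateLaw a (d, h) =
      push (mapState φ) (I.stateLaw x (d₀, h)) := by
  classical
  obtain ⟨n, hn, s', hs⟩ := machine_steps_of_call (I := I) (e := e) (dummy := dummy) (arg := arg)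
    hA (fun _ => counter 0) (fun _ => counter 0) hr
  have key : ∀ o, (machine L I e dummy arg body).law a (d, h) o =
      (machine L I e dummy arg body).lawFrom (liftConf φ (arg a) s' (I.start x (d₀, h))) o :=
    hs.lawFrom_eq
  have hinj : Function.Injective (mapState φ : State U A B g r Addr₀ → _) := by
    rintro ⟨d, h⟩ ⟨d', h'⟩ heq
    simp only [mapState, Prod.mk.injEq] at heq
    rw [hφ.injective heq.1, heq.2]
  funext s₁
  simp only [Proc.stateLaw, key]
  -- As `mapState φ` is injective, at most one state contributes to the weight pushed to `s₁`.
  by_cases hs₁ : ∃ s₀, mapState φ s₀ = s₁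
  · obtain ⟨s₀, rfl⟩ := hs₁
    rw [push, tsum_eq_single s₀]
    · rw [PMF.pure_apply, if_pos rfl, mul_one]
      refine tsum_congr fun p => ?_
      refine iSup_congr fun n => ?_
      exact machine_haltBy_lift hA hφ _ _ n _ ⟨s₀, p.1, p.2⟩
    · intro b hb
      rw [PMF.pure_apply, if_neg (fun h => hb (hinj h).symm), mul_zero]
  · push Not at hs₁
    rw [push, ENNReal.tsum_eq_zero.2, ENNReal.tsum_eq_zero.2]
    · intro s₀
      rw [PMF.pure_apply, if_neg (hs₁ s₀).symm, mul_zero]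
    · intro p
      refine ENNReal.iSup_eq_zero.2 fun n => ?_
      refine machine_haltBy_lift_of_forall_ne hA hφ _ _ n _ _ fun o₀ ho => hs₁ o₀.state ?_
      exact congrArg Outcome.state ho

lemma machine_call_expectedCost (hA : L + 1 < A) (hφ : Embeds e φ) {a : α} {h : Hashes U g r}
    {d : Disk U A B Addr} {d₀ : Disk U A B Addr₀} {x : κ}
    (hr : (body h (arg a)).RunsIn d L (φ d₀) ([], .call x)) :
    (machine L I e dummy arg body).expectedCost a (d, h) ≤
      (L + 1 : ℕ) + I.expectedCost x (d₀, h) := by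
  obtain ⟨n, hn, s', hs⟩ := machine_steps_of_call (I := I) (e := e) (dummy := dummy) (arg := arg)
    hA (fun _ => counter 0) (fun _ => counter 0) hr
  have key : (machine L I e dummy arg body).expectedCost a (d, h) =
      n + (machine L I e dummy arg body).costFrom (liftConf φ (arg a) s' (I.start x (d₀, h))) :=
    hs.costFrom_eq
  rw [key, machine_costFrom_lift hA hφ]
  gcongr
  exact le_rfl

/-- A procedure without any function. -/
def idle (m : ℕ) (b : β) : Proc U A B g r Addr₀ m κ β where
  load _ _ := counter 0
  step _ f := PMF.pure (f, [], .halt b)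

end Machine

end

/-! ### The pool of blocks: invariants, and insertion where no block has to be split -/

section

/-! ## The data structure -/

/-- A slot for a queue: a group and an index in this group. -/
abbrev QueueId (G B : ℕ) : Type := Fin G × Fin B

/-- The memory of the multiqueue without the dictionary.  The queues of a group keep their first
elements, the base, in blocks that they share; the other elements of a queue are in a stack of
blocks of its own. -/
structure Mem (U : Type) (G B P : ℕ) where
  base : Fin G → Fin B → Fin P
  /-- sizes of the bases -/
  cnt : Fin G → Fin B → ℕ
  /-- tops of the stacks -/
  top : Fin G → Fin B → Option (Fin P)
  /-- links of the stacks and of the list of free blocks -/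
  next : Fin P → Option (Fin P)
  free : Option (Fin P)
  data : Fin P → Finset (U × QueueId G B)

/-- What a block of the pool is used for. -/
inductive Role (G B : ℕ) : Type
  | free
  | shared (g : Fin G)
  | own (q : QueueId G B)

/-- `l` is the linked list with head `h`. -/
def Chain {α : Type} (next : α → Option α) : Option α → List α → Prop
  | h, [] => h = none
  | h, a :: l => h = some a ∧ Chain next (next a) l

lemma Chain.congr {α : Type} {next next' : α → Option α} {h : Option α} {l : List α}
    (hl : Chain next h l) (hn : ∀ a ∈ l, next a = next' a) : Chain next' h l := by
  induction l generalizing h with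
  | nil => exact hl
  | cons a l ih =>
    refine ⟨hl.1, ?_⟩
    rw [← hn a (by simp)]
    exact ih hl.2 fun b hb => hn b (by simp [hb])

lemma Chain.update {α : Type} [DecidableEq α] {next : α → Option α} {h : Option α} {l : List α}
    (hl : Chain next h l) {a : α} (ha : a ∉ l) (v : Option α) :
    Chain (Function.update next a v) h l :=
  hl.congr fun b hb => by rw [Function.update_of_ne]; rintro rfl; exact ha hb

lemma Chain.head_eq {α : Type} {next : α → Option α} {h : Option α} {l : List α}
    (hl : Chain next h l) : h = l.head? := by
  cases l with
  | nil => exact hl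
  | cons a l => exact hl.1

lemma exists_chain {α : Type} [DecidableEq α] (l : List α) (hl : l.Nodup) :
    ∃ next : α → Option α, Chain next l.head? l := by
  induction l with
  | nil => exact ⟨fun _ => none, rfl⟩
  | cons a l ih =>
    rw [List.nodup_cons] at hl
    obtain ⟨next, hn⟩ := ih hl.2
    refine ⟨Function.update next a l.head?, rfl, ?_⟩
    rw [Function.update_self]
    exact hn.update hl.1 _


variable {U : Type} [DecidableEq U] {G B P : ℕ}

/-- The blocks of the pool are properly linked. -/
structure Linked (M : Mem U G B P) (stk : QueueId G B → List (Fin P)) (fr : List (Fin P))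
    (role : Fin P → Role G B) : Prop where
  stk_chain (q : QueueId G B) : Chain M.next (M.top q.1 q.2) (stk q)
  fr_chain : Chain M.next M.free fr
  stk_nodup (q) : (stk q).Nodup
  fr_nodup : fr.Nodup
  mem_fr (p) : p ∈ fr ↔ role p = .free
  mem_stk (p q) : p ∈ stk q ↔ role p = .own q
  mem_shared (p g) : (∃ j, M.base g j = p) ↔ role p = .shared g

/-- The blocks of the pool contain the right elements, where `loc x` is the block of `x`, together
with the queue of `x`. -/
structure Filled (M : Mem U G B P) (loc : U → Option (Fin P × QueueId G B))
    (stk : QueueId G B → List (Fin P)) : Prop where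
  data_iff (x p q) : (x, q) ∈ M.data p ↔ loc x = some (p, q)
  card_le (p) : (M.data p).card ≤ B
  cnt_eq (g j) : M.cnt g j = ((M.data (M.base g j)).filter fun y => y.2 = (g, j)).card
  place {x p q} : loc x = some (p, q) → M.base q.1 q.2 = p ∨ p ∈ stk q
  full {g j} : stk (g, j) ≠ [] → M.cnt g j = B
  stack_full {q t l} : stk q = t :: l → ∀ p ∈ l, (M.data p).card = B

/-- No stack has an empty block at the top. -/
def TopsNonempty (M : Mem U G B P) (stk : QueueId G B → List (Fin P)) : Prop :=
  ∀ q t l, stk q = t :: l → (M.data t).Nonempty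

/-- Two shared blocks of the group `g` that could be merged. -/
structure Mergeable (M : Mem U G B P) (g : Fin G) (p p' : Fin P) : Prop where
  ne : p ≠ p'
  left : ∃ j, M.base g j = p
  right : ∃ j, M.base g j = p'
  card_le : (M.data p).card + (M.data p').card ≤ B

lemma Mergeable.symm {M : Mem U G B P} {g : Fin G} {p p' : Fin P} (h : Mergeable M g p p') :
    Mergeable M g p' p := ⟨h.ne.symm, h.right, h.left, by rw [add_comm]; exact h.card_le⟩

/-- At most `k` merges are missing in the group `g`. -/
def Dense (M : Mem U G B P) (k : ℕ) (g : Fin G) : Prop :=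
  ∃ E : Finset (Fin P), E.card ≤ k ∧ (∀ a b, Mergeable M g a b → a ∈ E ∨ b ∈ E) ∧
    ∀ a ∈ E, ∀ b ∈ E, ¬ Mergeable M g a b

lemma Dense.mono {M : Mem U G B P} {k n : ℕ} {g : Fin G} (h : Dense M k g) (hk : k ≤ n) :
    Dense M n g := by
  obtain ⟨E, h1, h2⟩ := h
  exact ⟨E, h1.trans hk, h2⟩

lemma Dense.not_mergeable {M : Mem U G B P} {g : Fin G} (h : Dense M 0 g) (a b : Fin P) :
    ¬ Mergeable M g a b := by
  obtain ⟨E, h1, h2, -⟩ := h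
  intro hab
  obtain rfl : E = ∅ := by simpa using h1
  simpa using h2 a b hab

lemma dense_of_forall {M : Mem U G B P} {g : Fin G} {k : ℕ} (h : ∀ a b, ¬ Mergeable M g a b) :
    Dense M k g := ⟨∅, by simp, fun a b hab => (h a b hab).elim, by simp⟩

variable {M : Mem U G B P} {loc : U → Option (Fin P × QueueId G B)}
  {stk : QueueId G B → List (Fin P)} {fr : List (Fin P)} {role : Fin P → Role G B}

/-- A block has a single role. This one function replaces all the disjointness statements between
free blocks, shared blocks of different groups and stacks of different queues. -/
lemma Linked.role_base (hL : Linked M stk fr role) (g : Fin G) (j : Fin B) :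
    role (M.base g j) = .shared g := (hL.mem_shared _ _).1 ⟨j, rfl⟩

lemma Linked.base_not_mem_stk (hL : Linked M stk fr role) (g : Fin G) (j : Fin B)
    (q : QueueId G B) : M.base g j ∉ stk q := by
  rw [hL.mem_stk, hL.role_base]; simp

lemma Linked.group_eq (hL : Linked M stk fr role) {g g' : Fin G} {j j' : Fin B}
    (h : M.base g j = M.base g' j') : g = g' := by
  have h1 := hL.role_base g j
  rw [h, hL.role_base] at h1
  exact (Role.shared.inj h1).symm

lemma Linked.queue_eq (hL : Linked M stk fr role) {p : Fin P} {q q' : QueueId G B}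
    (h : p ∈ stk q) (h' : p ∈ stk q') : q = q' := by
  rw [hL.mem_stk] at h h'
  rw [h] at h'
  exact Role.own.inj h'

lemma Linked.data_free (hL : Linked M stk fr role) (hF : Filled M loc stk) {p : Fin P}
    (hp : p ∈ fr) : M.data p = ∅ := by
  rw [Finset.eq_empty_iff_forall_notMem]
  rintro ⟨x, q⟩ hx
  rw [hF.data_iff] at hx
  rw [hL.mem_fr] at hp
  rcases hF.place hx with h | h
  · rw [← h, hL.role_base] at hp; simp at hp
  · rw [hL.mem_stk, hp] at h; simp at h

lemma Linked.queue_of_mem_stk (hL : Linked M stk fr role) (hF : Filled M loc stk) {p : Fin P}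
    {q q' : QueueId G B} (hp : p ∈ stk q) {x : U} (hx : (x, q') ∈ M.data p) : q' = q := by
  rw [hF.data_iff] at hx
  rcases hF.place hx with h | h
  · rw [← h] at hp; exact (hL.base_not_mem_stk _ _ _ hp).elim
  · exact hL.queue_eq h hp

/-- A block to which a base pointer leads is in no stack, so all its entries are base entries; and
two groups never share a block. -/
lemma Linked.base_of_mem_data (hL : Linked M stk fr role) (hF : Filled M loc stk) {g : Fin G}
    {j : Fin B} {x : U} {q : QueueId G B} (hx : (x, q) ∈ M.data (M.base g j)) :
    q.1 = g ∧ M.base g q.2 = M.base g j := by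
  rw [hF.data_iff] at hx
  rcases hF.place hx with h | h
  · have := hL.group_eq h
    subst this
    exact ⟨rfl, h⟩
  · exact (hL.base_not_mem_stk _ _ _ h).elim

lemma Filled.cnt_le (hF : Filled M loc stk) (g : Fin G) (j : Fin B) :
    M.cnt g j ≤ (M.data (M.base g j)).card := by
  rw [hF.cnt_eq]; exact Finset.card_filter_le _ _

/-- The number of elements of a shared block can be computed from the sizes of the bases. -/
lemma Linked.sum_cnt (hL : Linked M stk fr role) (hF : Filled M loc stk) (g : Fin G) (j : Fin B) :
    ∑ k with M.base g k = M.base g j, M.cnt g k = (M.data (M.base g j)).card := by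
  -- The entries are sorted by the index of their queue, the group being the same for all. Thanks to
  -- this formula mergeable pairs are found from the pointers and counters of the group alone, with
  -- two reads.
  rw [Finset.card_eq_sum_card_fiberwise (f := fun y => y.2.2)
    (t := Finset.univ.filter fun k => M.base g k = M.base g j)]
  · refine Finset.sum_congr rfl fun k hk => ?_
    rw [Finset.mem_filter] at hk
    rw [hF.cnt_eq, hk.2]
    congr 1
    ext ⟨x, q⟩
    simp only [Finset.mem_filter, and_congr_right_iff]
    intro hx
    have := hL.base_of_mem_data hF hx
    constructor
    · rintro rfl; rfl
    · rintro rfl; rw [← this.1]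
  · rintro ⟨x, q⟩ hx
    simpa using (hL.base_of_mem_data hF hx).2

lemma update_update_apply {α β γ : Type} [DecidableEq α] [DecidableEq β] (f : α → β → γ) (a : α)
    (b : β) (c : γ) (a' : α) (b' : β) :
    Function.update f a (Function.update (f a) b c) a' b' =
      if (a', b') = (a, b) then c else f a' b' := by
  by_cases ha : a' = a
  · subst ha
    by_cases hb : b' = b
    · subst hb; simp
    · simp [hb]
  · simp [ha]

/-- Where the dictionary says that an element is: in the base of a queue or in a certain block. -/
def dict (M : Mem U G B P) (loc : U → Option (Fin P × QueueId G B)) (x : U) :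
    Option (QueueId G B ⊕ Fin P) :=
  (loc x).map fun y => if M.base y.2.1 y.2.2 = y.1 then .inl y.2 else .inr y.1

/-- The queue of an element. -/
def queueOf (loc : U → Option (Fin P × QueueId G B)) (x : U) : Option (QueueId G B) :=
  (loc x).map Prod.snd

/-! ### Insertion into a shared block with room -/

def Mem.addBase (M : Mem U G B P) (x : U) (g : Fin G) (j : Fin B) : Mem U G B P :=
  { M with
    data := Function.update M.data (M.base g j) (insert (x, (g, j)) (M.data (M.base g j)))
    cnt := Function.update M.cnt g (Function.update (M.cnt g) j (M.cnt g j + 1)) }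

lemma Linked.addBase (hL : Linked M stk fr role) (x : U) (g : Fin G) (j : Fin B) :
    Linked (M.addBase x g j) stk fr role := by
  obtain ⟨h1, h2, h3, h4, h5, h6, h7⟩ := hL
  exact ⟨h1, h2, h3, h4, h5, h6, h7⟩

lemma Filled.notMem_of_loc_eq_none (hF : Filled M loc stk) {x : U} (hx : loc x = none)
    (p : Fin P) (q : QueueId G B) : (x, q) ∉ M.data p := by
  rw [hF.data_iff, hx]; simp

lemma Filled.addBase (hF : Filled M loc stk) (hL : Linked M stk fr role) {x : U}
    (hx : loc x = none) {g : Fin G} {j : Fin B} (hcard : (M.data (M.base g j)).card < B) :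
    Filled (M.addBase x g j) (Function.update loc x (some (M.base g j, (g, j)))) stk where
  data_iff y p q := by
    have := hF.data_iff y p q
    have h2 := hF.notMem_of_loc_eq_none hx
    simp only [Mem.addBase, Function.update_apply]
    split_ifs with h3 h4 h4 <;> grind
  card_le p := by
    have := hF.card_le p
    simp only [Mem.addBase, Function.update_apply]
    split_ifs with h
    · exact (Finset.card_insert_le _ _).trans hcard
    · exact this
  cnt_eq g' j' := by
    have h1 := hF.cnt_eq g' j'
    have h2 := hF.notMem_of_loc_eq_none hx
    simp only [Mem.addBase, update_update_apply, Function.update_apply]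
    split_ifs with h3 h4 h4
    · simp only [Prod.mk.injEq] at h3
      obtain ⟨rfl, rfl⟩ := h3
      rw [Finset.filter_insert, if_pos rfl, Finset.card_insert_of_notMem (by simp [h2]), h1]
    · simp only [Prod.mk.injEq] at h3
      obtain ⟨rfl, rfl⟩ := h3
      exact (h4 rfl).elim
    · rw [Finset.filter_insert, if_neg (fun h => h3 h.symm), h1, h4]
    · exact h1
  place {y p q} h := by
    simp only [Function.update_apply] at h
    split_ifs at h with h1
    · simp only [Option.some.injEq, Prod.mk.injEq] at h
      obtain ⟨rfl, rfl⟩ := h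
      exact .inl rfl
    · exact hF.place h
  full {g' j'} h := by
    have h1 := hF.full h
    simp only [Mem.addBase, update_update_apply]
    split_ifs with h2
    · simp only [Prod.mk.injEq] at h2
      obtain ⟨rfl, rfl⟩ := h2
      -- A queue with a stack has `B` elements in its base and thus no room in its shared block:
      -- this case is contradictory.
      have := hF.cnt_le g' j'
      omega
    · exact h1
  stack_full {q t l} h p hp := by
    simp only [Mem.addBase, Function.update_apply]
    rw [if_neg]
    · exact hF.stack_full h p hp
    · rintro rfl
      exact hL.base_not_mem_stk g j q (by rw [h]; simp [hp])

lemma TopsNonempty.addBase (hT : TopsNonempty M stk) (x : U) (g : Fin G) (j : Fin B) :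
    TopsNonempty (M.addBase x g j) stk := by
  intro q t l h
  have := hT q t l h
  simp only [Mem.addBase, Function.update_apply]
  split_ifs
  · simp
  · exact this

/-- Sizes only grow and no pointer changes, so no new pair fits into one block. -/
lemma not_mergeable_addBase (h : ∀ g a b, ¬ Mergeable M g a b) (x : U) (g : Fin G) (j : Fin B)
    (g' : Fin G) (a b : Fin P) : ¬ Mergeable (M.addBase x g j) g' a b := by
  have key : ∀ p, (M.data p).card ≤ ((M.addBase x g j).data p).card := by
    intro p
    simp only [Mem.addBase, Function.update_apply]
    split_ifs with hp
    · rw [hp]; exact Finset.card_le_card (Finset.subset_insert _ _)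
    · exact le_rfl
  intro hab
  exact h g' a b ⟨hab.ne, hab.left, hab.right,
    (Nat.add_le_add (key a) (key b)).trans hab.card_le⟩

lemma dict_update (M : Mem U G B P) (loc : U → Option (Fin P × QueueId G B)) (x : U) (p : Fin P)
    (q : QueueId G B) : dict M (Function.update loc x (some (p, q))) =
      Function.update (dict M loc) x (some (if M.base q.1 q.2 = p then .inl q else .inr p)) := by
  funext y
  by_cases h : y = x
  · subst h; simp [dict]
  · simp [dict, h]

/-! ### Insertion into a stack -/

def Mem.addData (M : Mem U G B P) (x : U) (q : QueueId G B) (p : Fin P) : Mem U G B P :=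
  { M with data := Function.update M.data p (insert (x, q) (M.data p)) }

/-- Pop `n` from the list of free blocks and push it on the stack of `(g, j)`. -/
def Mem.pushBlock (M : Mem U G B P) (g : Fin G) (j : Fin B) (n : Fin P) : Mem U G B P :=
  { M with
    free := M.next n
    next := Function.update M.next n (M.top g j)
    top := Function.update M.top g (Function.update (M.top g) j (some n)) }

lemma Linked.addData (hL : Linked M stk fr role) (x : U) (q : QueueId G B) (p : Fin P) :
    Linked (M.addData x q p) stk fr role := by
  obtain ⟨h1, h2, h3, h4, h5, h6, h7⟩ := hL
  exact ⟨h1, h2, h3, h4, h5, h6, h7⟩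

lemma Linked.pushBlock {n : Fin P} (hL : Linked M stk (n :: fr) role) (g : Fin G) (j : Fin B) :
    Linked (M.pushBlock g j n) (Function.update stk (g, j) (n :: stk (g, j))) fr
      (Function.update role n (.own (g, j))) := by
  have hn : role n = .free := (hL.mem_fr n).1 (by simp)
  have hnfr : n ∉ fr := (List.nodup_cons.1 hL.fr_nodup).1
  have hnstk : ∀ q, n ∉ stk q := fun q => by rw [hL.mem_stk, hn]; simp
  refine ⟨fun q => ?_, ?_, fun q => ?_, (List.nodup_cons.1 hL.fr_nodup).2, fun p => ?_,
    fun p q => ?_, fun p g' => ?_⟩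
  · simp only [Mem.pushBlock, update_update_apply, Prod.mk.eta]
    by_cases hq : q = (g, j)
    · subst hq
      simp only [Function.update_self, if_true]
      refine ⟨rfl, ?_⟩
      rw [Function.update_self]
      exact (hL.stk_chain (g, j)).update (hnstk _) _
    · rw [if_neg hq, Function.update_of_ne hq]
      exact (hL.stk_chain q).update (hnstk _) _
  · exact hL.fr_chain.2.update hnfr _
  · by_cases hq : q = (g, j)
    · subst hq; simp [hnstk, hL.stk_nodup]
    · rw [Function.update_of_ne hq]; exact hL.stk_nodup q
  · have := hL.mem_fr p
    by_cases hp : p = n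
    · subst hp; simp [hnfr]
    · simpa [hp] using this
  · have := hL.mem_stk p q
    by_cases hp : p = n
    · subst hp
      by_cases hq : q = (g, j)
      · subst hq; simp
      · simp [hq, hnstk, Ne.symm hq]
    · by_cases hq : q = (g, j)
      · subst hq; simp [hp, this]
      · simp [hp, hq, this]
  · change (∃ k, M.base g' k = p) ↔ _
    have := hL.mem_shared p g'
    by_cases hp : p = n
    · subst hp
      simpa [hn] using this
    · simpa [hp] using this

/-- A stack may only be started on a full base, whence `hcnt`, and a top may only be covered when it
is full, whence `htop`. When this is used the new top is still empty; therefore nonempty tops are a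
condition separate from `Filled`. -/
lemma Filled.pushBlock {n : Fin P} (hF : Filled M loc stk) (g : Fin G) (j : Fin B)
    (hcnt : M.cnt g j = B) (htop : ∀ t l, stk (g, j) = t :: l → (M.data t).card = B) :
    Filled (M.pushBlock g j n) loc (Function.update stk (g, j) (n :: stk (g, j))) where
  data_iff := hF.data_iff
  card_le := hF.card_le
  cnt_eq := hF.cnt_eq
  place {x p q} h := by
    rcases hF.place h with h | h
    · exact .inl h
    · right
      by_cases hq : q = (g, j)
      · subst hq; simp [h]
      · simpa [hq] using h
  full {g' j'} h := by
    by_cases hq : (g', j') = (g, j)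
    · simp only [Prod.mk.injEq] at hq
      obtain ⟨rfl, rfl⟩ := hq
      exact hcnt
    · rw [Function.update_of_ne hq] at h
      exact hF.full h
  stack_full {q t l} h p hp := by
    by_cases hq : q = (g, j)
    · subst hq
      rw [Function.update_self, List.cons.injEq] at h
      obtain ⟨rfl, rfl⟩ := h
      cases hs : stk (g, j) with
      | nil => rw [hs] at hp; simp at hp
      | cons t l =>
        rw [hs, List.mem_cons] at hp
        rcases hp with rfl | hp
        · exact htop _ _ hs
        · exact hF.stack_full hs p hp
    · rw [Function.update_of_ne hq] at h
      exact hF.stack_full h p hp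

lemma Filled.addData (hF : Filled M loc stk) (hL : Linked M stk fr role) {x : U}
    (hx : loc x = none) {q : QueueId G B} {t : Fin P} {l : List (Fin P)} (ht : stk q = t :: l)
    (hcard : (M.data t).card < B) :
    Filled (M.addData x q t) (Function.update loc x (some (t, q))) stk where
  data_iff y p q := by
    have := hF.data_iff y p q
    have h2 := hF.notMem_of_loc_eq_none hx
    simp only [Mem.addData, Function.update_apply]
    split_ifs with h3 h4 h4 <;> grind
  card_le p := by
    have := hF.card_le p
    simp only [Mem.addData, Function.update_apply]
    split_ifs with h
    · exact (Finset.card_insert_le _ _).trans hcard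
    · exact this
  cnt_eq g' j' := by
    have h1 := hF.cnt_eq g' j'
    simp only [Mem.addData, Function.update_apply]
    rw [if_neg]
    · exact h1
    · rintro rfl
      exact hL.base_not_mem_stk g' j' q (by rw [ht]; simp)
  place {y p q} h := by
    simp only [Function.update_apply] at h
    split_ifs at h with h1
    · simp only [Option.some.injEq, Prod.mk.injEq] at h
      obtain ⟨rfl, rfl⟩ := h
      exact .inr (by rw [ht]; simp)
    · exact hF.place h
  full h := hF.full h
  stack_full {q' t' l'} h p hp := by
    simp only [Mem.addData, Function.update_apply]
    split_ifs with h1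
    · subst h1
      obtain rfl := hL.queue_eq (q := q) (q' := q') (p := p) (by rw [ht]; simp)
        (by rw [h]; simp [hp])
      rw [ht, List.cons.injEq] at h
      obtain ⟨rfl, rfl⟩ := h
      have := hL.stk_nodup q
      rw [ht, List.nodup_cons] at this
      exact (this.1 hp).elim
    · exact hF.stack_full h p hp

lemma not_mergeable_addData (h : ∀ g a b, ¬ Mergeable M g a b) (x : U) (q : QueueId G B)
    (p : Fin P) (g' : Fin G) (a b : Fin P) : ¬ Mergeable (M.addData x q p) g' a b := by
  have key : ∀ p', (M.data p').card ≤ ((M.addData x q p).data p').card := by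
    intro p'
    simp only [Mem.addData, Function.update_apply]
    split_ifs with hp
    · rw [hp]; exact Finset.card_le_card (Finset.subset_insert _ _)
    · exact le_rfl
  intro hab
  exact h g' a b ⟨hab.ne, hab.left, hab.right,
    (Nat.add_le_add (key a) (key b)).trans hab.card_le⟩

/-- The block `p` that receives the new element is exempted in the hypothesis, since it may have
been pushed while empty. -/
lemma TopsNonempty.addData (hT : ∀ q t l, stk q = t :: l → t ≠ p → (M.data t).Nonempty)
    (x : U) (q : QueueId G B) : TopsNonempty (M.addData x q p) stk := by
  intro q t l h
  simp only [Mem.addData, Function.update_apply]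
  split_ifs with hp
  · simp
  · exact hT q t l h hp

end

/-! ### Splitting and merging shared blocks -/

section

variable {U : Type} [DecidableEq U] {G B P : ℕ}
variable {M : Mem U G B P} {loc : U → Option (Fin P × QueueId G B)}
  {stk : QueueId G B → List (Fin P)} {fr : List (Fin P)} {role : Fin P → Role G B}

/-! ### Insertion into a full shared block -/

/-- Move the base of the queue `(g, j)` to the free block `n`, and add `x` to it. -/
def Mem.split (M : Mem U G B P) (x : U) (g : Fin G) (j : Fin B) (n : Fin P) : Mem U G B P :=
  { M with
    free := M.next n
    base := Function.update M.base g (Function.update (M.base g) j n)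
    cnt := Function.update M.cnt g (Function.update (M.cnt g) j (M.cnt g j + 1))
    data := Function.update
      (Function.update M.data (M.base g j)
        ((M.data (M.base g j)).filter fun y => ¬ y.2 = (g, j)))
      n (insert (x, (g, j)) ((M.data (M.base g j)).filter fun y => y.2 = (g, j))) }

/-- The locations of the elements after a split. -/
def splitLoc (loc : U → Option (Fin P × QueueId G B)) (x : U) (q : QueueId G B) (n : Fin P) :
    U → Option (Fin P × QueueId G B) :=
  Function.update (fun y => (loc y).map fun z => (if z.2 = q then n else z.1, z.2)) x (some (n, q))

lemma splitLoc_eq_some {x y : U} {q q' : QueueId G B} {n p : Fin P} :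
    splitLoc loc x q n y = some (p, q') ↔
      (y = x ∧ p = n ∧ q' = q) ∨ (y ≠ x ∧ q' = q ∧ p = n ∧ ∃ p', loc y = some (p', q)) ∨
        (y ≠ x ∧ q' ≠ q ∧ loc y = some (p, q')) := by
  unfold splitLoc
  by_cases hy : y = x
  · subst hy; simp [eq_comm]
  · simp only [Function.update_of_ne hy, hy]
    cases h : loc y with
    | none => simp
    | some z => 
      obtain ⟨p', q''⟩ := z
      simp only [Option.map_some, Option.some.injEq, Prod.mk.injEq]
      by_cases h2 : q'' = q <;> grind

/-- Fewer than `B` entries of one queue cannot fill the block, so some other queue of the group has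
entries there. Hence the old block still has a pointer to it after the base of `(g, j)` has left,
and no block is lost. -/
lemma Linked.exists_other (hL : Linked M stk fr role) (hF : Filled M loc stk) {g : Fin G}
    {j : Fin B} (hcard : B ≤ (M.data (M.base g j)).card) (hcnt : M.cnt g j < B) :
    ∃ k, k ≠ j ∧ M.base g k = M.base g j := by
  by_contra! hc
  rw [hF.cnt_eq, Finset.filter_true_of_mem] at hcnt
  · omega
  · rintro ⟨x, q⟩ hx
    have := hL.base_of_mem_data hF hx
    obtain ⟨g', k⟩ := q
    obtain ⟨rfl, hk⟩ := this
    by_contra hne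
    exact hc k (fun h => hne (by rw [h])) hk

lemma Linked.split {n : Fin P} (hL : Linked M stk (n :: fr) role) (hF : Filled M loc stk) {x : U}
    {g : Fin G} {j : Fin B} (hcard : B ≤ (M.data (M.base g j)).card) (hcnt : M.cnt g j < B) :
    Linked (M.split x g j n) stk fr (Function.update role n (.shared g)) := by
  have hn : role n = .free := (hL.mem_fr n).1 (by simp)
  have hnfr : n ∉ fr := (List.nodup_cons.1 hL.fr_nodup).1
  have hnstk : ∀ q, n ∉ stk q := fun q => by rw [hL.mem_stk, hn]; simp
  obtain ⟨k, hk, hkb⟩ := hL.exists_other hF hcard hcnt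
  refine ⟨hL.stk_chain, hL.fr_chain.2, hL.stk_nodup, (List.nodup_cons.1 hL.fr_nodup).2,
    fun p => ?_, fun p q => ?_, fun p g' => ?_⟩
  · have := hL.mem_fr p
    by_cases hp : p = n
    · subst hp; simp [hnfr]
    · simpa [hp] using this
  · have := hL.mem_stk p q
    by_cases hp : p = n
    · subst hp; simp [hnstk]
    · simpa [hp] using this
  · have := hL.mem_shared p g'
    change (∃ i, Function.update M.base g (Function.update (M.base g) j n) g' i = p) ↔ _
    simp only [update_update_apply, Function.update_apply]
    by_cases hp : p = n
    · subst hp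
      rw [if_pos rfl]
      constructor
      · rintro ⟨i, hi⟩
        split_ifs at hi with h
        · rw [Prod.mk.injEq] at h; rw [h.1]
        · exact absurd (hL.role_base g' i) (by rw [hi, hn]; simp)
      · intro h
        rw [Role.shared.injEq] at h
        exact ⟨j, by simp [h]⟩
    · rw [if_neg hp, ← this]
      constructor
      · rintro ⟨i, hi⟩
        split_ifs at hi with h
        · exact (hp hi.symm).elim
        · exact ⟨i, hi⟩
      · rintro ⟨i, hi⟩
        by_cases h : (g', i) = (g, j)
        · rw [Prod.mk.injEq] at h
          obtain ⟨rfl, rfl⟩ := h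
          refine ⟨k, ?_⟩
          rw [if_neg (by simp [hk]), hkb, hi]
        · exact ⟨i, by rw [if_neg h, hi]⟩

/-- Only a queue with a full base has a stack; otherwise all its elements are in the base. -/
lemma Filled.loc_eq_of_cnt_lt (hF : Filled M loc stk) {g : Fin G} {j : Fin B}
    (hcnt : M.cnt g j < B) {y : U} {p : Fin P} (h : loc y = some (p, (g, j))) :
    p = M.base g j := by
  rcases hF.place h with h | h
  · exact h.symm
  · have := hF.full (g := g) (j := j) (fun h0 => by rw [h0] at h; simp at h)
    omega

lemma Filled.split {n : Fin P} (hF : Filled M loc stk) (hL : Linked M stk (n :: fr) role) {x : U}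
    (hx : loc x = none) {g : Fin G} {j : Fin B} (hcnt : M.cnt g j < B) :
    Filled (M.split x g j n) (splitLoc loc x (g, j) n) stk where
  data_iff y p q := by
    have h1 := hF.data_iff y
    have hn : M.data n = ∅ := hL.data_free hF (by simp)
    have hnb : M.base g j ≠ n := by
      intro h
      have h2 := hL.role_base g j
      rw [h, (hL.mem_fr n).1 (by simp)] at h2
      simp at h2
    have h3 : ∀ p', loc y = some (p', (g, j)) → p' = M.base g j := fun p' h =>
      hF.loc_eq_of_cnt_lt hcnt h
    have h4 : ∀ q, loc y ≠ some (n, q) := fun q h => by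
      rw [← h1, hn] at h; simp at h
    rw [splitLoc_eq_some]
    simp only [Mem.split, Function.update_apply]
    split_ifs with h5 h6
    · subst h5
      simp only [Finset.mem_insert, Finset.mem_filter, h1, Prod.mk.injEq]
      by_cases hy : y = x
      · subst hy; simp [hx]
      · grind
    · subst h6
      simp only [Finset.mem_filter, h1]
      grind
    · rw [h1]
      grind
  card_le p := by
    have h1 := hF.card_le p
    simp only [Mem.split, Function.update_apply]
    split_ifs with h5 h6
    · refine (Finset.card_insert_le _ _).trans ?_
      rw [← hF.cnt_eq]
      exact hcnt
    · exact (Finset.card_filter_le _ _).trans (hF.card_le _)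
    · exact h1
  cnt_eq g' j' := by
    have h1 := hF.cnt_eq g' j'
    have hn : ∀ g' j', M.base g' j' ≠ n := by
      intro g' j' h
      have h2 := hL.role_base g' j'
      rw [h, (hL.mem_fr n).1 (by simp)] at h2
      simp at h2
    simp only [Mem.split, update_update_apply]
    split_ifs with h5
    · rw [Prod.mk.injEq] at h5
      obtain ⟨rfl, rfl⟩ := h5
      rw [Function.update_self, Finset.filter_insert, if_pos rfl, Finset.filter_filter,
        Finset.card_insert_of_notMem (by simp [hF.notMem_of_loc_eq_none hx]), h1]
      simp
    · rw [Function.update_of_ne (hn _ _), Function.update_apply, h1]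
      split_ifs with h6
      · rw [Finset.filter_filter, h6]
        congr 1
        refine Finset.filter_congr fun y _ => ?_
        constructor
        · intro hy
          exact ⟨by rw [hy]; exact h5, hy⟩
        · exact fun hy => hy.2
      · rfl
  place {y p q} h := by
    simp only [Mem.split, update_update_apply]
    rw [splitLoc_eq_some] at h
    rcases h with ⟨rfl, rfl, rfl⟩ | ⟨_, rfl, rfl, _⟩ | ⟨_, h2, h3⟩
    · simp
    · simp
    · rw [if_neg h2]
      exact hF.place h3
  full {g' j'} h := by
    have h1 := hF.full h
    simp only [Mem.split, update_update_apply]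
    split_ifs with h2
    · simp only [Prod.mk.injEq] at h2
      obtain ⟨rfl, rfl⟩ := h2
      omega
    · exact h1
  stack_full {q t l} h p hp := by
    have hpq : p ∈ stk q := by rw [h]; simp [hp]
    simp only [Mem.split, Function.update_apply]
    rw [if_neg, if_neg]
    · exact hF.stack_full h p hp
    · rintro rfl
      exact hL.base_not_mem_stk g j q hpq
    · rintro rfl
      rw [hL.mem_stk, (hL.mem_fr p).1 (by simp)] at hpq
      simp at hpq

lemma TopsNonempty.split {n : Fin P} (hT : TopsNonempty M stk)
    (hL : Linked M stk (n :: fr) role) (x : U) (g : Fin G) (j : Fin B) :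
    TopsNonempty (M.split x g j n) stk := by
  intro q t l h
  have hpq : t ∈ stk q := by rw [h]; simp
  simp only [Mem.split, Function.update_apply]
  rw [if_neg, if_neg]
  · exact hT q t l h
  · rintro rfl
    exact hL.base_not_mem_stk g j q hpq
  · rintro rfl
    rw [hL.mem_stk, (hL.mem_fr t).1 (by simp)] at hpq
    simp at hpq

/-- A newly mergeable pair must involve one of the two blocks that result from the split. These two
together are a cover, and an independent one, as their contents exceed one block. -/
lemma dense_split {n : Fin P} (hF : Filled M loc stk) (hL : Linked M stk (n :: fr) role) {x : U}
    (hx : loc x = none) {g : Fin G} {j : Fin B} (hcard : B ≤ (M.data (M.base g j)).card)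
    (h : ∀ g a b, ¬ Mergeable M g a b) (g' : Fin G) :
    Dense (M.split x g j n) (if g' = g then 2 else 0) g' := by
  have hbase : ∀ g' p, p ≠ n → (∃ k, (M.split x g j n).base g' k = p) →
      ∃ k, M.base g' k = p := by
    rintro g' p hp ⟨k, hk⟩
    simp only [Mem.split, update_update_apply] at hk
    split_ifs at hk with h1
    · exact (hp hk.symm).elim
    · exact ⟨k, hk⟩
  have hdata : ∀ p, p ≠ n → p ≠ M.base g j → (M.split x g j n).data p = M.data p := by
    intro p hp hp'
    simp [Mem.split, hp, hp']
  have hnb : ∀ g' j', M.base g' j' ≠ n := by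
    intro g' j' h
    have h2 := hL.role_base g' j'
    rw [h, (hL.mem_fr n).1 (by simp)] at h2
    simp at h2
  have hcover : ∀ g' a b, Mergeable (M.split x g j n) g' a b →
      (a = n ∨ a = M.base g j) ∨ (b = n ∨ b = M.base g j) := by
    intro g' a b hab
    by_contra! hc
    refine h g' a b ⟨hab.ne, hbase _ _ hc.1.1 hab.left, hbase _ _ hc.2.1 hab.right, ?_⟩
    rw [← hdata a hc.1.1 hc.1.2, ← hdata b hc.2.1 hc.2.2]
    exact hab.card_le
  have hgroup : ∀ g' p, (∃ k, (M.split x g j n).base g' k = p) → (p = n ∨ p = M.base g j) →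
      g' = g := by
    rintro g' p ⟨k, hk⟩ hp
    simp only [Mem.split, update_update_apply] at hk
    split_ifs at hk with h1
    · rw [Prod.mk.injEq] at h1; exact h1.1
    · rcases hp with rfl | rfl
      · exact (hnb _ _ hk).elim
      · exact hL.group_eq hk
  split_ifs with hg
  · subst hg
    refine ⟨{n, M.base g' j}, Finset.card_le_two, fun a b hab => ?_, ?_⟩
    · simpa using hcover _ a b hab
    -- At least `B` old entries and the new one are distributed between the two blocks.
    · have hsum : B < ((M.split x g' j n).data n).card +
          ((M.split x g' j n).data (M.base g' j)).card := by
        simp only [Mem.split, Function.update_self, Function.update_of_ne (hnb _ _)]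
        rw [Finset.card_insert_of_notMem (by simp [hF.notMem_of_loc_eq_none hx])]
        have := Finset.card_filter_add_card_filter_not (s := M.data (M.base g' j))
          (fun y => y.2 = (g', j))
        omega
      intro a ha b hb hab
      have h1 := hab.ne
      have h2 := hab.card_le
      simp only [Finset.mem_insert, Finset.mem_singleton] at ha hb
      rcases ha with rfl | rfl <;> rcases hb with rfl | rfl
      · exact h1 rfl
      · omega
      · omega
      · exact h1 rfl
  · refine dense_of_forall fun a b hab => ?_
    rcases hcover _ _ _ hab with h1 | h1
    · exact hg (hgroup _ _ hab.left h1)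
    · exact hg (hgroup _ _ hab.right h1)

/-- The moved elements keep their dictionary entry, since it names the queue, whose pointer has
moved along. Only the key `x` is new. -/
lemma dict_split {n : Fin P} (hF : Filled M loc stk) (hL : Linked M stk (n :: fr) role) {x : U}
    {g : Fin G} {j : Fin B} (hcnt : M.cnt g j < B) :
    dict (M.split x g j n) (splitLoc loc x (g, j) n) =
      Function.update (dict M loc) x (some (.inl (g, j))) := by
  have hnb : ∀ q p, loc q ≠ some (n, p) := by
    intro x q h
    rw [← hF.data_iff, hL.data_free hF (by simp)] at h; simp at h
  funext y
  by_cases hy : y = x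
  · subst hy
    simp [dict, splitLoc, Mem.split]
  · simp only [dict, splitLoc, Function.update_of_ne hy]
    cases h : loc y with
    | none => simp
    | some z =>
      obtain ⟨p, q⟩ := z
      simp only [Option.map_some, Mem.split, update_update_apply, Prod.mk.eta]
      by_cases hq : q = (g, j)
      · subst hq
        simp [hF.loc_eq_of_cnt_lt hcnt h]
      · simp [hq]

lemma queueOf_splitLoc (x : U) (q : QueueId G B) (n : Fin P) :
    queueOf (splitLoc loc x q n) = Function.update (queueOf loc) x (some q) := by
  funext y
  by_cases hy : y = x
  · subst hy
    simp [queueOf, splitLoc]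
  · simp [queueOf, splitLoc, hy, Function.comp_def]

/-! ### Merging two shared blocks -/

/-- Move the content of the block `p` to the block `p'` of the same group, and free `p`. -/
def Mem.merge (M : Mem U G B P) (g : Fin G) (p p' : Fin P) : Mem U G B P :=
  { M with
    free := some p
    next := Function.update M.next p M.free
    base := Function.update M.base g fun k => if M.base g k = p then p' else M.base g k
    data := Function.update (Function.update M.data p' (M.data p ∪ M.data p')) p ∅ }

def mergeLoc (loc : U → Option (Fin P × QueueId G B)) (p p' : Fin P) (x : U) :
    Option (Fin P × QueueId G B) :=
  (loc x).map fun z => (if z.1 = p then p' else z.1, z.2)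

lemma mergeLoc_eq_some {y : U} {q : QueueId G B} {p p' a : Fin P} :
    mergeLoc loc p p' y = some (a, q) ↔
      (a = p' ∧ loc y = some (p, q)) ∨ (a ≠ p ∧ loc y = some (a, q)) ∨
        (p = p' ∧ a = p ∧ loc y = some (p, q)) := by
  unfold mergeLoc
  cases h : loc y with
  | none => simp
  | some z =>
    obtain ⟨b, q'⟩ := z
    simp only [Option.map_some, Option.some.injEq, Prod.mk.injEq]
    grind

lemma Linked.base_merge (hL : Linked M stk fr role) {g : Fin G} {p : Fin P}
    (hp : ∃ j, M.base g j = p) (p' : Fin P) (g' : Fin G) (j : Fin B) :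
    (M.merge g p p').base g' j = if M.base g' j = p then p' else M.base g' j := by
  simp only [Mem.merge, Function.update_apply]
  by_cases hg : g' = g
  · subst hg; simp
  · rw [if_neg hg, if_neg]
    intro h
    obtain ⟨k, hk⟩ := hp
    exact hg (hL.group_eq (h.trans hk.symm))

lemma Linked.merge (hL : Linked M stk fr role) {g : Fin G} {p p' : Fin P}
    (hm : Mergeable M g p p') :
    Linked (M.merge g p p') stk (p :: fr) (Function.update role p .free) := by
  have hp : role p = .shared g := (hL.mem_shared _ _).1 hm.left
  have hp' : role p' = .shared g := (hL.mem_shared _ _).1 hm.right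
  have hpfr : p ∉ fr := by rw [hL.mem_fr, hp]; simp
  have hpstk : ∀ q, p ∉ stk q := fun q => by rw [hL.mem_stk, hp]; simp
  refine ⟨fun q => (hL.stk_chain q).update (hpstk q) _, ⟨rfl, ?_⟩, hL.stk_nodup,
    List.nodup_cons.2 ⟨hpfr, hL.fr_nodup⟩, fun a => ?_, fun a q => ?_, fun a g' => ?_⟩
  · simp only [Mem.merge, Function.update_self]
    exact hL.fr_chain.update hpfr _
  · have := hL.mem_fr a
    by_cases ha : a = p
    · subst ha; simp
    · simpa [ha] using this
  · have := hL.mem_stk a q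
    by_cases ha : a = p
    · subst ha; simp [hpstk]
    · simpa [ha] using this
  · have := hL.mem_shared a g'
    simp only [hL.base_merge hm.left]
    by_cases ha : a = p
    · subst ha
      simp only [Function.update_self, reduceCtorEq, iff_false]
      rintro ⟨k, hk⟩
      split_ifs at hk with h1
      · exact hm.ne hk.symm
      · exact h1 hk
    · rw [Function.update_of_ne ha, ← this]
      constructor
      · rintro ⟨k, hk⟩
        split_ifs at hk with h1
        · subst hk
          obtain ⟨i, hi⟩ := hm.left
          have := hL.group_eq (h1.trans hi.symm)
          subst this
          exact hm.right
        · exact ⟨k, hk⟩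
      · rintro ⟨k, hk⟩
        exact ⟨k, by rw [if_neg (by rw [hk]; exact ha), hk]⟩

lemma Filled.disjoint (hF : Filled M loc stk) {p p' : Fin P} (h : p ≠ p') :
    Disjoint (M.data p) (M.data p') := by
  rw [Finset.disjoint_left]
  rintro ⟨x, q⟩ h1 h2
  rw [hF.data_iff] at h1 h2
  rw [h1] at h2
  simp only [Option.some.injEq, Prod.mk.injEq, and_true] at h2
  exact h h2

lemma Filled.merge (hF : Filled M loc stk) (hL : Linked M stk fr role) {g : Fin G} {p p' : Fin P}
    (hm : Mergeable M g p p') : Filled (M.merge g p p') (mergeLoc loc p p') stk where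
  data_iff y a q := by
    have h1 := hF.data_iff y
    have h2 := hm.ne
    rw [mergeLoc_eq_some]
    simp only [Mem.merge, Function.update_apply]
    split_ifs with h5 h6
    · subst h5; simp [hm.ne]
    · subst h6
      simp only [Finset.mem_union, h1]
      grind
    · rw [h1]; grind
  card_le a := by
    have h1 := hF.card_le a
    simp only [Mem.merge, Function.update_apply]
    split_ifs with h5 h6
    · simp
    · rw [Finset.card_union_of_disjoint (hF.disjoint hm.ne)]; exact hm.card_le
    · exact h1
  cnt_eq g' j' := by
    have h1 := hF.cnt_eq g' j'
    rw [hL.base_merge hm.left]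
    -- Entries of a queue outside its base block lie in its stack. So of the two shared blocks at
    -- most one contributes to the counter of a queue.
    have key : ∀ p₁ p₂, p₁ ≠ p₂ → M.base g' j' = p₁ →
        (M.data p₂).filter (fun y => y.2 = (g', j')) = ∅ ∨ p₂ ∈ stk (g', j') := by
      intro p₁ p₂ h12 h
      rcases Finset.eq_empty_or_nonempty ((M.data p₂).filter fun y => y.2 = (g', j')) with h3 | h3
      · exact .inl h3
      · obtain ⟨⟨y, q⟩, hy⟩ := h3
        rw [Finset.mem_filter, hF.data_iff] at hy
        obtain ⟨hy, rfl⟩ := hy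
        rcases hF.place hy with h4 | h4
        · exact (h12 (h.symm.trans h4)).elim
        · exact .inr h4
    have hp : ∀ q, p ∉ stk q := fun q => by
      obtain ⟨k, rfl⟩ := hm.left; exact hL.base_not_mem_stk _ _ _
    have hp' : ∀ q, p' ∉ stk q := fun q => by
      obtain ⟨k, rfl⟩ := hm.right; exact hL.base_not_mem_stk _ _ _
    change M.cnt g' j' = _
    rw [h1]
    simp only [Mem.merge, Function.update_apply]
    split_ifs with h2 h3 h4 h4
    · exact (hm.ne h3.symm).elim
    · rw [Finset.filter_union, (key p p' hm.ne h2).resolve_right (hp' _), h2, Finset.union_empty]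
    · exact (h4 rfl).elim
    · rw [Finset.filter_union, (key p' p hm.ne.symm h4).resolve_right (hp _), h4,
        Finset.empty_union]
    · rfl
  place {y a q} h := by
    rw [hL.base_merge hm.left]
    rw [mergeLoc_eq_some] at h
    have hp : ∀ q, p ∉ stk q := fun q => by
      obtain ⟨k, rfl⟩ := hm.left; exact hL.base_not_mem_stk _ _ _
    rcases h with ⟨rfl, h⟩ | ⟨h1, h⟩ | ⟨h1, _⟩
    · rcases hF.place h with h2 | h2
      · rw [if_pos h2]; exact .inl rfl
      · exact (hp _ h2).elim
    · rcases hF.place h with h2 | h2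
      · rw [h2, if_neg h1]; exact .inl rfl
      · exact .inr h2
    · exact (hm.ne h1).elim
  full h := hF.full h
  stack_full {q t l} h a ha := by
    have haq : a ∈ stk q := by rw [h]; simp [ha]
    simp only [Mem.merge, Function.update_apply]
    rw [if_neg, if_neg]
    · exact hF.stack_full h a ha
    · rintro rfl
      obtain ⟨k, rfl⟩ := hm.right
      exact hL.base_not_mem_stk _ _ _ haq
    · rintro rfl
      obtain ⟨k, rfl⟩ := hm.left
      exact hL.base_not_mem_stk _ _ _ haq

lemma TopsNonempty.merge (hT : TopsNonempty M stk) (hL : Linked M stk fr role) {g : Fin G}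
    {p p' : Fin P} (hm : Mergeable M g p p') : TopsNonempty (M.merge g p p') stk := by
  intro q t l h
  have haq : t ∈ stk q := by rw [h]; simp
  simp only [Mem.merge, Function.update_apply]
  rw [if_neg, if_neg]
  · exact hT q t l h
  · rintro rfl
    obtain ⟨k, rfl⟩ := hm.right
    exact hL.base_not_mem_stk _ _ _ haq
  · rintro rfl
    obtain ⟨k, rfl⟩ := hm.left
    exact hL.base_not_mem_stk _ _ _ haq

/-- `E` is an independent vertex cover of the graph of mergeable pairs. A block `b` mergeable with
the union would form a triangle with `p` and `p'`; a cover contains two vertices of a triangle, an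
independent set at most one. So the union is isolated in the new graph, while `p` is no longer
shared. Since `E` contains `p` or `p'`, that element can be dropped, and the bound falls by one. -/
lemma dense_merge (hL : Linked M stk fr role) {g : Fin G} {p p' : Fin P}
    (hm : Mergeable M g p p') {k : ℕ} (hk : Dense M (k + 1) g) : Dense (M.merge g p p') k g := by
  obtain ⟨E, hE, h1, h2⟩ := hk
  have hbase : ∀ a, (∃ i, (M.merge g p p').base g i = a) → a ≠ p ∧ ∃ i, M.base g i = a := by
    rintro a ⟨i, hi⟩
    rw [hL.base_merge hm.left] at hi
    split_ifs at hi with h3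
    · subst hi; exact ⟨hm.ne.symm, hm.right⟩
    · subst hi; exact ⟨h3, i, rfl⟩
  have hcard : ∀ a, a ≠ p → (M.data a).card ≤ ((M.merge g p p').data a).card := by
    intro a ha
    simp only [Mem.merge, Function.update_apply, if_neg ha]
    split_ifs with h3
    · subst h3; exact Finset.card_le_card Finset.subset_union_right
    · exact le_rfl
  have hcard' : (M.data p).card ≤ ((M.merge g p p').data p').card := by
    simp only [Mem.merge, Function.update_apply, if_neg hm.ne.symm]
    exact Finset.card_le_card Finset.subset_union_left
  have hold : ∀ a b, Mergeable (M.merge g p p') g a b → Mergeable M g a b := by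
    intro a b hab
    have ha := hbase a hab.left
    have hb := hbase b hab.right
    exact ⟨hab.ne, ha.2, hb.2, (Nat.add_le_add (hcard a ha.1) (hcard b hb.1)).trans hab.card_le⟩
  -- a block that can be merged with the new one could be merged with each of the old ones
  have hnew : ∀ b, ¬ Mergeable (M.merge g p p') g p' b := by
    intro b hb
    have hb' := hold _ _ hb
    have hbp : Mergeable M g p b := by
      have := hbase b hb.right
      exact ⟨this.1.symm, hm.left, this.2,
        (Nat.add_le_add hcard' (hcard b this.1)).trans hb.card_le⟩
    have := h1 _ _ hm
    have := h1 _ _ hb'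
    have := h1 _ _ hbp
    have := h2 p
    have := h2 p'
    grind
  have hnew' : ∀ b, ¬ Mergeable (M.merge g p p') g b p' := fun b hb => hnew b hb.symm
  by_cases hp : p ∈ E
  · refine ⟨E.erase p, by rw [Finset.card_erase_of_mem hp]; omega, fun a b hab => ?_,
      fun a ha b hb hab => h2 a (Finset.mem_of_mem_erase ha) b (Finset.mem_of_mem_erase hb)
        (hold _ _ hab)⟩
    have ha := (hbase a hab.left).1
    have hb := (hbase b hab.right).1
    simpa [ha, hb] using h1 _ _ (hold _ _ hab)
  · have hp' : p' ∈ E := (h1 _ _ hm).resolve_left hp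
    refine ⟨E.erase p', by rw [Finset.card_erase_of_mem hp']; omega, fun a b hab => ?_,
      fun a ha b hb hab => h2 a (Finset.mem_of_mem_erase ha) b (Finset.mem_of_mem_erase hb)
        (hold _ _ hab)⟩
    have ha : a ≠ p' := by rintro rfl; exact hnew _ hab
    have hb : b ≠ p' := by rintro rfl; exact hnew' _ hab
    simpa [ha, hb] using h1 _ _ (hold _ _ hab)

/-- Different groups have no shared block in common, so the merge is invisible in the group `g'`. -/
lemma dense_merge_of_ne (hL : Linked M stk fr role) {g g' : Fin G}
    {p p' : Fin P} (hm : Mergeable M g p p') (hg : g' ≠ g) {k : ℕ} (hk : Dense M k g') :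
    Dense (M.merge g p p') k g' := by
  obtain ⟨E, hE, h1, h2⟩ := hk
  have hbase : ∀ a, (∃ i, (M.merge g p p').base g' i = a) →
      (∃ i, M.base g' i = a) ∧ (M.merge g p p').data a = M.data a := by
    rintro a ⟨i, hi⟩
    simp only [Mem.merge, Function.update_of_ne hg] at hi
    subst hi
    refine ⟨⟨i, rfl⟩, ?_⟩
    simp only [Mem.merge]
    rw [Function.update_of_ne, Function.update_of_ne]
    · rintro rfl
      obtain ⟨k, hk⟩ := hm.right
      exact hg (hL.group_eq hk.symm)
    · rintro rfl
      obtain ⟨k, hk⟩ := hm.left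
      exact hg (hL.group_eq hk.symm)
  have hold : ∀ a b, Mergeable (M.merge g p p') g' a b → Mergeable M g' a b := by
    intro a b hab
    have ha := hbase a hab.left
    have hb := hbase b hab.right
    refine ⟨hab.ne, ha.1, hb.1, ?_⟩
    rw [← ha.2, ← hb.2]
    exact hab.card_le
  exact ⟨E, hE, fun a b hab => h1 _ _ (hold _ _ hab), fun a ha b hb hab => h2 a ha b hb
    (hold _ _ hab)⟩

/-- Up to `B` elements move, but only base elements, whose dictionary entries name queues. This is
what makes merging affordable: no key of the dictionary has to be touched. -/
lemma dict_merge (hF : Filled M loc stk) (hL : Linked M stk fr role) {g : Fin G} {p p' : Fin P}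
    (hm : Mergeable M g p p') : dict (M.merge g p p') (mergeLoc loc p p') = dict M loc := by
  funext y
  simp only [dict, mergeLoc, hL.base_merge hm.left]
  cases h : loc y with
  | none => simp
  | some z =>
    obtain ⟨a, q⟩ := z
    simp only [Option.map_some]
    have hp : p ∉ stk q := by
      obtain ⟨k, rfl⟩ := hm.left; exact hL.base_not_mem_stk _ _ _
    have hp' : p' ∉ stk q := by
      obtain ⟨k, rfl⟩ := hm.right; exact hL.base_not_mem_stk _ _ _
    rcases hF.place h with h1 | h1
    · simp [h1]
    · have h2 : a ≠ p := by rintro rfl; exact hp h1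
      have h3 : a ≠ p' := by rintro rfl; exact hp' h1
      have h4 : M.base q.1 q.2 ≠ a := by rintro rfl; exact hL.base_not_mem_stk _ _ _ h1
      simp only [h2, if_false, h4]
      rw [if_neg]
      split_ifs
      · exact h3.symm
      · exact h4

lemma queueOf_mergeLoc (p p' : Fin P) : queueOf (mergeLoc loc p p') = queueOf loc := by
  funext y
  simp [queueOf, mergeLoc, Function.comp_def]

end

/-! ### Removing elements, the number of blocks in use, and the initial memory -/

section

variable {U : Type} [DecidableEq U] {G B P : ℕ}
variable {M : Mem U G B P} {loc : U → Option (Fin P × QueueId G B)}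
  {stk : QueueId G B → List (Fin P)} {fr : List (Fin P)} {role : Fin P → Role G B}

/-! ### Removal from a queue without a stack -/

def Mem.eraseBase (M : Mem U G B P) (x : U) (g : Fin G) (j : Fin B) : Mem U G B P :=
  { M with
    data := Function.update M.data (M.base g j) ((M.data (M.base g j)).erase (x, (g, j)))
    cnt := Function.update M.cnt g (Function.update (M.cnt g) j (M.cnt g j - 1)) }

lemma Linked.eraseBase (hL : Linked M stk fr role) (x : U) (g : Fin G) (j : Fin B) :
    Linked (M.eraseBase x g j) stk fr role := by
  obtain ⟨h1, h2, h3, h4, h5, h6, h7⟩ := hL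
  exact ⟨h1, h2, h3, h4, h5, h6, h7⟩

lemma Filled.eraseBase (hF : Filled M loc stk) (hL : Linked M stk fr role) {x : U}
    {g : Fin G} {j : Fin B} (hx : loc x = some (M.base g j, (g, j))) (hstk : stk (g, j) = []) :
    Filled (M.eraseBase x g j) (Function.update loc x none) stk where
  data_iff y p q := by
    have := hF.data_iff y p q
    simp only [Mem.eraseBase, Function.update_apply]
    split_ifs with h3 h4 h4 <;> grind
  card_le p := by
    have := hF.card_le p
    simp only [Mem.eraseBase, Function.update_apply]
    split_ifs with h
    · exact (Finset.card_erase_le).trans (hF.card_le _)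
    · exact this
  cnt_eq g' j' := by
    have h1 := hF.cnt_eq g' j'
    have h2 := (hF.data_iff _ _ _).2 hx
    simp only [Mem.eraseBase, update_update_apply, Function.update_apply]
    split_ifs with h3 h4 h4
    · simp only [Prod.mk.injEq] at h3
      obtain ⟨rfl, rfl⟩ := h3
      rw [Finset.filter_erase, Finset.card_erase_of_mem (by simp [h2]), h1]
    · simp only [Prod.mk.injEq] at h3
      obtain ⟨rfl, rfl⟩ := h3
      exact (h4 rfl).elim
    · rw [Finset.filter_erase, Finset.erase_eq_of_notMem, h1, h4]
      simp only [Finset.mem_filter, not_and]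
      exact fun _ h => h3 h.symm
    · exact h1
  place {y p q} h := by
    simp only [Function.update_apply] at h
    split_ifs at h with h1
    exact hF.place h
  full {g' j'} h := by
    have h1 := hF.full h
    simp only [Mem.eraseBase, update_update_apply]
    split_ifs with h2
    · rw [h2] at h; exact (h hstk).elim
    · exact h1
  stack_full {q t l} h p hp := by
    simp only [Mem.eraseBase, Function.update_apply]
    rw [if_neg]
    · exact hF.stack_full h p hp
    · rintro rfl
      exact hL.base_not_mem_stk g j q (by rw [h]; simp [hp])

lemma TopsNonempty.eraseBase (hT : TopsNonempty M stk) (hL : Linked M stk fr role) (x : U)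
    (g : Fin G) (j : Fin B) : TopsNonempty (M.eraseBase x g j) stk := by
  intro q t l h
  simp only [Mem.eraseBase, Function.update_apply]
  rw [if_neg]
  · exact hT q t l h
  · rintro rfl
    exact hL.base_not_mem_stk g j q (by rw [h]; simp)

/-- Only one shared block shrinks, so all newly mergeable pairs contain it: the graph is a star, and
its centre is a cover. -/
lemma dense_eraseBase (hL : Linked M stk fr role) (h : ∀ g a b, ¬ Mergeable M g a b) (x : U)
    (g : Fin G) (j : Fin B) (g' : Fin G) :
    Dense (M.eraseBase x g j) (if g' = g then 1 else 0) g' := by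
  have hcover : ∀ g' a b, Mergeable (M.eraseBase x g j) g' a b →
      a = M.base g j ∨ b = M.base g j := by
    intro g' a b hab
    by_contra! hc
    refine h g' a b ⟨hab.ne, hab.left, hab.right, ?_⟩
    have := hab.card_le
    simpa [Mem.eraseBase, hc.1, hc.2] using this
  split_ifs with hg
  · subst hg
    refine ⟨{M.base g' j}, by simp, fun a b hab => by simpa using hcover _ a b hab, ?_⟩
    intro a ha b hb hab
    rw [Finset.mem_singleton] at ha hb
    exact hab.ne (ha.trans hb.symm)
  · refine dense_of_forall fun a b hab => ?_
    rcases hcover _ _ _ hab with h1 | h1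
    · obtain ⟨k, hk⟩ := hab.left
      exact hg (hL.group_eq (j := k) (j' := j) (hk.trans h1))
    · obtain ⟨k, hk⟩ := hab.right
      exact hg (hL.group_eq (j := k) (j' := j) (hk.trans h1))

/-! ### Removal from a queue with a stack -/

/-- In the queue `q`, the element `y` of the block `t` replaces the element `x` of the block
`p`. -/
def Mem.replace (M : Mem U G B P) (x y : U) (q : QueueId G B) (p t : Fin P) : Mem U G B P :=
  let M₁ := { M with data := Function.update M.data p (insert (y, q) ((M.data p).erase (x, q))) }
  { M₁ with data := Function.update M₁.data t ((M₁.data t).erase (y, q)) }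

def replaceLoc (loc : U → Option (Fin P × QueueId G B)) (x y : U) :
    U → Option (Fin P × QueueId G B) :=
  Function.update (Function.update loc y (loc x)) x none

/-- The hypothesis `h` covers the case in which `x` itself is in the top block: then `x` is its own
substitute, the first write changes nothing, and the second one erases `x`. -/
lemma replace_data (hF : Filled M loc stk) {x y : U} {q : QueueId G B} {p t : Fin P}
    (hx : loc x = some (p, q)) (h : p = t → x = y) (a : Fin P) :
    (M.replace x y q p t).data a =
      if a = t then (M.data a).erase (y, q)
      else if a = p then insert (y, q) ((M.data a).erase (x, q)) else M.data a := by
  have hx' := (hF.data_iff _ _ _).2 hx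
  simp only [Mem.replace, Function.update_apply]
  split_ifs with h1 h2 h2
  · rw [h h2.symm, Finset.insert_erase (by rw [← h h2.symm]; exact hx'), h1, h2]
  · rw [h1]
  · rw [h2]
  · rfl

lemma replace_card (hF : Filled M loc stk) {x y : U} {q : QueueId G B} {p t : Fin P}
    (hx : loc x = some (p, q)) (hy : loc y = some (t, q)) (h : p = t → x = y) (a : Fin P) :
    ((M.replace x y q p t).data a).card =
      if a = t then (M.data a).card - 1 else (M.data a).card := by
  have hx' := (hF.data_iff _ _ _).2 hx
  have hy' := (hF.data_iff _ _ _).2 hy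
  rw [replace_data hF hx h]
  split_ifs with h1 h2
  · subst h1; rw [Finset.card_erase_of_mem hy']
  · subst h2
    rw [Finset.card_insert_of_notMem, Finset.card_erase_add_one hx']
    rw [Finset.mem_erase, not_and, hF.data_iff, hy]
    simp [Ne.symm h1]
  · rfl

lemma Linked.replace (hL : Linked M stk fr role) (x y : U) (q : QueueId G B) (p t : Fin P) :
    Linked (M.replace x y q p t) stk fr role := by
  obtain ⟨h1, h2, h3, h4, h5, h6, h7⟩ := hL
  exact ⟨h1, h2, h3, h4, h5, h6, h7⟩

/-- The gap is closed by an element of the same queue, so only the top block loses an entry: the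
base of the queue and the lower blocks of the stack stay full. -/
lemma Filled.replace (hF : Filled M loc stk) (hL : Linked M stk fr role) {x y : U}
    {q : QueueId G B} {p t : Fin P} (hx : loc x = some (p, q)) (hy : loc y = some (t, q))
    (h : p = t → x = y) {l : List (Fin P)} (ht : stk q = t :: l) :
    Filled (M.replace x y q p t) (replaceLoc loc x y) stk where
  data_iff z a q' := by
    have h1 := hF.data_iff z a q'
    rw [replace_data hF hx h]
    simp only [replaceLoc, Function.update_apply]
    split_ifs <;> grind
  card_le a := by
    have h1 := hF.card_le a
    rw [replace_card hF hx hy h]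
    split_ifs <;> omega
  cnt_eq g' j' := by
    have h1 := hF.cnt_eq g' j'
    have hx' := (hF.data_iff _ _ _).2 hx
    change M.cnt g' j' = Finset.card (Finset.filter _ ((M.replace x y q p t).data (M.base g' j')))
    rw [replace_data hF hx h, if_neg, h1]
    · split_ifs with h2
      · subst h2
        have hyp : (y, q) ∉ (M.data (M.base g' j')).erase (x, q) := by
          rw [Finset.mem_erase, not_and, hF.data_iff, hy]
          intro h3 h4
          simp only [Option.some.injEq, Prod.mk.injEq, and_true] at h4
          exact h3 (by rw [h h4.symm])
        rw [Finset.filter_insert, Finset.filter_erase]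
        split_ifs with h3
        · subst h3
          rw [Finset.card_insert_of_notMem, Finset.card_erase_add_one (by simp [hx'])]
          rw [← Finset.filter_erase]
          exact fun h4 => hyp (Finset.mem_of_mem_filter _ h4)
        · rw [Finset.erase_eq_of_notMem]
          simp [h3]
      · rfl
    · rintro rfl
      exact hL.base_not_mem_stk g' j' q (by rw [ht]; simp)
  place {z a q'} hz := by
    change M.base q'.1 q'.2 = a ∨ _
    simp only [replaceLoc, Function.update_apply] at hz
    split_ifs at hz with h1 h2
    · exact hF.place hz
    · exact hF.place hz
  full h := hF.full h
  stack_full {q' t' l'} h' a ha := by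
    rw [replace_card hF hx hy h, if_neg]
    · exact hF.stack_full h' a ha
    · rintro rfl
      obtain rfl := hL.queue_eq (q := q) (q' := q') (p := a) (by rw [ht]; simp)
        (by rw [h']; simp [ha])
      rw [ht, List.cons.injEq] at h'
      obtain ⟨rfl, rfl⟩ := h'
      have := hL.stk_nodup q
      rw [ht, List.nodup_cons] at this
      exact this.1 ha

/-- The only size that changes is that of `t`, which is in a stack and hence not a shared block. No
merge is needed here. -/
lemma not_mergeable_replace (hF : Filled M loc stk) (hL : Linked M stk fr role) {x y : U}
    {q : QueueId G B} {p t : Fin P} (hx : loc x = some (p, q)) (hy : loc y = some (t, q))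
    (h : p = t → x = y) (ht : t ∈ stk q) (hm : ∀ g a b, ¬ Mergeable M g a b)
    (g : Fin G) (a b : Fin P) : ¬ Mergeable (M.replace x y q p t) g a b := by
  intro hab
  have hc := hab.card_le
  rw [replace_card hF hx hy h, replace_card hF hx hy h, if_neg, if_neg] at hc
  · exact hm g a b ⟨hab.ne, hab.left, hab.right, hc⟩
  · rintro rfl
    obtain ⟨k, hk⟩ := hab.right
    exact hL.base_not_mem_stk g k q (by rw [show M.base g k = b from hk]; exact ht)
  · rintro rfl
    obtain ⟨k, hk⟩ := hab.left
    exact hL.base_not_mem_stk g k q (by rw [show M.base g k = a from hk]; exact ht)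

lemma dict_replace (x y : U) (q : QueueId G B) (p t : Fin P) :
    dict (M.replace x y q p t) (replaceLoc loc x y) =
      Function.update (Function.update (dict M loc) y (dict M loc x)) x none := by
  funext z
  simp only [dict, replaceLoc, Function.update_apply]
  split_ifs <;> rfl

lemma queueOf_replaceLoc {x y : U} {q : QueueId G B} {p t : Fin P} (hx : loc x = some (p, q))
    (hy : loc y = some (t, q)) :
    queueOf (replaceLoc loc x y) = Function.update (queueOf loc) x none := by
  funext z
  simp only [queueOf, replaceLoc, Function.update_apply]
  split_ifs with h1 h2
  · rfl
  · rw [h2, hx, hy]; rfl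
  · rfl

/-- Pop `t` from the stack of `(g, j)` and push it on the list of free blocks. -/
def Mem.popBlock (M : Mem U G B P) (g : Fin G) (j : Fin B) (t : Fin P) : Mem U G B P :=
  { M with
    free := some t
    next := Function.update M.next t M.free
    top := Function.update M.top g (Function.update (M.top g) j (M.next t)) }

lemma Linked.popBlock (hL : Linked M stk fr role) {g : Fin G} {j : Fin B} {t : Fin P}
    {l : List (Fin P)} (ht : stk (g, j) = t :: l) :
    Linked (M.popBlock g j t) (Function.update stk (g, j) l) (t :: fr)
      (Function.update role t .free) := by
  have hrt : role t = .own (g, j) := (hL.mem_stk _ _).1 (by rw [ht]; simp)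
  have hfr : t ∉ fr := by rw [hL.mem_fr, hrt]; simp
  have hnd := hL.stk_nodup (g, j)
  rw [ht, List.nodup_cons] at hnd
  refine ⟨fun q => ?_, ⟨rfl, ?_⟩, fun q => ?_, List.nodup_cons.2 ⟨hfr, hL.fr_nodup⟩, fun p => ?_,
    fun p q => ?_, fun p g' => ?_⟩
  · simp only [Mem.popBlock, update_update_apply, Prod.mk.eta]
    by_cases hq : q = (g, j)
    · subst hq
      rw [if_pos rfl, Function.update_self]
      have := hL.stk_chain (g, j)
      rw [ht] at this
      exact this.2.update hnd.1 _
    · rw [if_neg hq, Function.update_of_ne hq]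
      refine (hL.stk_chain q).update ?_ _
      rw [hL.mem_stk, hrt, Role.own.injEq]
      exact Ne.symm hq
  · simp only [Mem.popBlock, Function.update_self]
    exact hL.fr_chain.update hfr _
  · by_cases hq : q = (g, j)
    · subst hq; simpa using hnd.2
    · rw [Function.update_of_ne hq]; exact hL.stk_nodup q
  · have := hL.mem_fr p
    by_cases hp : p = t
    · subst hp; simp
    · simpa [hp] using this
  · have := hL.mem_stk p q
    by_cases hp : p = t
    · subst hp
      by_cases hq : q = (g, j)
      · subst hq; simp [hnd.1]
      · simp [hq, this, hrt, Ne.symm hq]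
    · by_cases hq : q = (g, j)
      · subst hq; simpa [ht, hp] using this
      · simp [hp, hq, this]
  · change (∃ k, M.base g' k = p) ↔ _
    have := hL.mem_shared p g'
    by_cases hp : p = t
    · subst hp
      simpa [hrt] using this
    · simpa [hp] using this

lemma Filled.popBlock (hF : Filled M loc stk) {g : Fin G} {j : Fin B} {t : Fin P}
    {l : List (Fin P)} (ht : stk (g, j) = t :: l) (hd : M.data t = ∅) :
    Filled (M.popBlock g j t) loc (Function.update stk (g, j) l) where
  data_iff := hF.data_iff
  card_le := hF.card_le
  cnt_eq := hF.cnt_eq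
  place {x p q} h := by
    rcases hF.place h with h1 | h1
    · exact .inl h1
    · right
      by_cases hq : q = (g, j)
      · subst hq
        rw [ht, List.mem_cons] at h1
        rcases h1 with rfl | h1
        · rw [← hF.data_iff, hd] at h; simp at h
        · simpa using h1
      · simpa [hq] using h1
  full {g' j'} h := by
    by_cases hq : (g', j') = (g, j)
    · exact hF.full (by rw [hq, ht]; simp)
    · rw [Function.update_of_ne hq] at h
      exact hF.full h
  stack_full {q t' l'} h p hp := by
    by_cases hq : q = (g, j)
    · subst hq
      rw [Function.update_self] at h
      subst h
      exact hF.stack_full ht p (by simp [hp])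
    · rw [Function.update_of_ne hq] at h
      exact hF.stack_full h p hp

lemma TopsNonempty.popBlock (hF : Filled M loc stk) {g : Fin G} {j : Fin B} {t : Fin P}
    {l : List (Fin P)} (ht : stk (g, j) = t :: l)
    (hT : ∀ q t' l', stk q = t' :: l' → q ≠ (g, j) → (M.data t').Nonempty) :
    TopsNonempty (M.popBlock g j t) (Function.update stk (g, j) l) := by
  intro q t' l' h
  change (M.data t').Nonempty
  by_cases hq : q = (g, j)
  · subst hq
    rw [Function.update_self] at h
    subst h
    -- The new top was below the old one, so it is full, and `B` is positive.
    rw [← Finset.card_pos, hF.stack_full ht t' (by simp)]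
    exact Fin.pos j
  · rw [Function.update_of_ne hq] at h
    exact hT q t' l' h hq

/-! ### Space -/

/-- The element of an entry determines the entry, because `queueOf` prescribes the second component.
So disjoint sets of entries can be counted by their elements. -/
lemma sum_card_le_of_loc {ι : Type} {s : Finset ι} {S : ι → Finset (U × QueueId G B)}
    {T : Finset U} (hd : (s : Set ι).PairwiseDisjoint S)
    (hT : ∀ i ∈ s, ∀ y ∈ S i, y.1 ∈ T ∧ queueOf loc y.1 = some y.2) :
    ∑ i ∈ s, (S i).card ≤ T.card := by
  rw [← Finset.card_biUnion hd]
  refine Finset.card_le_card_of_injOn Prod.fst ?_ ?_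
  · intro y hy
    simp only [Finset.coe_biUnion, Set.mem_iUnion, Finset.mem_coe] at hy
    obtain ⟨i, hi, hy⟩ := hy
    exact (hT i hi y hy).1
  · intro y hy z hz h
    simp only [Finset.coe_biUnion, Set.mem_iUnion, Finset.mem_coe] at hy hz
    obtain ⟨i, hi, hy⟩ := hy
    obtain ⟨k, hk, hz⟩ := hz
    have h1 := (hT i hi y hy).2
    have h2 := (hT k hk z hz).2
    rw [h, h2, Option.some.injEq] at h1
    exact Prod.ext h h1.symm

lemma Filled.queueOf_eq (hF : Filled M loc stk) {y : U × QueueId G B} {p : Fin P}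
    (hy : y ∈ M.data p) : queueOf loc y.1 = some y.2 := by
  obtain ⟨x, q⟩ := y
  rw [hF.data_iff] at hy
  simp [queueOf, hy]

/-- The length of a stack. -/
lemma Linked.length_stk_mul_le [Fintype U] (hL : Linked M stk fr role) (hF : Filled M loc stk)
    (q : QueueId G B) :
    (stk q).length * B ≤ (Finset.univ.filter fun x => queueOf loc x = some q).card + B := by
  cases h : stk q with
  | nil => simp
  | cons t l =>
    rw [List.length_cons, add_mul, one_mul]
    refine Nat.add_le_add_right ?_ _
    have hnd := hL.stk_nodup q
    rw [h, List.nodup_cons] at hnd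
    -- All blocks below the top are full, so each of them accounts for `B` elements of the queue.
    have : ∑ p ∈ l.toFinset, (M.data p).card = l.length * B := by
      rw [Finset.sum_congr rfl fun p hp => hF.stack_full h p (by simpa using hp),
        Finset.sum_const, List.toFinset_card_of_nodup hnd.2, smul_eq_mul]
    rw [← this]
    refine sum_card_le_of_loc (loc := loc) (fun a _ b _ hab => hF.disjoint hab) ?_
    intro p hp y hy
    have hpq : p ∈ stk q := by rw [h]; simp_all
    have h1 := hF.queueOf_eq hy
    refine ⟨?_, h1⟩
    rw [Finset.mem_filter, h1]
    exact ⟨Finset.mem_univ _, congrArg some (hL.queue_of_mem_stk hF hpq hy)⟩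

def Role.group : Role G B → Option (Fin G)
  | .shared g => some g
  | _ => none

def Role.queue : Role G B → Option (QueueId G B)
  | .own q => some q
  | _ => none

open Classical in
/-- The number of blocks in use. -/
lemma Linked.card_used_mul_le [Fintype U] (hL : Linked M stk fr role) (hF : Filled M loc stk)
    (hm : ∀ g a b, ¬ Mergeable M g a b) :
    (Finset.univ.filter fun p => role p ≠ .free).card * B ≤
      G * B + 3 * (Finset.univ.filter fun x => (loc x).isSome = true).card := by
  set n := (Finset.univ.filter fun x => (loc x).isSome = true).card with hn
  have hsome : ∀ p, ∀ y ∈ M.data p, y.1 ∈ Finset.univ.filter fun x => (loc x).isSome = true := by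
    rintro p ⟨x, q⟩ hy
    rw [hF.data_iff] at hy
    simp [hy]
  -- The blocks in use are classified: shared and at most half full, more than half full, and stack
  -- blocks that are at most half full.
  let low := Finset.univ.filter fun p => (∃ g, role p = .shared g) ∧ 2 * (M.data p).card ≤ B
  let high := Finset.univ.filter fun p => B < 2 * (M.data p).card
  let part := Finset.univ.filter fun p => (∃ q, role p = .own q) ∧ 2 * (M.data p).card ≤ B
  have hsub : (Finset.univ.filter fun p => role p ≠ .free) ⊆ low ∪ high ∪ part := by
    intro p hp
    simp only [low, high, part, Finset.mem_union, Finset.mem_filter, Finset.mem_univ,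
      true_and] at hp ⊢
    cases h : role p with
    | free => exact (hp h).elim
    | shared g => by_cases h2 : 2 * (M.data p).card ≤ B <;> simp [h2]; omega
    | own q => by_cases h2 : 2 * (M.data p).card ≤ B <;> simp [h2]; omega
  -- Two such blocks in one group would fit together, so the map to the group is injective.
  have hlow : low.card ≤ G := by
    have : low.card ≤ (Finset.univ.map Function.Embedding.some : Finset (Option (Fin G))).card := by
      refine Finset.card_le_card_of_injOn (fun p => (role p).group) ?_ ?_
      · intro p hp
        simp only [low, Finset.coe_filter, Set.mem_ofPred_eq, Finset.mem_univ, true_and] at hp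
        obtain ⟨⟨g, hg⟩, -⟩ := hp
        simp [hg, Role.group]
      · intro p hp p' hp' h
        simp only [low, Finset.coe_filter, Set.mem_ofPred_eq, Finset.mem_univ, true_and] at hp hp'
        obtain ⟨⟨g, hg⟩, h1⟩ := hp
        obtain ⟨⟨g', hg'⟩, h2⟩ := hp'
        simp only [hg, hg', Role.group, Option.some.injEq] at h
        subst h
        by_contra hne
        exact hm g p p' ⟨hne, (hL.mem_shared _ _).2 hg, (hL.mem_shared _ _).2 hg', by omega⟩
    simpa using this
  have hhigh : high.card * B ≤ 2 * n := by
    have h1 : ∑ p ∈ high, (M.data p).card ≤ n :=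
      sum_card_le_of_loc (loc := loc) (fun a _ b _ hab => hF.disjoint hab)
        fun p _ y hy => ⟨hsome p y hy, hF.queueOf_eq hy⟩
    have h2 : ∑ p ∈ high, B ≤ ∑ p ∈ high, 2 * (M.data p).card := by
      refine Finset.sum_le_sum fun p hp => ?_
      simp only [high, Finset.mem_filter, Finset.mem_univ, true_and] at hp
      omega
    rw [Finset.sum_const, smul_eq_mul, ← Finset.mul_sum] at h2
    omega
  -- A stack block that is at most half full must be the top, so there is at most one per queue; it
  -- is charged to the `B` elements in the base of its queue.
  have hpart : part.card * B ≤ n := by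
    let Q := Finset.univ.filter fun q : QueueId G B => M.cnt q.1 q.2 = B
    have h1 : part.card ≤ (Q.map Function.Embedding.some).card := by
      refine Finset.card_le_card_of_injOn (fun p => (role p).queue) ?_ ?_
      · intro p hp
        simp only [part, Finset.coe_filter, Set.mem_ofPred_eq, Finset.mem_univ, true_and] at hp
        obtain ⟨⟨q, hq⟩, -⟩ := hp
        have : p ∈ stk q := (hL.mem_stk _ _).2 hq
        have := hF.full (g := q.1) (j := q.2) (by intro h; rw [h] at this; simp at this)
        simp [hq, Role.queue, Q, this]
      · intro p hp p' hp' h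
        simp only [part, Finset.coe_filter, Set.mem_ofPred_eq, Finset.mem_univ, true_and] at hp hp'
        obtain ⟨⟨q, hq⟩, h1⟩ := hp
        obtain ⟨⟨q', hq'⟩, h2⟩ := hp'
        simp only [hq, hq', Role.queue, Option.some.injEq] at h
        subst h
        have h3 : p ∈ stk q := (hL.mem_stk _ _).2 hq
        have h4 : p' ∈ stk q := (hL.mem_stk _ _).2 hq'
        have hB : 0 < B := Fin.pos q.2
        cases hs : stk q with
        | nil => rw [hs] at h3; simp at h3
        | cons t l =>
          rw [hs, List.mem_cons] at h3 h4
          have := hF.stack_full hs p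
          have := hF.stack_full hs p'
          rcases h3 with h3 | h3 <;> rcases h4 with h4 | h4
          · rw [h3, h4]
          all_goals grind
    rw [Finset.card_map] at h1
    have h2 : ∑ q ∈ Q, ((M.data (M.base q.1 q.2)).filter fun y => y.2 = (q.1, q.2)).card ≤ n := by
      refine sum_card_le_of_loc (loc := loc) ?_ ?_
      · intro a _ b _ hab
        rw [Function.onFun, Finset.disjoint_left]
        intro y hy hy'
        simp only [Finset.mem_filter, Prod.mk.eta] at hy hy'
        exact hab (hy.2.symm.trans hy'.2)
      · intro q _ y hy
        have hy := Finset.mem_of_mem_filter _ hy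
        exact ⟨hsome _ y hy, hF.queueOf_eq hy⟩
    have h3 : ∑ q ∈ Q, ((M.data (M.base q.1 q.2)).filter fun y => y.2 = (q.1, q.2)).card =
        Q.card * B := by
      rw [← smul_eq_mul, ← Finset.sum_const]
      refine Finset.sum_congr rfl fun q hq => ?_
      rw [← hF.cnt_eq]
      simpa [Q] using hq
    calc part.card * B ≤ Q.card * B := Nat.mul_le_mul_right _ h1
      _ ≤ n := h3 ▸ h2
  have := (Finset.card_le_card hsub).trans ((Finset.card_union_le _ _).trans
    (Nat.add_le_add_right (Finset.card_union_le _ _) _))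
  calc _ ≤ (low.card + high.card + part.card) * B := Nat.mul_le_mul_right _ this
    _ = low.card * B + high.card * B + part.card * B := by ring
    _ ≤ G * B + 2 * n + n :=
      Nat.add_le_add (Nat.add_le_add (Nat.mul_le_mul_right _ hlow) hhigh) hpart
    _ = G * B + 3 * n := by ring

/-- As long as the pool is large enough, there is a free block. -/
lemma Linked.exists_free [Fintype U] (hL : Linked M stk fr role) (hF : Filled M loc stk)
    (hm : ∀ g a b, ¬ Mergeable M g a b)
    (hP : G * B + 3 * (Finset.univ.filter fun x => (loc x).isSome = true).card < P * B) :
    ∃ n fr', fr = n :: fr' ∧ M.free = some n := by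
  classical
  cases h : fr with
  | nil =>
    have h1 := hL.card_used_mul_le hF hm
    rw [Finset.filter_true_of_mem, Finset.card_univ, Fintype.card_fin] at h1
    · omega
    · intro p _ hp
      rw [← hL.mem_fr, h] at hp
      simp at hp
  | cons n fr' =>
    have := hL.fr_chain
    rw [h] at this
    exact ⟨n, fr', rfl, this.1⟩

/-- The memory at the beginning. -/
lemma exists_initial (U : Type) [DecidableEq U] {G B P : ℕ} (hB : 0 < B) (hP : G ≤ P) :
    ∃ (M : Mem U G B P) (fr : List (Fin P)) (role : Fin P → Role G B),
      Linked M (fun _ => []) fr role ∧ Filled M (fun _ => none) (fun _ => []) ∧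
      TopsNonempty M (fun _ => []) ∧ ∀ g a b, ¬ Mergeable M g a b := by
  classical
  -- At first all queues of a group point to the same empty block, and all remaining blocks are
  -- free. With one shared block per group there is nothing to merge.
  let role : Fin P → Role G B := fun p => if h : p.val < G then .shared ⟨p, h⟩ else .free
  let fr := (Finset.univ.filter fun p => role p = .free).toList
  obtain ⟨next, hnext⟩ := exists_chain fr (Finset.nodup_toList _)
  refine ⟨⟨fun g _ => Fin.castLE hP g, fun _ _ => 0, fun _ _ => none, next, fr.head?, fun _ => ∅⟩,
    fr, role, ⟨fun _ => rfl, hnext, fun _ => List.nodup_nil, Finset.nodup_toList _, fun p => ?_,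
      fun p q => ?_, fun p g => ?_⟩, ⟨?_, ?_, ?_, ?_, ?_, ?_⟩, ?_, ?_⟩
  · simp [fr]
  · simp only [List.not_mem_nil, role, false_iff]
    split_ifs <;> simp
  · simp only [role]
    constructor
    · rintro ⟨_, rfl⟩
      simp
    · intro h
      split_ifs at h with h1
      rw [Role.shared.injEq] at h
      refine ⟨⟨0, hB⟩, ?_⟩
      rw [← h]
      rfl
  · simp
  · simp
  · simp
  · simp
  · simp
  · simp
  · intro q t l h
    simp at h
  · intro g a b h
    obtain ⟨_, h1⟩ := h.left
    obtain ⟨_, h2⟩ := h.right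
    exact h.ne (h1.symm.trans h2)

end

/-! ### Encoding the memory in blocks -/

section

/-! ## The layout of the disk -/

section Codec

variable {V : Type} [Fintype V] [Nonempty V] {A : ℕ} [NeZero A]

/-- Integer words represent the elements of a small type. -/
def enc (A : ℕ) [NeZero A] {V : Type} [Fintype V] (v : V) : Fin A :=
  Fin.ofNat A (Fintype.equivFin V v)

def dec (V : Type) [Fintype V] [Nonempty V] (a : Fin A) : V := Function.invFun (enc A) a

lemma dec_enc (h : Fintype.card V ≤ A) (v : V) : dec V (enc A v) = v := by
  refine Function.leftInverse_invFun (fun v w hvw => ?_) v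
  have := congrArg Fin.val hvw
  simp only [enc, Fin.ofNat_eq_cast, Fin.val_natCast] at this
  rw [Nat.mod_eq_of_lt ((Fintype.equivFin V v).2.trans_le h),
    Nat.mod_eq_of_lt ((Fintype.equivFin V w).2.trans_le h)] at this
  exact (Fintype.equivFin V).injective (Fin.ext this)

variable {U : Type} [DecidableEq U] {B : ℕ} [NeZero B]

def encRow (f : Fin B → V) : Block U A B := fun j => (none, enc A (f j))

def decRow (V : Type) [Fintype V] [Nonempty V] (b : Block U A B) : Fin B → V :=
  fun j => dec V (b j).2

lemma decRow_encRow (h : Fintype.card V ≤ A) (f : Fin B → V) :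
    decRow V (encRow f : Block U A B) = f := by
  funext j
  exact dec_enc h _

def encNats (f : Fin B → ℕ) : Block U A B := fun j => (none, Fin.ofNat A (f j))

def decNats (b : Block U A B) : Fin B → ℕ := fun j => (b j).2

lemma decNats_encNats {f : Fin B → ℕ} (h : ∀ j, f j < A) :
    decNats (encNats f : Block U A B) = f := by
  funext j
  simp [decNats, encNats, Nat.mod_eq_of_lt (h j)]

/-- The set is listed in an arbitrary order, one entry per cell. A set with more than `B` entries
would be truncated, which is why decoding requires the bound on its size. -/
def encData (s : Finset (U × V)) : Block U A B := fun c =>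
  match s.toList[c.val]? with
  | some y => (some y.1, enc A y.2)
  | none => (none, 0)

def decData [DecidableEq V] (b : Block U A B) : Finset (U × V) :=
  Finset.univ.biUnion fun c =>
    match (b c).1 with
    | some x => {(x, dec V (b c).2)}
    | none => ∅

lemma exists_encData_eq {s : Finset (U × V)} (hs : s.card ≤ B) {y : U × V} (hy : y ∈ s) :
    ∃ c, (encData s : Block U A B) c = (some y.1, enc A y.2) := by
  rw [← Finset.mem_toList, List.mem_iff_getElem] at hy
  obtain ⟨i, hi, rfl⟩ := hy
  have h2 := hi
  rw [Finset.length_toList] at h2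
  refine ⟨⟨i, h2.trans_le hs⟩, ?_⟩
  simp only [encData]
  rw [List.getElem?_eq_getElem hi]

lemma mem_of_encData_eq {s : Finset (U × V)} {c : Fin B} {x : U}
    (h : ((encData s : Block U A B) c).1 = some x) :
    ∃ v, (x, v) ∈ s ∧ ((encData s : Block U A B) c).2 = enc A v := by
  unfold encData at h ⊢
  cases hc : s.toList[c.val]? with
  | none => rw [hc] at h; simp at h
  | some y =>
    rw [hc] at h
    simp only [Option.some.injEq] at h
    subst h
    refine ⟨y.2, ?_, rfl⟩
    rw [← Finset.mem_toList]
    exact List.mem_of_getElem? hc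

lemma decData_encData [DecidableEq V] (h : Fintype.card V ≤ A) {s : Finset (U × V)}
    (hs : s.card ≤ B) : decData (encData s : Block U A B) = s := by
  ext ⟨x, v⟩
  simp only [decData, Finset.mem_biUnion, Finset.mem_univ, true_and]
  constructor
  · rintro ⟨c, hc⟩
    cases h1 : ((encData s : Block U A B) c).1 with
    | none => rw [h1] at hc; simp at hc
    | some y =>
      rw [h1] at hc
      obtain ⟨w, hw, h2⟩ := mem_of_encData_eq h1
      simp only [Finset.mem_singleton, Prod.mk.injEq] at hc
      rw [h2, dec_enc h] at hc
      rw [hc.1, hc.2]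
      exact hw
  · intro hy
    obtain ⟨c, hc⟩ := exists_encData_eq (A := A) hs hy
    refine ⟨c, ?_⟩
    simp [hc, dec_enc h]

end Codec

/-- The addresses of the data structure: for each group the bases, their sizes, and the tops of the
stacks; the head of the list of free blocks; for each block of the pool the link and the data. -/
abbrev MemAddr (G P : ℕ) : Type := Fin G ⊕ Fin G ⊕ Fin G ⊕ Unit ⊕ Fin P ⊕ Fin P

set_option synthInstance.maxSize 1000 in
instance {G P : ℕ} : DecidableEq (MemAddr G P) := inferInstance

namespace MemAddr
variable {G P : ℕ}
abbrev base (g : Fin G) : MemAddr G P := .inl g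
abbrev cnt (g : Fin G) : MemAddr G P := .inr (.inl g)
abbrev top (g : Fin G) : MemAddr G P := .inr (.inr (.inl g))
abbrev free : MemAddr G P := .inr (.inr (.inr (.inl ())))
abbrev next (p : Fin P) : MemAddr G P := .inr (.inr (.inr (.inr (.inl p))))
abbrev data (p : Fin P) : MemAddr G P := .inr (.inr (.inr (.inr (.inr p))))
end MemAddr

section Layout

variable {U : Type} [DecidableEq U] {A B G P : ℕ} [NeZero A] [NeZero B] [NeZero P]
  {Addr₀ Addr : Type} [DecidableEq Addr₀] [DecidableEq Addr]

/-- The disk of the data structure. -/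
def Mem.disk (M : Mem U G B P) : Disk U A B (MemAddr G P) :=
  Sum.elim (fun g => encRow (M.base g)) <| Sum.elim (fun g => encNats (M.cnt g)) <|
    Sum.elim (fun g => encRow (M.top g)) <| Sum.elim (fun _ => encRow fun _ => M.free) <|
      Sum.elim (fun p => encRow fun _ => M.next p) fun p => encData (M.data p)

/-- The disk of the dictionary together with the disk of the data structure. -/
def fullDisk (e : Addr₀ ⊕ MemAddr G P ≃ Addr) (M : Mem U G B P) (d : Disk U A B Addr₀) :
    Disk U A B Addr := Sum.elim d M.disk ∘ e.symm

variable (e : Addr₀ ⊕ MemAddr G P ≃ Addr)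

lemma embeds_fullDisk (M : Mem U G B P) :
    Embeds (U := U) (A := A) (B := B) (fun a => e (.inl a)) (fullDisk e M) where
  read d a := by simp [fullDisk]
  write d a b := by
    rw [fullDisk, fullDisk, ← Sum.update_elim_inl, Function.update_comp_equiv]
    simp

lemma fullDisk_mem (M : Mem U G B P) (d : Disk U A B Addr₀) (a : MemAddr G P) :
    fullDisk e M d (e (.inr a)) = M.disk a := by simp [fullDisk]

lemma fullDisk_update (M : Mem U G B P) (d : Disk U A B Addr₀) (a : MemAddr G P)
    (b : Block U A B) : Function.update (fullDisk e M d) (e (.inr a)) b =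
      Sum.elim d (Function.update M.disk a b) ∘ e.symm := by
  rw [fullDisk, ← Sum.update_elim_inr, Function.update_comp_equiv]
  simp

/-- The words are large enough. -/
def Fits (A G B P : ℕ) : Prop := G * B + P + B + 1 ≤ A

lemma Fits.card_ptr (h : Fits A G B P) : Fintype.card (Fin P) ≤ A := by
  simp [Fits] at *; omega
lemma Fits.card_link (h : Fits A G B P) : Fintype.card (Option (Fin P)) ≤ A := by
  simp [Fits] at *; omega
lemma Fits.card_queue (h : Fits A G B P) : Fintype.card (QueueId G B) ≤ A := by
  simp [Fits] at *; omega
lemma Fits.card_place (h : Fits A G B P) : Fintype.card (QueueId G B ⊕ Fin P) ≤ A := by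
  simp [Fits] at *; omega
lemma Fits.lt_of_le (h : Fits A G B P) {n : ℕ} (hn : n ≤ B) : n < A := by
  simp [Fits] at *; omega

abbrev DiskProg (U : Type) (A B : ℕ) (Addr ρ : Type) : Type := Prog Addr (Block U A B) ρ

variable (A U) in
def getBase (g : Fin G) : DiskProg U A B Addr (Fin B → Fin P) := .get (e (.inr (.base g))) (decRow (Fin P))
variable (A U) in
def getCnt (g : Fin G) : DiskProg U A B Addr (Fin B → ℕ) := .get (e (.inr (.cnt g))) decNats
variable (A U) in
def getTop (g : Fin G) : DiskProg U A B Addr (Fin B → Option (Fin P)) :=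
  .get (e (.inr (.top g))) (decRow (Option (Fin P)))
variable (A U B) in
def getFree : DiskProg U A B Addr (Option (Fin P)) :=
  .get (e (.inr .free)) fun b => decRow (Option (Fin P)) b 0
variable (A U B) in
def getNext (p : Fin P) : DiskProg U A B Addr (Option (Fin P)) :=
  .get (e (.inr (.next p))) fun b => decRow (Option (Fin P)) b 0
variable (A B) in
def getData [NeZero G] (p : Fin P) : DiskProg U A B Addr (Finset (U × QueueId G B)) :=
  .get (e (.inr (.data p))) decData

variable (A U) in
def putBase (g : Fin G) (f : Fin B → Fin P) : DiskProg U A B Addr Unit :=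
  .put (e (.inr (.base g))) (encRow f)
variable (A U) in
def putCnt (g : Fin G) (f : Fin B → ℕ) : DiskProg U A B Addr Unit := .put (e (.inr (.cnt g))) (encNats f)
variable (A U) in
def putTop (g : Fin G) (f : Fin B → Option (Fin P)) : DiskProg U A B Addr Unit :=
  .put (e (.inr (.top g))) (encRow f)
variable (A U B) in
def putFree (v : Option (Fin P)) : DiskProg U A B Addr Unit := .put (e (.inr .free)) (encRow fun _ => v)
variable (A U B) in
def putNext (p : Fin P) (v : Option (Fin P)) : DiskProg U A B Addr Unit :=
  .put (e (.inr (.next p))) (encRow fun _ => v)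
variable (A) in
def putData (p : Fin P) (s : Finset (U × QueueId G B)) : DiskProg U A B Addr Unit :=
  .put (e (.inr (.data p))) (encData s)

variable (M : Mem U G B P) (d : Disk U A B Addr₀)

lemma runsIn_get_mem {ρ : Type} (a : MemAddr G P) (f : Block U A B → ρ) :
    (Prog.get (e (.inr a)) f).RunsIn (fullDisk e M d) 1 (fullDisk e M d) (f (M.disk a)) := by
  have := Prog.runsIn_get (e (.inr a)) f (fullDisk e M d)
  rwa [fullDisk_mem] at this

variable {M}

/-- Writing one block is matched with changing one field of the memory at one place. A chain of such
changes unfolds definitionally to `Mem.split`, `Mem.merge` and so on; this is what closes the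
specifications of the programs. -/
lemma runsIn_put_mem {M' : Mem U G B P} {a : MemAddr G P} {b : Block U A B}
    (h : Function.update M.disk a b = M'.disk) :
    (Prog.put (e (.inr a)) b).RunsIn (fullDisk e M d) 1 (fullDisk e M' d) () := by
  have := Prog.runsIn_put (e (.inr a)) b (fullDisk e M d)
  rwa [fullDisk_update, h] at this

variable {d}

lemma runsIn_getBase (hA : Fits A G B P) (g : Fin G) :
    (getBase U A e g).RunsIn (fullDisk e M d) 1 (fullDisk e M d) (M.base g) := by
  have := runsIn_get_mem e M d (.base g) (decRow (Fin P))
  rwa [show decRow (Fin P) (M.disk (.base g) : Block U A B) = M.base g from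
    decRow_encRow hA.card_ptr _] at this

lemma runsIn_getCnt (g : Fin G) (hc : ∀ j, M.cnt g j < A) :
    (getCnt U A e g).RunsIn (fullDisk e M d) 1 (fullDisk e M d) (M.cnt g) := by
  have := runsIn_get_mem e M d (.cnt g) decNats
  rwa [show decNats (M.disk (.cnt g) : Block U A B) = M.cnt g from
    decNats_encNats hc] at this

lemma runsIn_getTop (hA : Fits A G B P) (g : Fin G) :
    (getTop U A e g).RunsIn (fullDisk e M d) 1 (fullDisk e M d) (M.top g) := by
  have := runsIn_get_mem e M d (.top g) (decRow (Option (Fin P)))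
  rwa [show decRow (Option (Fin P)) (M.disk (.top g) : Block U A B) = M.top g from
    decRow_encRow hA.card_link _] at this

lemma runsIn_getFree (hA : Fits A G B P) :
    (getFree U A B e).RunsIn (fullDisk e M d) 1 (fullDisk e M d) M.free := by
  have := runsIn_get_mem e M d .free fun b => decRow (Option (Fin P)) b 0
  rwa [show decRow (Option (Fin P)) (M.disk .free : Block U A B) 0 = M.free from
    congrFun (decRow_encRow hA.card_link _) 0] at this

lemma runsIn_getNext (hA : Fits A G B P) (p : Fin P) :
    (getNext U A B e p).RunsIn (fullDisk e M d) 1 (fullDisk e M d) (M.next p) := by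
  have := runsIn_get_mem e M d (.next p) fun b => decRow (Option (Fin P)) b 0
  rwa [show decRow (Option (Fin P)) (M.disk (.next p) : Block U A B) 0 = M.next p from
    congrFun (decRow_encRow hA.card_link _) 0] at this

lemma runsIn_getData [NeZero G] (hA : Fits A G B P) {p : Fin P} (hp : (M.data p).card ≤ B) :
    (getData A B e p).RunsIn (fullDisk e M d) 1 (fullDisk e M d) (M.data p) := by
  have := runsIn_get_mem e M d (.data p) (decData (V := QueueId G B))
  rwa [show decData (M.disk (.data p) : Block U A B) = M.data p from
    decData_encData hA.card_queue hp] at this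

lemma runsIn_putBase (g : Fin G) (f : Fin B → Fin P) :
    (putBase U A e g f).RunsIn (fullDisk e M d) 1
      (fullDisk e { M with base := Function.update M.base g f } d) () := by
  refine runsIn_put_mem e d ?_
  funext a
  rcases a with a | a | a | a | a | a <;> simp [Mem.disk, Function.update_apply]
  split_ifs <;> rfl

lemma runsIn_putCnt (g : Fin G) (f : Fin B → ℕ) :
    (putCnt U A e g f).RunsIn (fullDisk e M d) 1
      (fullDisk e { M with cnt := Function.update M.cnt g f } d) () := by
  refine runsIn_put_mem e d ?_
  funext a
  rcases a with a | a | a | a | a | a <;> simp [Mem.disk, Function.update_apply]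
  split_ifs <;> rfl

lemma runsIn_putTop (g : Fin G) (f : Fin B → Option (Fin P)) :
    (putTop U A e g f).RunsIn (fullDisk e M d) 1
      (fullDisk e { M with top := Function.update M.top g f } d) () := by
  refine runsIn_put_mem e d ?_
  funext a
  rcases a with a | a | a | a | a | a <;> simp [Mem.disk, Function.update_apply]
  split_ifs <;> rfl

lemma runsIn_putFree (v : Option (Fin P)) :
    (putFree U A B e v).RunsIn (fullDisk e M d) 1 (fullDisk e { M with free := v } d) () := by
  refine runsIn_put_mem e d ?_
  funext a
  rcases a with a | a | a | a | a | a <;> simp [Mem.disk]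

lemma runsIn_putNext (p : Fin P) (v : Option (Fin P)) :
    (putNext U A B e p v).RunsIn (fullDisk e M d) 1
      (fullDisk e { M with next := Function.update M.next p v } d) () := by
  refine runsIn_put_mem e d ?_
  funext a
  rcases a with a | a | a | a | a | a <;> simp [Mem.disk, Function.update_apply]
  split_ifs <;> rfl

lemma runsIn_putData (p : Fin P) (s : Finset (U × QueueId G B)) :
    (putData A e p s).RunsIn (fullDisk e M d) 1
      (fullDisk e { M with data := Function.update M.data p s } d) () := by
  refine runsIn_put_mem e d ?_
  funext a
  rcases a with a | a | a | a | a | a <;> simp [Mem.disk, Function.update_apply]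
  split_ifs <;> rfl

end Layout

end

/-! ### Programs for merging, adding and removing -/

section

section Operations

variable {U : Type} [DecidableEq U] {A B G P : ℕ} [NeZero A] [NeZero B] [NeZero P] [NeZero G]
  {Addr₀ Addr : Type} [DecidableEq Addr₀] [DecidableEq Addr]
  {M : Mem U G B P} {loc : U → Option (Fin P × QueueId G B)}
  (e : Addr₀ ⊕ MemAddr G P ≃ Addr)

/-! ## The operations on the data structure -/

/-- The memory represents the locations `loc`, up to `k` missing merges in the group `g`. -/
def Represents (k : ℕ) (g : Fin G) (M : Mem U G B P) (loc : U → Option (Fin P × QueueId G B)) :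
    Prop :=
  ∃ stk fr role, Linked M stk fr role ∧ Filled M loc stk ∧ TopsNonempty M stk ∧
    ∀ g', Dense M (if g' = g then k else 0) g'

/-- The memory represents the locations `loc`. -/
def Valid (M : Mem U G B P) (loc : U → Option (Fin P × QueueId G B)) : Prop :=
  ∃ stk fr role, Linked M stk fr role ∧ Filled M loc stk ∧ TopsNonempty M stk ∧
    ∀ g a b, ¬ Mergeable M g a b

lemma Represents.valid {g : Fin G} (h : Represents 0 g M loc) : Valid M loc := by
  obtain ⟨stk, fr, role, hL, hF, hT, hD⟩ := h
  exact ⟨stk, fr, role, hL, hF, hT, fun g' => ((hD g').mono (by split_ifs <;> rfl)).not_mergeable⟩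

variable (A U) in
open Classical in
/-- Merge two shared blocks of the group `g`, if this is possible. -/
def mergeProg (g : Fin G) : DiskProg U A B Addr Unit := do
  let b ← getBase U A e g
  let c ← getCnt U A e g
  if h : ∃ j : Fin B × Fin B, b j.1 ≠ b j.2 ∧
      (∑ k with b k = b j.1, c k) + (∑ k with b k = b j.2, c k) ≤ B then
    let s ← getData A B e (b h.choose.1)
    let s' ← getData A B e (b h.choose.2)
    putData A e (b h.choose.2) (s ∪ s')
    putData A e (b h.choose.1) ∅
    putBase U A e g fun k => if b k = b h.choose.1 then b h.choose.2 else b k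
    let f ← getFree U A B e
    putNext U A B e (b h.choose.1) f
    putFree U A B e (some (b h.choose.1))
  else pure ()

/-- Either a pair is found, and merging it lowers the number of missing merges by one, or no pair of
the group is mergeable, and then none is missing. Both ways the bound drops from `k + 1` to `k`, so
a fixed number of calls repairs a group. -/
lemma mergeProg_spec (hA : Fits A G B P) {k : ℕ} {g : Fin G} (hM : Represents (k + 1) g M loc) :
    ∃ M' loc', (∀ d : Disk U A B Addr₀,
        (mergeProg U A e g).RunsIn (fullDisk e M d) 10 (fullDisk e M' d) ()) ∧
      Represents k g M' loc' ∧ dict M' loc' = dict M loc ∧ queueOf loc' = queueOf loc := by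
  classical
  obtain ⟨stk, fr, role, hL, hF, hT, hD⟩ := hM
  have hcnt : ∀ j, M.cnt g j < A := fun j =>
    hA.lt_of_le ((hF.cnt_le g j).trans (hF.card_le _))
  by_cases h : ∃ j : Fin B × Fin B, M.base g j.1 ≠ M.base g j.2 ∧
      (∑ k with M.base g k = M.base g j.1, M.cnt g k) +
        (∑ k with M.base g k = M.base g j.2, M.cnt g k) ≤ B
  · have hm : Mergeable M g (M.base g h.choose.1) (M.base g h.choose.2) := by
      have := h.choose_spec
      rw [hL.sum_cnt hF, hL.sum_cnt hF] at this
      exact ⟨this.1, ⟨_, rfl⟩, ⟨_, rfl⟩, this.2⟩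
    refine ⟨M.merge g (M.base g h.choose.1) (M.base g h.choose.2),
      mergeLoc loc (M.base g h.choose.1) (M.base g h.choose.2), fun d => ?_,
      ⟨stk, _, _, hL.merge hm, hF.merge hL hm, hT.merge hL hm, fun g' => ?_⟩,
      dict_merge hF hL hm, queueOf_mergeLoc _ _⟩
    · refine Prog.RunsIn.mono (n := 1 + (1 + (1 + (1 + (1 + (1 + (1 + (1 + (1 + 1)))))))))
        ?_ (by norm_num)
      refine (runsIn_getBase e hA g).bind ((runsIn_getCnt e g hcnt).bind ?_)
      rw [dif_pos h]
      refine (runsIn_getData e hA (hF.card_le _)).bind ((runsIn_getData e hA (hF.card_le _)).bind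
        ((runsIn_putData e _ _).bind ((runsIn_putData e _ _).bind ((runsIn_putBase e g _).bind
          ((runsIn_getFree e hA).bind ((runsIn_putNext e _ _).bind (runsIn_putFree e _)))))))
    · by_cases hg : g' = g
      · subst hg
        rw [if_pos rfl]
        refine dense_merge hL hm ?_
        simpa using hD g'
      · rw [if_neg hg]
        refine dense_merge_of_ne hL hm hg ?_
        simpa [hg] using hD g'
  · refine ⟨M, loc, fun d => ?_, ⟨stk, fr, role, hL, hF, hT, fun g' => ?_⟩, rfl, rfl⟩
    · refine Prog.RunsIn.mono (n := 1 + (1 + 0)) ?_ (by norm_num)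
      refine (runsIn_getBase e hA g).bind ((runsIn_getCnt e g hcnt).bind ?_)
      rw [dif_neg h]
      exact Prog.runsIn_pure _ _
    · by_cases hg : g' = g
      · subst hg
        refine dense_of_forall fun a b hab => h ?_
        obtain ⟨i, rfl⟩ := hab.left
        obtain ⟨k, rfl⟩ := hab.right
        refine ⟨(i, k), hab.ne, ?_⟩
        rw [hL.sum_cnt hF, hL.sum_cnt hF]
        exact hab.card_le
      · rw [if_neg hg]
        simpa [hg] using hD g'

variable (A U) in
/-- The given block with its content, if it has room. -/
def roomProg (t : Option (Fin P)) :
    DiskProg U A B Addr (Option (Fin P × Finset (U × QueueId G B))) :=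
  match t with
  | none => pure none
  | some p => do
    let s ← getData A B e p
    pure (if s.card < B then some (p, s) else none)

variable (A) in
open Classical in
/-- Add the element `x` to the queue `q`; the answer is its place. -/
def addProg (x : U) (q : QueueId G B) : DiskProg U A B Addr (QueueId G B ⊕ Fin P) := do
  let b ← getBase U A e q.1
  let c ← getCnt U A e q.1
  let s ← getData A B e (b q.2)
  if s.card < B then
    putData A e (b q.2) (insert (x, q) s)
    putCnt U A e q.1 (Function.update c q.2 (c q.2 + 1))
    pure (.inl q)
  else if c q.2 < B then
    match ← getFree U A B e with
    | none => pure (.inl q)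
    | some n =>
      let v ← getNext U A B e n
      putFree U A B e v
      putData A e (b q.2) (s.filter fun y => ¬ y.2 = q)
      putData A e n (insert (x, q) (s.filter fun y => y.2 = q))
      putBase U A e q.1 (Function.update b q.2 n)
      putCnt U A e q.1 (Function.update c q.2 (c q.2 + 1))
      mergeProg U A e q.1
      mergeProg U A e q.1
      pure (.inl q)
  else
    let t ← getTop U A e q.1
    match ← roomProg U A e (t q.2) with
    | some (p, s) =>
      putData A e p (insert (x, q) s)
      pure (.inr p)
    | none =>
      match ← getFree U A B e with
      | none => pure (.inl q)
      | some n =>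
        let v ← getNext U A B e n
        putFree U A B e v
        putNext U A B e n (t q.2)
        putTop U A e q.1 (Function.update t q.2 (some n))
        let s ← getData A B e n
        putData A e n (insert (x, q) s)
        pure (.inr n)

variable [Fintype U]

/-- There are four cases: room in the shared block, a full shared block but a base that is not full,
room at the top of the stack, and a new block on the stack. In all of them the dictionary changes at
`x` only, so that one insertion suffices. -/
lemma addProg_spec (hA : Fits A G B P) (hM : Valid M loc)
    (hP : G * B + 3 * (Finset.univ.filter fun x => (loc x).isSome = true).card < P * B)
    {x : U} (hx : loc x = none) (q : QueueId G B) :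
    ∃ M' loc' v, (∀ d : Disk U A B Addr₀,
        (addProg A e x q).RunsIn (fullDisk e M d) 40 (fullDisk e M' d) v) ∧
      Valid M' loc' ∧ dict M' loc' = Function.update (dict M loc) x (some v) ∧
      queueOf loc' = Function.update (queueOf loc) x (some q) := by
  classical
  obtain ⟨stk, fr, role, hL, hF, hT, hm⟩ := hM
  obtain ⟨g, j⟩ := q
  have hcnt : ∀ j, M.cnt g j < A := fun j =>
    hA.lt_of_le ((hF.cnt_le g j).trans (hF.card_le _))
  have hqueue : ∀ p, queueOf (Function.update loc x (some (p, (g, j)))) =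
      Function.update (queueOf loc) x (some (g, j)) := by
    intro p
    funext y
    by_cases hy : y = x
    · subst hy; simp [queueOf]
    · simp [queueOf, hy]
  by_cases hroom : (M.data (M.base g j)).card < B
  · refine ⟨M.addBase x g j, _, .inl (g, j), fun d => ?_, ⟨stk, fr, role, hL.addBase x g j,
      hF.addBase hL hx hroom, hT.addBase x g j, not_mergeable_addBase hm x g j⟩, ?_, hqueue _⟩
    · refine Prog.RunsIn.mono (n := 1 + (1 + (1 + (1 + (1 + 0))))) ?_ (by norm_num)
      refine (runsIn_getBase e hA g).bind ((runsIn_getCnt e g hcnt).bind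
        ((runsIn_getData e hA (hF.card_le _)).bind ?_))
      rw [if_pos hroom]
      exact (runsIn_putData e _ _).bind ((runsIn_putCnt e _ _).bind (Prog.runsIn_pure _ _))
    · rw [dict_update]
      simp only [Mem.addBase, if_true]
      rfl
  -- The space bound provides a free block; the branches of the program without one are never taken.
  obtain ⟨n, fr', rfl, hfree⟩ := hL.exists_free hF hm hP
  by_cases hc : M.cnt g j < B
  · push Not at hroom
    -- The split may leave two missing merges, whence the two calls of `mergeProg`.
    have hR : Represents 2 g (M.split x g j n) (splitLoc loc x (g, j) n) :=
      ⟨stk, fr', _, hL.split hF hroom hc, hF.split hL hx hc, hT.split hL x g j,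
        dense_split hF hL hx hroom hm⟩
    obtain ⟨M₁, loc₁, hr₁, hR₁, hd₁, hq₁⟩ := mergeProg_spec e hA hR
    obtain ⟨M₂, loc₂, hr₂, hR₂, hd₂, hq₂⟩ := mergeProg_spec e hA hR₁
    refine ⟨M₂, loc₂, .inl (g, j), fun d => ?_, hR₂.valid, ?_, ?_⟩
    · refine Prog.RunsIn.mono
        (n := 1 + (1 + (1 + (1 + (1 + (1 + (1 + (1 + (1 + (1 + (10 + (10 + 0))))))))))))
        ?_ (by norm_num)
      refine (runsIn_getBase e hA g).bind ((runsIn_getCnt e g hcnt).bind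
        ((runsIn_getData e hA (hF.card_le _)).bind ?_))
      rw [if_neg hroom.not_gt, if_pos hc]
      refine (runsIn_getFree e hA).bind ?_
      rw [hfree]
      refine (runsIn_getNext e hA _).bind ((runsIn_putFree e _).bind ((runsIn_putData e _ _).bind
        ((runsIn_putData e _ _).bind ((runsIn_putBase e _ _).bind
          ((runsIn_putCnt e _ _).bind ((hr₁ d).bind ((hr₂ d).bind (Prog.runsIn_pure _ _))))))))
    · rw [hd₂, hd₁, dict_split hF hL hc]
    · rw [hq₂, hq₁, queueOf_splitLoc]
  have hcB : M.cnt g j = B :=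
    le_antisymm ((hF.cnt_le g j).trans (hF.card_le _)) (Nat.not_lt.1 hc)
  by_cases ht : ∃ t l, stk (g, j) = t :: l ∧ (M.data t).card < B
  · obtain ⟨t, l, ht, htB⟩ := ht
    have htop : M.top g j = some t := by
      have := (hL.stk_chain (g, j)).head_eq
      rw [ht] at this
      exact this
    refine ⟨M.addData x (g, j) t, _, .inr t, fun d => ?_, ⟨stk, _, role, hL.addData x _ t,
      hF.addData hL hx ht htB, TopsNonempty.addData (fun q t' l' h _ => hT q t' l' h) x _,
      not_mergeable_addData hm x _ t⟩, ?_, hqueue _⟩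
    · refine Prog.RunsIn.mono (n := 1 + (1 + (1 + (1 + ((1 + 0) + (1 + 0)))))) ?_ (by norm_num)
      refine (runsIn_getBase e hA g).bind ((runsIn_getCnt e g hcnt).bind
        ((runsIn_getData e hA (hF.card_le _)).bind ?_))
      rw [if_neg hroom, if_neg hc]
      refine (runsIn_getTop e hA g).bind (Prog.RunsIn.bind
        (d₁ := fullDisk e M d) (r := some (t, M.data t)) ?_ ?_)
      · rw [show M.top g (g, j).2 = some t from htop]
        refine (runsIn_getData e hA (hF.card_le _)).bind ?_
        rw [if_pos htB]
        exact Prog.runsIn_pure _ _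
      · exact (runsIn_putData e _ _).bind (Prog.runsIn_pure _ _)
    · rw [dict_update, if_neg]
      · rfl
      · exact fun h => hL.base_not_mem_stk g j (g, j) (by
          rw [show M.base g j = t from h, ht]; simp)
  · have htop : ∀ t l, stk (g, j) = t :: l → (M.data t).card = B := by
      intro t l h
      by_contra hne
      exact ht ⟨t, l, h, lt_of_le_of_ne (hF.card_le t) hne⟩
    have hL' := hL.pushBlock g j
    have hF' := hF.pushBlock (n := n) g j hcB htop
    have hn : M.data n = ∅ := hL.data_free hF (by simp)
    refine ⟨(M.pushBlock g j n).addData x (g, j) n, _, .inr n, fun d => ?_,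
      ⟨_, _, _, hL'.addData x _ n, hF'.addData hL' hx (l := stk (g, j)) (by simp) ?_,
        TopsNonempty.addData ?_ x _, not_mergeable_addData ?_ x _ n⟩, ?_, hqueue _⟩
    · have hfin : ∀ s, (M.pushBlock g j n).data n = s →
          (putData A e n (insert (x, (g, j)) s)).RunsIn (fullDisk e (M.pushBlock g j n) d) 1
            (fullDisk e ((M.pushBlock g j n).addData x (g, j) n) d) () := by
        rintro s rfl
        exact runsIn_putData e _ _
      refine Prog.RunsIn.mono
        (n := 1 + (1 + (1 + (1 + (1 + (1 + (1 + (1 + (1 + (1 + (1 + (1 + 0))))))))))))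
        ?_ (by norm_num)
      refine (runsIn_getBase e hA g).bind ((runsIn_getCnt e g hcnt).bind
        ((runsIn_getData e hA (hF.card_le _)).bind ?_))
      rw [if_neg hroom, if_neg hc]
      refine (runsIn_getTop e hA g).bind (Prog.RunsIn.bind
        (d₁ := fullDisk e M d) (r := none) ?_ ?_)
      · cases h : stk (g, j) with
        | nil =>
          have h1 := (hL.stk_chain (g, j)).head_eq
          rw [h] at h1
          rw [show M.top g (g, j).2 = none from h1]
          exact (Prog.runsIn_pure _ _).mono (by norm_num)
        | cons t l =>
          have h1 := (hL.stk_chain (g, j)).head_eq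
          rw [h] at h1
          rw [show M.top g (g, j).2 = some t from h1]
          refine Prog.RunsIn.mono (n := 1 + 0) ?_ (by norm_num)
          refine (runsIn_getData e hA (hF.card_le _)).bind ?_
          rw [if_neg (htop t l h).not_lt]
          exact Prog.runsIn_pure _ _
      · refine (runsIn_getFree e hA).bind ?_
        rw [hfree]
        refine (runsIn_getNext e hA _).bind ((runsIn_putFree e _).bind ((runsIn_putNext e _ _).bind
          ((runsIn_putTop e _ _).bind (Prog.RunsIn.bind
            (runsIn_getData e (M := M.pushBlock g j n) hA (hF'.card_le n)) 
            ((hfin _ rfl).bind (Prog.runsIn_pure _ _))))))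
    · change (M.data n).card < B
      rw [hn]
      exact Nat.pos_of_neZero B
    · intro q t l h htn
      change (M.data t).Nonempty
      by_cases hq : q = (g, j)
      · subst hq
        rw [Function.update_self, List.cons.injEq] at h
        exact (htn h.1.symm).elim
      · rw [Function.update_of_ne hq] at h
        exact hT q t l h
    · exact fun g' a b hab => hm g' a b ⟨hab.ne, hab.left, hab.right, hab.card_le⟩
    · rw [dict_update, if_neg]
      · rfl
      · exact fun h => hL.base_not_mem_stk g j (g, j) (by
          have := hL'.base_not_mem_stk g j (g, j)
          rw [show (M.pushBlock g j n).base g j = n from h] at this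
          simp at this)

variable (A) in
open Classical in
/-- The queue and the block of the element `x` with the place `v`. -/
def findProg (x : U) (v : QueueId G B ⊕ Fin P) : DiskProg U A B Addr (QueueId G B × Fin P) :=
  match v with
  | .inl q => do
    let b ← getBase U A e q.1
    pure (q, b q.2)
  | .inr p => do
    let s ← getData A B e p
    pure (if h : ∃ q, (x, q) ∈ s then h.choose else (0, 0), p)

lemma findProg_spec (hA : Fits A G B P) (hM : Valid M loc) {x : U} {v : QueueId G B ⊕ Fin P}
    (hv : dict M loc x = some v) {p : Fin P} {q : QueueId G B} (hx : loc x = some (p, q))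
    (d : Disk U A B Addr₀) :
    (findProg A e x v).RunsIn (fullDisk e M d) 1 (fullDisk e M d) (q, p) := by
  obtain ⟨stk, fr, role, hL, hF, hT, hm⟩ := hM
  simp only [dict, hx, Option.map_some, Option.some.injEq] at hv
  split_ifs at hv with h
  · subst hv
    rw [← h]
    exact Prog.RunsIn.mono (n := 1 + 0)
      ((runsIn_getBase e hA q.1).bind (Prog.runsIn_pure _ _)) (by norm_num)
  · subst hv
    have hex : ∃ q, (x, q) ∈ M.data p := ⟨q, (hF.data_iff _ _ _).2 hx⟩
    have hq : hex.choose = q := by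
      have := (hF.data_iff _ _ _).1 hex.choose_spec
      rw [hx] at this
      simp only [Option.some.injEq, Prod.mk.injEq, true_and] at this
      exact this.symm
    refine Prog.RunsIn.mono (n := 1 + 0)
      ((runsIn_getData e hA (hF.card_le _)).bind ?_) (by norm_num)
    rw [dif_pos hex, hq]
    exact Prog.runsIn_pure _ _

variable (A) in
open Classical in
/-- Remove the element `x` with the place `v`; the answer is the element that takes its place. -/
def removeProg (x : U) (v : QueueId G B ⊕ Fin P) : DiskProg U A B Addr U := do
  let (q, p) ← findProg A e x v
  let t ← getTop U A e q.1
  match t q.2 with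
  | none =>
    let s ← getData A B e p
    putData A e p (s.erase (x, q))
    let c ← getCnt U A e q.1
    putCnt U A e q.1 (Function.update c q.2 (c q.2 - 1))
    mergeProg U A e q.1
    pure x
  | some a =>
    let s ← getData A B e a
    let y := if p = a then x else if h : ∃ y, (y, q) ∈ s then h.choose else x
    let s ← getData A B e p
    putData A e p (insert (y, q) (s.erase (x, q)))
    let s ← getData A B e a
    putData A e a (s.erase (y, q))
    if s.erase (y, q) = ∅ then
      let n ← getNext U A B e a
      let f ← getFree U A B e
      putFree U A B e (some a)
      putNext U A B e a f
      putTop U A e q.1 (Function.update t q.2 n)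
      pure y
    else pure y

/-- Apart from `x`, only the key `y` whose element fills the gap can get a new value, namely the old
value of `x`. As `y` is already present, no insertion into the cuckoo table is needed, which makes a
worst-case bound possible. -/
lemma removeProg_spec (hA : Fits A G B P) (hM : Valid M loc) {x : U} {v : QueueId G B ⊕ Fin P}
    (hv : dict M loc x = some v) :
    ∃ M' loc' y, (∀ d : Disk U A B Addr₀,
        (removeProg A e x v).RunsIn (fullDisk e M d) 40 (fullDisk e M' d) y) ∧
      Valid M' loc' ∧ (dict M loc y).isSome = true ∧
      dict M' loc' = Function.update (Function.update (dict M loc) y (some v)) x none ∧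
      queueOf loc' = Function.update (queueOf loc) x none := by
  classical
  obtain ⟨stk, fr, role, hL, hF, hT, hm⟩ := hM
  obtain ⟨⟨p, q⟩, hx⟩ : ∃ z, loc x = some z := by
    cases h : loc x with
    | none => simp [dict, h] at hv
    | some z => exact ⟨z, rfl⟩
  have hstart := findProg_spec (Addr₀ := Addr₀) e hA ⟨stk, fr, role, hL, hF, hT, hm⟩ hv hx
  obtain ⟨g, j⟩ := q
  have hcnt : ∀ j, M.cnt g j < A := fun j =>
    hA.lt_of_le ((hF.cnt_le g j).trans (hF.card_le _))
  have hdata := (hF.data_iff _ _ _).2 hx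
  cases ht : stk (g, j) with
  | nil =>
    have htop : M.top g j = none := by
      have := (hL.stk_chain (g, j)).head_eq
      rw [ht] at this
      exact this
    have hp : M.base g j = p := by
      rcases hF.place hx with h | h
      · exact h
      · rw [ht] at h; simp at h
    subst hp
    have hR : Represents 1 g (M.eraseBase x g j) (Function.update loc x none) :=
      ⟨stk, fr, role, hL.eraseBase x g j, hF.eraseBase hL hx ht, hT.eraseBase hL x g j,
        dense_eraseBase hL hm x g j⟩
    obtain ⟨M₁, loc₁, hr₁, hR₁, hd₁, hq₁⟩ := mergeProg_spec e hA hR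
    refine ⟨M₁, loc₁, x, fun d => ?_, hR₁.valid, by rw [hv]; rfl, ?_, ?_⟩
    · refine Prog.RunsIn.mono (n := 1 + (1 + (1 + (1 + (1 + (1 + (10 + 0)))))))
        ((hstart d).bind ((runsIn_getTop e hA g).bind ?_)) (by norm_num)
      simp only [htop]
      exact (runsIn_getData e hA (hF.card_le _)).bind ((runsIn_putData e _ _).bind
        ((runsIn_getCnt e g (by exact hcnt)).bind ((runsIn_putCnt e _ _).bind
          ((hr₁ d).bind (Prog.runsIn_pure _ _)))))
    · rw [hd₁]
      funext z
      simp only [dict, Function.update_apply]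
      split_ifs <;> rfl
    · rw [hq₁]
      funext z
      simp only [queueOf, Function.update_apply]
      split_ifs <;> rfl
  | cons t l =>
    have htop : M.top g j = some t := by
      have := (hL.stk_chain (g, j)).head_eq
      rw [ht] at this
      exact this
    have htmem : t ∈ stk (g, j) := by rw [ht]; simp
    have hex : ∃ y, (y, (g, j)) ∈ M.data t := by
      obtain ⟨⟨y, q'⟩, hy⟩ := hT _ _ _ ht
      obtain rfl := hL.queue_of_mem_stk hF htmem hy
      exact ⟨y, hy⟩
    -- If `x` lies in the top block, it is its own substitute; otherwise any element of the top
    -- block serves, and there is one since tops are nonempty.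
    obtain ⟨y, hydef, hy, hpy⟩ : ∃ y, (if p = t then x else if h : ∃ y, (y, (g, j)) ∈ M.data t
        then h.choose else x) = y ∧ loc y = some (t, (g, j)) ∧ (p = t → x = y) := by
      refine ⟨_, rfl, ?_, ?_⟩
      · split_ifs with h
        · rw [← h]; exact hx
        · exact (hF.data_iff _ _ _).1 hex.choose_spec
      · intro h; rw [if_pos h]
    have hL' := hL.replace x y (g, j) p t
    have hF' := hF.replace hL hx hy hpy ht
    have hm' := not_mergeable_replace hF hL hx hy hpy htmem hm
    have hdict := dict_replace (M := M) (loc := loc) x y (g, j) p t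
    rw [hv] at hdict
    have hysome : (dict M loc y).isSome = true := by simp [dict, hy]
    have hcard' : ∀ a, a ≠ t → ((M.replace x y (g, j) p t).data a).card = (M.data a).card := by
      intro a ha
      rw [replace_card hF hx hy hpy, if_neg ha]
    have htops : ∀ q t' l', stk q = t' :: l' → q ≠ (g, j) →
        ((M.replace x y (g, j) p t).data t').Nonempty := by
      intro q t' l' h hq
      rw [← Finset.card_pos, hcard', Finset.card_pos]
      · exact hT q t' l' h
      · rintro rfl
        exact hq (hL.queue_eq (by rw [h]; simp) htmem)
    set s₀ := insert (y, (g, j)) ((M.data p).erase (x, (g, j))) with hs₀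
    set M₀ : Mem U G B P := { M with data := Function.update M.data p s₀ } with hM₀
    -- For `p = t` the first write puts `y = x` back, so the block still has at most `B` entries
    -- when it is read again.
    have hcard₀ : (M₀.data t).card ≤ B := by
      simp only [hM₀, hs₀, Function.update_apply]
      split_ifs with h
      · rw [← hpy h.symm, Finset.insert_erase (by simpa using hdata)]
        exact hF.card_le p
      · exact hF.card_le t
    have hlast : (M₀.data t).erase (y, (g, j)) = (M.replace x y (g, j) p t).data t := by
      simp [Mem.replace, hM₀, hs₀]
    -- The four transfers common to both branches, with an arbitrary continuation: afterwards the
    -- top block is either kept or, if empty, freed.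
    have hrun : ∀ {ρ : Type} (d : Disk U A B Addr₀) (n : ℕ) (f : Finset (U × QueueId G B) →
        DiskProg U A B Addr ρ) (d' : Disk U A B Addr) (z : ρ),
        (f ((M.replace x y (g, j) p t).data t)).RunsIn (fullDisk e (M.replace x y (g, j) p t) d)
          n d' z →
        (do
          let s ← getData A B e p
          putData A e p (insert (y, (g, j)) (s.erase (x, (g, j))))
          let s ← getData A B e t
          putData A e t (s.erase (y, (g, j)))
          f (s.erase (y, (g, j)))).RunsIn (fullDisk e M d) (1 + (1 + (1 + (1 + n)))) d' z := by
      intro ρ d n f d' z h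
      refine (runsIn_getData e hA (hF.card_le _)).bind ((runsIn_putData e _ _).bind
        ((runsIn_getData e (M := M₀) hA hcard₀).bind (Prog.RunsIn.bind
          (runsIn_putData e (M := M₀) _ _) ?_)))
      rw [← hlast] at h
      exact h
    by_cases hempty : (M.replace x y (g, j) p t).data t = ∅
    · refine ⟨(M.replace x y (g, j) p t).popBlock g j t, _, y, fun d => ?_,
        ⟨_, _, _, hL'.popBlock ht, hF'.popBlock ht hempty, TopsNonempty.popBlock hF' ht htops,
          fun g' a b hab => hm' g' a b ⟨hab.ne, hab.left, hab.right, hab.card_le⟩⟩, hysome,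
        hdict, queueOf_replaceLoc hx hy⟩
      refine Prog.RunsIn.mono
        (n := 1 + (1 + (1 + (1 + (1 + (1 + (1 + (1 + (1 + (1 + (1 + (1 + 0))))))))))))
        ((hstart d).bind ((runsIn_getTop e hA g).bind ?_)) (by norm_num)
      simp only [htop]
      refine (runsIn_getData e hA (hF.card_le _)).bind ?_
      rw [hydef]
      refine hrun d _ (fun s => if s = ∅ then _ else _) _ _ ?_
      rw [if_pos hempty]
      exact (runsIn_getNext e hA _).bind ((runsIn_getFree e hA).bind ((runsIn_putFree e _).bind
        ((runsIn_putNext e _ _).bind ((runsIn_putTop e _ _).bind (Prog.runsIn_pure _ _)))))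
    · refine ⟨M.replace x y (g, j) p t, _, y, fun d => ?_,
        ⟨_, _, _, hL', hF', ?_, hm'⟩, hysome, hdict, queueOf_replaceLoc hx hy⟩
      · refine Prog.RunsIn.mono
          (n := 1 + (1 + (1 + (1 + (1 + (1 + (1 + 0)))))))
          ((hstart d).bind ((runsIn_getTop e hA g).bind ?_)) (by norm_num)
        simp only [htop]
        refine (runsIn_getData e hA (hF.card_le _)).bind ?_
        rw [hydef]
        refine hrun d _ (fun s => if s = ∅ then _ else _) _ _ ?_
        rw [if_neg hempty]
        exact Prog.runsIn_pure _ _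
      · intro q t' l' h
        by_cases hq : q = (g, j)
        · subst hq
          rw [ht, List.cons.injEq] at h
          rw [← h.1]
          exact Finset.nonempty_iff_ne_empty.2 hempty
        · exact htops q t' l' h hq

end Operations

end

/-! ### Access to the cuckoo table, and the bodies of the procedures -/

section

/-! ## The dictionary -/

section Dictionary

variable {U : Type} [Fintype U] [DecidableEq U] {A B G P : ℕ} [NeZero A] [NeZero B] [NeZero P]
  [NeZero G] {Addr : Type} [DecidableEq Addr] (D : CuckooData U A B)
  (e : D.Addr ⊕ MemAddr G P ≃ Addr) {M : Mem U G B P}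

open Classical in
/-- The value of the key `x` in a block. -/
def lookBlock (x : U) (b : Block U A B) : Option (Fin A) :=
  if h : ∃ c, (b c).1 = some x then some (b h.choose).2 else none

lemma lookBlock_eq_some {x : U} {b : Block U A B} {v : Fin A} (h : lookBlock x b = some v) :
    ∃ c, (b c).1 = some x ∧ (b c).2 = v := by
  unfold lookBlock at h
  split_ifs at h with h1
  exact ⟨_, h1.choose_spec, Option.some.inj h⟩

lemma lookBlock_eq_none {x : U} {b : Block U A B} (h : lookBlock x b = none) (c : Fin B) :
    (b c).1 ≠ some x := by
  unfold lookBlock at h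
  split_ifs at h with h1
  exact fun hc => h1 ⟨c, hc⟩

/-- Every cell with `x` carries the right value, and a key that is present has its cell in one of
its two buckets. So two reads decide the membership and give the value. -/
lemma Stores.look_eq {D : CuckooData U A B} {d : Disk U A B D.Addr} {h : Hashes U D.g D.r}
    {f : U → Option (Fin A)} (hs : D.Stores (d, h) f) (x : U) :
    (lookBlock x (d (D.bucket h x 0))).or (lookBlock x (d (D.bucket h x 1))) = f x := by
  have key : ∀ j v, lookBlock x (d (D.bucket h x j)) = some v → f x = some v := by
    intro j v hv
    obtain ⟨c, hc, rfl⟩ := lookBlock_eq_some hv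
    exact (hs.1 _ _ _ hc).1
  cases h0 : lookBlock x (d (D.bucket h x 0)) with
  | some v => simp [key 0 v h0]
  | none =>
    cases h1 : lookBlock x (d (D.bucket h x 1)) with
    | some v => simp [key 1 v h1]
    | none =>
      cases hf : f x with
      | none => rfl
      | some v =>
        obtain ⟨p, hp, -⟩ := hs.2 x (by rw [hf]; rfl)
        obtain ⟨-, j, hj⟩ := hs.1 _ _ _ hp
        change (d (.inl p.1) p.2).1 = some x at hp
        change D.bucket h x j = .inl p.1 at hj
        rw [← hj] at hp
        fin_cases j
        · exact (lookBlock_eq_none h0 _ hp).elim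
        · exact (lookBlock_eq_none h1 _ hp).elim

/-- Look up the place of `x` in the dictionary. -/
def lookupProg (h : Hashes U D.g D.r) (x : U) : DiskProg U A B Addr (Option (QueueId G B ⊕ Fin P)) := do
  let b ← Prog.get (e (.inl (D.bucket h x 0))) id
  let b' ← Prog.get (e (.inl (D.bucket h x 1))) id
  pure (((lookBlock x b).or (lookBlock x b')).map (dec _))

variable {D}

lemma runsIn_get_dict {ρ : Type} (d : Disk U A B D.Addr) (a : D.Addr) (f : Block U A B → ρ) :
    (Prog.get (e (.inl a)) f).RunsIn (fullDisk e M d) 1 (fullDisk e M d) (f (d a)) := by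
  have := Prog.runsIn_get (e (.inl a)) f (fullDisk e M d)
  rwa [(embeds_fullDisk e M).read] at this

lemma runsIn_put_dict (d : Disk U A B D.Addr) (a : D.Addr) (b : Block U A B) :
    (Prog.put (e (.inl a)) b).RunsIn (fullDisk e M d) 1
      (fullDisk e M (Function.update d a b)) () := by
  have := Prog.runsIn_put (e (.inl a)) b (fullDisk e M d)
  rwa [← (embeds_fullDisk e M).write d a b] at this

lemma lookupProg_spec (hA : Fits A G B P) {d : Disk U A B D.Addr} {h : Hashes U D.g D.r}
    {δ : U → Option (QueueId G B ⊕ Fin P)} (hs : D.Stores (d, h) fun x => (δ x).map (enc A))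
    (x : U) : (lookupProg D e h x).RunsIn (fullDisk e M d) 2 (fullDisk e M d) (δ x) := by
  have : δ x = ((lookBlock x (d (D.bucket h x 0))).or (lookBlock x (d (D.bucket h x 1)))).map
      (dec _) := by
    rw [Stores.look_eq hs]
    cases δ x with
    | none => rfl
    | some v => simp [dec_enc hA.card_place]
  rw [this]
  exact Prog.RunsIn.mono (n := 1 + (1 + 0)) ((runsIn_get_dict e d _ id).bind
    ((runsIn_get_dict e d _ id).bind (Prog.runsIn_pure _ _))) le_rfl

variable (D) in
/-- Rewrite in place the cell of `x`. -/
def rewriteProg (h : Hashes U D.g D.r) (x : U) (φ : Cell U A → Cell U A) : DiskProg U A B Addr Unit := do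
  let b ← Prog.get (e (.inl (D.bucket h x 0))) id
  Prog.put (e (.inl (D.bucket h x 0))) fun c => if (b c).1 = some x then φ (b c) else b c
  let b ← Prog.get (e (.inl (D.bucket h x 1))) id
  Prog.put (e (.inl (D.bucket h x 1))) fun c => if (b c).1 = some x then φ (b c) else b c

/-- All cells with `x` lie in the two buckets of `x`, which are different blocks because they belong
to different tables. Rewriting these two therefore has the effect of the rewriting in all buckets.
-/
lemma rewriteProg_spec {d : Disk U A B D.Addr} {h : Hashes U D.g D.r} {x : U}
    (φ : Cell U A → Cell U A)
    (hs : ∀ b c, (d (.inl b) c).1 = some x → ∃ j, D.bucket h x j = .inl b) :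
    (rewriteProg D e h x φ).RunsIn (fullDisk e M d) 4 (fullDisk e M (D.rewrite x φ d)) () := by
  set d₁ : Disk U A B D.Addr := Function.update d (D.bucket h x 0) fun c =>
    if (d (D.bucket h x 0) c).1 = some x then φ (d (D.bucket h x 0) c)
      else d (D.bucket h x 0) c with hd₁
  have hne : D.bucket h x 1 ≠ D.bucket h x 0 := by simp [CuckooData.bucket]
  have : D.rewrite x φ d = Function.update d₁ (D.bucket h x 1) fun c =>
      if (d₁ (D.bucket h x 1) c).1 = some x then φ (d₁ (D.bucket h x 1) c)
        else d₁ (D.bucket h x 1) c := by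
    rw [hd₁, Function.update_of_ne hne]
    funext a
    rcases a with b | b
    · by_cases h1 : .inl b = D.bucket h x 1
      · rw [h1, Function.update_self, ← h1]; rfl
      · rw [Function.update_of_ne h1]
        by_cases h0 : .inl b = D.bucket h x 0
        · rw [h0, Function.update_self, ← h0]; rfl
        · rw [Function.update_of_ne h0]
          funext c
          refine if_neg fun hc => ?_
          obtain ⟨j, hj⟩ := hs b c hc
          fin_cases j
          · exact h0 hj.symm
          · exact h1 hj.symm
    · simp [CuckooData.bucket, CuckooData.rewrite]
  rw [this]
  exact Prog.RunsIn.mono (n := 1 + (1 + (1 + 1))) ((runsIn_get_dict e d _ id).bind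
    ((runsIn_put_dict e d _ _).bind ((runsIn_get_dict e d₁ _ id).bind
      (runsIn_put_dict e d₁ _ _)))) le_rfl

end Dictionary

/-! ## The procedures -/

section Procedures

variable {U : Type} [Fintype U] [DecidableEq U] {A B G P : ℕ} [NeZero A] [NeZero B] [NeZero P]
  [NeZero G] {Addr : Type} [DecidableEq Addr] (D : CuckooData U A B)
  (e : D.Addr ⊕ MemAddr G P ≃ Addr) {M : Mem U G B P}
  {loc : U → Option (Fin P × QueueId G B)}

/-- The memory is updated first, which fixes the value `v`; the random part, the insertion into the
table, is the last action. -/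
def enqueueBody (_ : Hashes U D.g D.r) (c : Cell U A) :
    DiskProg U A B Addr (List U × Exit (Cell U A) (U × Fin A) Unit) :=
  match c.1 with
  | none => pure ([], .halt ())
  | some x => do
    let v ← addProg A e x (dec (QueueId G B) c.2)
    pure ([], .call (x, enc A v))

def removeBody (h : Hashes U D.g D.r) (c : Cell U A) :
    DiskProg U A B Addr (List U × Exit (Cell U A) Unit Bool) :=
  match c.1 with
  | none => pure ([], .halt false)
  | some x => do
    match ← lookupProg D e h x with
    | none => pure ([], .halt false)
    | some v =>
      let y ← removeProg A e x v
      rewriteProg D e h y fun c => (c.1, enc A v)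
      rewriteProg D e h x fun c => (none, c.2)
      pure ([], .halt true)

def isMemberBody (h : Hashes U D.g D.r) (c : Cell U A) :
    DiskProg U A B Addr (List U × Exit (Cell U A) Unit Bool) :=
  match c.1 with
  | none => pure ([], .halt false)
  | some x => do
    let v ← lookupProg D e h x
    pure ([], .halt v.isSome)

def locateBody (h : Hashes U D.g D.r) (c : Cell U A) :
    DiskProg U A B Addr (List U × Exit (Cell U A) Unit (Option Addr)) :=
  match c.1 with
  | none => pure ([], .halt none)
  | some x => do
    match ← lookupProg D e h x with
    | none => pure ([], .halt none)
    | some (.inl q) =>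
      let b ← getBase U A e q.1
      pure ([], .halt (some (e (.inr (.data (b q.2))))))
    | some (.inr p) => pure ([], .halt (some (e (.inr (.data p)))))

/-- Stop at the end of a linked list, or go on with the next block. -/
def follow (v : Option (Fin P)) : Exit (Cell U A) Unit Unit :=
  match v with
  | none => .halt ()
  | some p => .loop (none, enc A (.inr p : QueueId G B ⊕ Fin P))

/-- One phase handles one block, and the register tells which: the base of a queue, or a block of
its stack. So the program of a phase has constant length, although the listing as a whole does not.
-/
def traverseBody (_ : Hashes U D.g D.r) (c : Cell U A) :
    DiskProg U A B Addr (List U × Exit (Cell U A) Unit Unit) :=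
  match dec (QueueId G B ⊕ Fin P) c.2 with
  | .inl q => do
    let b ← getBase U A e q.1
    let s ← getData A B e (b q.2)
    let t ← getTop U A e q.1
    pure ((s.filter fun y => y.2 = q).toList.map Prod.fst, follow (G := G) (B := B) (t q.2))
  | .inr p => do
    let s ← getData A B e p
    let n ← getNext U A B e p
    pure (s.toList.map Prod.fst, follow (G := G) (B := B) n)

variable {D} {d : Disk U A B D.Addr} {h : Hashes U D.g D.r}

lemma enqueueBody_spec (hA : Fits A G B P) {x : U} {q : QueueId G B}
    {M' : Mem U G B P} {v : QueueId G B ⊕ Fin P}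
    (hr : (addProg A e x q).RunsIn (fullDisk e M d) 40 (fullDisk e M' d) v) :
    (enqueueBody D e h (some x, enc A q)).RunsIn (fullDisk e M d) 64 (fullDisk e M' d)
      ([], .call (x, enc A v)) := by
  refine Prog.RunsIn.mono (n := 40 + 0) ?_ (by norm_num)
  simp only [enqueueBody, dec_enc hA.card_queue]
  exact hr.bind (Prog.runsIn_pure _ _)

lemma removeBody_of_none (hA : Fits A G B P)
    (hs : D.Stores (d, h) fun x => (dict M loc x).map (enc A)) {x : U} (hx : dict M loc x = none)
    (a : Fin A) :
    (removeBody D e h (some x, a)).RunsIn (fullDisk e M d) 64 (fullDisk e M d)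
      ([], .halt false) := by
  refine Prog.RunsIn.mono (n := 2 + 0) ((lookupProg_spec e hA hs x).bind ?_) (by norm_num)
  rw [hx]
  exact Prog.runsIn_pure _ _

lemma removeBody_of_some (hA : Fits A G B P)
    (hs : D.Stores (d, h) fun x => (dict M loc x).map (enc A)) {x y : U}
    {v : QueueId G B ⊕ Fin P} (hx : dict M loc x = some v) {M' : Mem U G B P}
    (hr : (removeProg A e x v).RunsIn (fullDisk e M d) 40 (fullDisk e M' d) y) (a : Fin A) :
    (removeBody D e h (some x, a)).RunsIn (fullDisk e M d) 64
      (fullDisk e M' (D.rewrite x (fun c => (none, c.2))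
        (D.rewrite y (fun c => (c.1, enc A v)) d))) ([], .halt true) := by
  refine Prog.RunsIn.mono (n := 2 + (40 + (4 + (4 + 0)))) ((lookupProg_spec e hA hs x).bind ?_)
    (by norm_num)
  rw [hx]
  refine hr.bind ((rewriteProg_spec e _ fun b c hc => (hs.1 b c y hc).2).bind
    ((rewriteProg_spec e _ fun b c hc => (hs.1 b c x ?_).2).bind (Prog.runsIn_pure _ _)))
  rw [← hc]
  simp only [CuckooData.rewrite]
  split_ifs <;> rfl

lemma isMemberBody_spec (hA : Fits A G B P)
    (hs : D.Stores (d, h) fun x => (dict M loc x).map (enc A)) (x : U) (a : Fin A) :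
    (isMemberBody D e h (some x, a)).RunsIn (fullDisk e M d) 64 (fullDisk e M d)
      ([], .halt (dict M loc x).isSome) :=
  Prog.RunsIn.mono (n := 2 + 0) ((lookupProg_spec e hA hs x).bind (Prog.runsIn_pure _ _))
    (by norm_num)

lemma locateBody_spec (hA : Fits A G B P)
    (hs : D.Stores (d, h) fun x => (dict M loc x).map (enc A)) (x : U) (a : Fin A) :
    (locateBody D e h (some x, a)).RunsIn (fullDisk e M d) 64 (fullDisk e M d)
      ([], .halt ((loc x).map fun z => e (.inr (.data z.1)))) := by
  refine Prog.RunsIn.mono (n := 2 + (1 + 0)) ((lookupProg_spec e hA hs x).bind ?_)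
    (by norm_num)
  cases hx : loc x with
  | none =>
    simp only [dict, hx]
    exact (Prog.runsIn_pure _ _).mono (by norm_num)
  | some z =>
    simp only [dict, hx, Option.map_some]
    by_cases hz : M.base z.2.1 z.2.2 = z.1
    · rw [if_pos hz, ← hz]
      exact (runsIn_getBase e hA _).bind (Prog.runsIn_pure _ _)
    · rw [if_neg hz]
      exact (Prog.runsIn_pure _ _).mono (by norm_num)

/-! ### Listing a queue -/

/-- The elements of the block `p`. -/
def blockItems (M : Mem U G B P) (p : Fin P) : List U := (M.data p).toList.map Prod.fst

variable {stk : QueueId G B → List (Fin P)} {fr : List (Fin P)} {role : Fin P → Role G B}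

/-- The items that are output when the queue `q` is listed. -/
def queueItems (M : Mem U G B P) (stk : QueueId G B → List (Fin P)) (q : QueueId G B) : List U :=
  ((M.data (M.base q.1 q.2)).filter fun y => y.2 = q).toList.map Prod.fst ++
    (stk q).flatMap (blockItems M)

lemma mem_queueItems (hL : Linked M stk fr role) (hF : Filled M loc stk) (q : QueueId G B) (x : U) :
    x ∈ queueItems M stk q ↔ queueOf loc x = some q := by
  simp only [queueItems, blockItems, List.mem_append, List.mem_map, Finset.mem_toList,
    Finset.mem_filter, List.mem_flatMap]
  constructor
  · rintro (⟨⟨y, q'⟩, ⟨hy, rfl⟩, rfl⟩ | ⟨p, hp, ⟨y, q'⟩, hy, rfl⟩)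
    · exact hF.queueOf_eq hy
    · rw [← hL.queue_of_mem_stk hF hp hy]
      exact hF.queueOf_eq hy
  · intro h
    cases hx : loc x with
    | none => simp [queueOf, hx] at h
    | some z =>
      obtain ⟨p, q'⟩ := z
      simp only [queueOf, hx, Option.map_some, Option.some.injEq] at h
      subst h
      rcases hF.place hx with h1 | h1
      · left
        subst h1
        exact ⟨(x, q'), ⟨(hF.data_iff _ _ _).2 hx, rfl⟩, rfl⟩
      · exact .inr ⟨p, h1, (x, q'), (hF.data_iff _ _ _).2 hx, rfl⟩

lemma nodup_queueItems (hL : Linked M stk fr role) (hF : Filled M loc stk) (q : QueueId G B) :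
    (queueItems M stk q).Nodup := by
  have hinj : ∀ s : Finset (U × QueueId G B), (∀ y ∈ s, queueOf loc y.1 = some y.2) →
      (s.toList.map Prod.fst).Nodup := by
    intro s hs
    refine List.Nodup.map_on ?_ (Finset.nodup_toList _)
    intro y hy z hz h
    have h1 := hs y (by simpa using hy)
    have h2 := hs z (by simpa using hz)
    rw [h, h2, Option.some.injEq] at h1
    exact Prod.ext h h1.symm
  have hdisj : ∀ p p', p ≠ p' → ∀ y ∈ M.data p, ∀ z ∈ M.data p', y.1 ≠ z.1 := by
    rintro p p' hp ⟨y, q⟩ hy ⟨z, q'⟩ hz rfl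
    rw [hF.data_iff] at hy hz
    rw [hy] at hz
    simp only [Option.some.injEq, Prod.mk.injEq] at hz
    exact hp hz.1
  rw [queueItems, List.nodup_append]
  refine ⟨hinj _ fun y hy => hF.queueOf_eq (Finset.mem_of_mem_filter _ hy), ?_, ?_⟩
  · rw [List.nodup_flatMap]
    refine ⟨fun p _ => hinj _ fun y hy => hF.queueOf_eq hy, (hL.stk_nodup q).imp fun {p p'} hp => ?_⟩
    intro x hx hx'
    simp only [blockItems, List.mem_map, Finset.mem_toList] at hx hx'
    obtain ⟨y, hy, rfl⟩ := hx
    obtain ⟨z, hz, hyz⟩ := hx'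
    exact hdisj p p' hp y hy z hz hyz.symm
  · intro x hx x' hx' h
    simp only [blockItems, List.mem_map, Finset.mem_toList, Finset.mem_filter,
      List.mem_flatMap] at hx hx'
    obtain ⟨y, ⟨hy, -⟩, rfl⟩ := hx
    obtain ⟨p, hp, z, hz, rfl⟩ := hx'
    exact hdisj _ p (by rintro rfl; exact hL.base_not_mem_stk _ _ _ hp) y hy z hz h

lemma traverseBody_inl (hA : Fits A G B P) (hF : Filled M loc stk) (q : QueueId G B) :
    (traverseBody D e h (none, enc A (.inl q : QueueId G B ⊕ Fin P))).RunsIn (fullDisk e M d) 3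
      (fullDisk e M d)
      (((M.data (M.base q.1 q.2)).filter fun y => y.2 = q).toList.map Prod.fst,
        follow (G := G) (B := B) (M.top q.1 q.2)) := by
  simp only [traverseBody, dec_enc hA.card_place]
  exact Prog.RunsIn.mono (n := 1 + (1 + (1 + 0))) ((runsIn_getBase e hA _).bind
    ((runsIn_getData e hA (hF.card_le _)).bind
      ((runsIn_getTop e hA _).bind (Prog.runsIn_pure _ _)))) le_rfl

lemma traverseBody_inr (hA : Fits A G B P) (hF : Filled M loc stk) (p : Fin P) :
    (traverseBody D e h (none, enc A (.inr p : QueueId G B ⊕ Fin P))).RunsIn (fullDisk e M d) 2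
      (fullDisk e M d) (blockItems M p, follow (G := G) (B := B) (M.next p)) := by
  simp only [traverseBody, dec_enc hA.card_place]
  exact Prog.RunsIn.mono (n := 1 + (1 + 0)) ((runsIn_getData e hA (hF.card_le _)).bind
    ((runsIn_getNext e hA _).bind (Prog.runsIn_pure _ _))) le_rfl

variable {m : ℕ} {α : Type} {I : Proc U A B D.g D.r D.Addr m Unit Unit} {arg : α → Cell U A}

/-- Induction along the stack. Before the final phase each phase costs at most three transfers and
the dummy read, hence 4 per block of `l`; the summand 64 is the generic bound for the final phase.
The hypothesis on `c` fits both kinds of phases, so it is passed on with `.inr p` in the register.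
-/
lemma traverse_yields (hA : Fits A G B P) (hA' : 64 + 1 < A) (hF : Filled M loc stk)
    (l : List (Fin P)) {c : Cell U A} {items : List U} {t : Option (Fin P)}
    (hc : (traverseBody D e h c).RunsIn (fullDisk e M d) 3 (fullDisk e M d)
      (items, follow (G := G) (B := B) t))
    (ht : Chain M.next t l) (w : Cache U A B m) (s : Fin 64 → Block U A B) (out : List U) :
    (machine 64 I (fun a => e (.inl a)) (e (.inr .free)) arg (traverseBody D e)).Yields
      (4 * l.length + 64) ⟨pack w 0 c s, (fullDisk e M d, h), out⟩
      ⟨(fullDisk e M d, h), (), out ++ (items ++ l.flatMap (blockItems M))⟩ := by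
  induction l generalizing c items t s out with
  | nil =>
    obtain rfl : t = none := ht
    simpa using machine_yields_of_halt (I := I) (e := fun a => e (.inl a))
      (dummy := e (.inr .free)) (arg := arg) hA' w out s (hc.mono (by norm_num))
  | cons p l ih =>
    obtain ⟨rfl, ht⟩ := ht
    obtain ⟨n, hn, s', hs⟩ := machine_steps_of_loop (I := I) (e := fun a => e (.inl a))
      (dummy := e (.inr .free)) (arg := arg) hA' w out s (by norm_num) hc
    have := hs.yields (ih ((traverseBody_inr e hA hF p).mono (by norm_num)) ht s' (out ++ items))
    rw [List.flatMap_cons]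
    simp only [List.append_assoc] at this ⊢
    refine this.mono ?_
    rw [List.length_cons]
    omega

end Procedures

end

/-! ### The simulation of the multiqueue by the cuckoo table -/

section

/-! ## The multiqueue -/

lemma push_coe {S T : Type} (φ : S → T) (p : PMF S) : push φ p = p.map φ := by
  classical
  funext t
  simp [push, PMF.map_apply, PMF.pure_apply]

lemma push_pure {S T : Type} (φ : S → T) (s : S) : push φ (PMF.pure s) = PMF.pure (φ s) := by
  rw [push_coe, PMF.pure_map]

section Multiqueue

variable {U : Type} [Fintype U] [DecidableEq U] {A B G P : ℕ} [NeZero A] [NeZero B] [NeZero P]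
  [NeZero G] {n K N : ℕ} (D : CuckooData U A B) (e : D.Addr ⊕ MemAddr G P ≃ Fin n)
  (M₀ : Mem U G B P) (idx : Fin K → QueueId G B)

/-- A multiqueue based on a cuckoo table. -/
abbrev multiqueue : Multiqueue U A B K D.g D.r where
  blocks := n
  m := D.m + (64 + 2)
  empty := fullDisk e M₀ D.empty
  enqueue := machine 64 D.insert (fun a => e (.inl a)) (e (.inr .free))
    (fun x => (some x.1, enc A (idx x.2))) (enqueueBody D e)
  remove := machine 64 (idle (Addr₀ := D.Addr) D.m false) (fun a => e (.inl a)) (e (.inr .free))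
    (fun x => (some x, 0)) (removeBody D e)
  isMember := machine 64 (idle (Addr₀ := D.Addr) D.m false) (fun a => e (.inl a))
    (e (.inr .free)) (fun x => (some x, 0)) (isMemberBody D e)
  locate := machine 64 (idle (Addr₀ := D.Addr) D.m none) (fun a => e (.inl a)) (e (.inr .free))
    (fun x => (some x, 0)) (locateBody D e)
  traverse := machine 64 (idle (Addr₀ := D.Addr) D.m ()) (fun a => e (.inl a)) (e (.inr .free))
    (fun i => (none, enc A (.inl (idx i) : QueueId G B ⊕ Fin P))) (traverseBody D e)

/-- The dictionary after a sequence of operations. -/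
def dictAfter (ops : List (DictOp U A)) : U → Option (Fin A) :=
  ops.foldl DictOp.apply fun _ => none

/-- After the operations `ops`, the memory is `M`, and the dictionary is as after the operations
`dops`. -/
structure Simulates (N : ℕ) (ops : List (QueueOp U K)) (dops : List (DictOp U A))
    (M : Mem U G B P) (loc : U → Option (Fin P × QueueId G B)) : Prop where
  allowed : CuckooData.Allowed N dops
  valid : Valid M loc
  dict_eq : dictAfter dops = fun x => (dict M loc x).map (enc A)
  queue_eq : queueOf loc = fun x => (queuesAfter ops x).map idx
  law_eq : (multiqueue D e M₀ idx).law ops = push (mapState (fullDisk e M)) (D.law dops)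

variable {D e M₀ idx} {ops : List (QueueOp U K)} {dops : List (DictOp U A)} {M : Mem U G B P}
  {loc : U → Option (Fin P × QueueId G B)}

lemma isSome_queuesAfter (hS : Simulates D e M₀ idx N ops dops M loc) (x : U) :
    (queuesAfter ops x).isSome = (loc x).isSome := by
  have := congrFun hS.queue_eq x
  simp only [queueOf] at this
  rw [← Option.isSome_map (f := idx), ← this, Option.isSome_map]

lemma isSome_dict (M : Mem U G B P) (loc : U → Option (Fin P × QueueId G B)) (x : U) :
    (dict M loc x).isSome = (loc x).isSome := by
  simp [dict]

lemma isSome_dictAfter (hS : Simulates D e M₀ idx N ops dops M loc) (x : U) :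
    (dictAfter dops x).isSome = (loc x).isSome := by
  rw [hS.dict_eq]
  simp [dict]

lemma stores_of_simulates (hD : D.IsCuckooTable N) (hS : Simulates D e M₀ idx N ops dops M loc)
    {s : State U A B D.g D.r D.Addr} (hs : D.law dops s ≠ 0) :
    D.Stores s fun x => (dict M loc x).map (enc A) := by
  have := (hD dops hS.allowed).2 s hs
  change D.Stores s (dictAfter dops) at this
  rwa [hS.dict_eq] at this

lemma queuesAfter_append (ops : List (QueueOp U K)) (o : QueueOp U K) :
    queuesAfter (ops ++ [o]) = QueueOp.apply (queuesAfter ops) o := by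
  simp [queuesAfter]

lemma allowed_append {os : List (DictOp U A)} :
    CuckooData.Allowed N (dops ++ os) ↔
      CuckooData.Allowed N dops ∧ AllowedSeq DictOp.apply (DictOp.Ok N) os (dictAfter dops) :=
  allowedSeq_append

lemma allowedOps_append {o : QueueOp U K} :
    AllowedOps N (ops ++ [o]) ↔ AllowedOps N ops ∧ QueueOp.Ok N (queuesAfter ops) o := by
  rw [AllowedOps, allowedSeq_append]
  simp [AllowedSeq, AllowedOps, queuesAfter]

lemma law_append (T : Multiqueue U A B K D.g D.r) (o : QueueOp U K) :
    T.law (ops ++ [o]) = fun s₁ => ∑' s, T.law ops s * T.trans o s s₁ := by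
  rw [Multiqueue.law, lawAfter_append]
  rfl

lemma dict_law_append (os : List (DictOp U A)) :
    D.law (dops ++ os) = lawAfter D.trans os (D.law dops) := lawAfter_append _ _ _ _

lemma simulates_nil (hM : Valid M₀ fun _ => none) :
    Simulates D e M₀ idx N [] [] M₀ fun _ => none where
  allowed := trivial
  valid := hM
  dict_eq := rfl
  queue_eq := rfl
  law_eq := by
    change initialLaw _ = push _ (initialLaw _)
    rw [initialLaw, initialLaw, push_coe, PMF.map_comp]
    rfl

lemma lawAfter_singleton_pure {Op S : Type} (T : Op → S → S → ℝ≥0∞) (o : Op) (s : S) :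
    lawAfter T [o] (PMF.pure s) = T o s := by
  funext s₁
  exact tsum_pure_mul s fun s' => T o s' s₁

/-- The dictionary operation that corresponds to an `enqueue`. -/
lemma exists_enqueue (hA : Fits A G B P) (hP : G * B + 3 * N < P * B)
    (hS : Simulates D e M₀ idx N ops dops M loc) {x : U} {i : Fin K}
    (hok : AllowedOps N (ops ++ [.enqueue x i])) :
    ∃ M' loc' v, (∀ d h, (enqueueBody D e h (some x, enc A (idx i))).RunsIn (fullDisk e M d) 64
        (fullDisk e M' d) ([], .call (x, enc A v))) ∧ Valid M' loc' ∧
      CuckooData.Allowed N (dops ++ [.insert x (enc A v)]) ∧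
      dict M' loc' = Function.update (dict M loc) x (some v) ∧
      queueOf loc' = Function.update (queueOf loc) x (some (idx i)) := by
  obtain ⟨-, hxq, hcount⟩ := allowedOps_append.1 hok
  have hx : loc x = none := by
    have := isSome_queuesAfter hS x
    rw [hxq] at this
    simpa using this.symm
  have hcount' : (Finset.univ.filter fun x => (loc x).isSome = true).card < N := by
    rw [count] at hcount
    simpa only [isSome_queuesAfter hS] using hcount
  obtain ⟨M', loc', v, hr, hM', hd, hq⟩ := addProg_spec (Addr₀ := D.Addr) e hA hS.valid
    (by omega) hx (idx i)
  refine ⟨M', loc', v, fun d h => enqueueBody_spec e hA (hr d), hM', ?_, hd, hq⟩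
  rw [allowed_append]
  refine ⟨hS.allowed, ⟨?_, ?_⟩, trivial⟩
  · have := isSome_dictAfter hS x
    rw [hx] at this
    simpa using this
  · simpa only [count, isSome_dictAfter hS] using hcount'

lemma simulates_enqueue (hA : Fits A G B P) (hA' : 64 + 1 < A) (hP : G * B + 3 * N < P * B)
    (hS : Simulates D e M₀ idx N ops dops M loc) {x : U} {i : Fin K}
    (hok : AllowedOps N (ops ++ [.enqueue x i])) :
    ∃ dops' M' loc', Simulates D e M₀ idx N (ops ++ [.enqueue x i]) dops' M' loc' := by
  obtain ⟨M', loc', v, hr, hM', hall, hd, hq⟩ := exists_enqueue hA hP hS hok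
  refine ⟨_, M', loc', hall, hM', ?_, ?_, ?_⟩
  · rw [hd]
    have h1 := hS.dict_eq
    simp only [dictAfter, List.foldl_append, List.foldl_cons, List.foldl_nil,
      DictOp.apply] at h1 ⊢
    rw [h1]
    funext y
    by_cases hy : y = x
    · subst hy; simp
    · simp [hy]
  · rw [hq, queuesAfter_append, hS.queue_eq]
    funext y
    by_cases hy : y = x
    · subst hy; simp [QueueOp.apply]
    · simp [QueueOp.apply, hy]
  · rw [law_append, dict_law_append, hS.law_eq]
    refine push_step (TS := D.trans) (TT := (multiqueue D e M₀ idx).trans (.enqueue x i))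
      fun s _ => ?_
    rw [lawAfter_singleton_pure]
    exact machine_call_stateLaw hA' (embeds_fullDisk e M')
      (arg := fun x : U × Fin K => ((some x.1, enc A (idx x.2)) : Cell U A)) (a := (x, i))
      (hr s.1 s.2)

/-- The memory and the value `v` do not depend on the random choices, so the insertion ends a
sequence of dictionary operations fixed in advance, and its cost is one of the terms in the supremum
`insertionCost`. The number 65 stands for 64 transfers and the dummy read. -/
lemma expectedCost_enqueue_le (hA : Fits A G B P) (hA' : 64 + 1 < A)
    (hP : G * B + 3 * N < P * B) (hD : D.IsCuckooTable N)
    (hS : Simulates D e M₀ idx N ops dops M loc) {x : U} {i : Fin K}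
    (hok : AllowedOps N (ops ++ [.enqueue x i])) :
    ∑' s, (multiqueue D e M₀ idx).law ops s *
        (multiqueue D e M₀ idx).enqueue.expectedCost (x, i) s ≤ 65 + D.insertionCost N := by
  obtain ⟨M', loc', v, hr, hM', hall, hd, hq⟩ := exists_enqueue hA hP hS hok
  rw [hS.law_eq, tsum_push_mul]
  calc ∑' s, D.law dops s * (multiqueue D e M₀ idx).enqueue.expectedCost (x, i)
        (mapState (fullDisk e M) s)
      ≤ ∑' s, D.law dops s * (65 + D.insert.expectedCost (x, enc A v) s) := by
        refine ENNReal.tsum_le_tsum fun s => ?_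
        gcongr
        refine (machine_call_expectedCost hA' (embeds_fullDisk e M')
          (arg := fun x : U × Fin K => ((some x.1, enc A (idx x.2)) : Cell U A)) (a := (x, i))
          (hr s.1 s.2)).trans_eq ?_
        norm_num
    _ = 65 + ∑' s, D.law dops s * D.insert.expectedCost (x, enc A v) s := by
        simp_rw [mul_add]
        -- The constant comes out of the sum because the law of the table has total mass one.
        rw [ENNReal.tsum_add, ENNReal.tsum_mul_right, (hD dops hS.allowed).1, one_mul]
    _ ≤ 65 + D.insertionCost N := by
        gcongr
        exact le_iSup_of_le dops (le_iSup_of_le x (le_iSup_of_le (enc A v)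
          (le_iSup_of_le hall le_rfl)))

lemma remove_yields_of_none (hA : Fits A G B P) (hA' : 64 + 1 < A) {d : Disk U A B D.Addr}
    {h : Hashes U D.g D.r} (hs : D.Stores (d, h) fun x => (dict M loc x).map (enc A)) {x : U}
    (hx : dict M loc x = none) :
    (multiqueue D e M₀ idx).remove.Yields 64
      ((multiqueue D e M₀ idx).remove.start x (fullDisk e M d, h))
      ⟨(fullDisk e M d, h), false, []⟩ :=
  machine_yields_of_halt hA' _ [] _ (removeBody_of_none e hA hs hx 0)

/-- The order of the quantifiers matters: the new memory and `y` are the same for all table disks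
`d` and hash functions `h`. This keeps the simulating sequence of dictionary operations independent
of chance. -/
lemma exists_remove_yields (hA : Fits A G B P) (hA' : 64 + 1 < A) (hM : Valid M loc) {x : U}
    {v : QueueId G B ⊕ Fin P} (hx : dict M loc x = some v) :
    ∃ M' loc' y, Valid M' loc' ∧ (dict M loc y).isSome = true ∧
      dict M' loc' = Function.update (Function.update (dict M loc) y (some v)) x none ∧
      queueOf loc' = Function.update (queueOf loc) x none ∧
      ∀ d h, D.Stores (d, h) (fun x => (dict M loc x).map (enc A)) →
        (multiqueue D e M₀ idx).remove.Yields 64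
          ((multiqueue D e M₀ idx).remove.start x (fullDisk e M d, h))
          ⟨(fullDisk e M' (D.rewrite x (fun c => (none, c.2))
            (D.rewrite y (fun c => (c.1, enc A v)) d)), h), true, []⟩ := by
  obtain ⟨M', loc', y, hr, hM', hy, hd, hq⟩ := removeProg_spec (Addr₀ := D.Addr) e hA hM hx
  exact ⟨M', loc', y, hM', hy, hd, hq, fun d h hs =>
    machine_yields_of_halt hA' _ [] _ (removeBody_of_some e hA hs hx (hr d) 0)⟩

/-- The removal of an absent element corresponds to no dictionary operation; that of a present one
to the assignment of its value to `y`, followed by its erasure. If `y = x`, the assignment changes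
nothing. -/
lemma simulates_remove (hA : Fits A G B P) (hA' : 64 + 1 < A) (hD : D.IsCuckooTable N)
    (hS : Simulates D e M₀ idx N ops dops M loc) (x : U) :
    ∃ dops' M' loc', Simulates D e M₀ idx N (ops ++ [.remove x]) dops' M' loc' := by
  cases hx : dict M loc x with
  | none =>
    refine ⟨dops, M, loc, hS.allowed, hS.valid, hS.dict_eq, ?_, ?_⟩
    · rw [hS.queue_eq, queuesAfter_append]
      have : queuesAfter ops x = none := by
        have h1 := isSome_queuesAfter hS x
        rw [← isSome_dict M, hx] at h1
        simpa using h1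
      rw [QueueOp.apply, Function.update_eq_self_iff.2 this.symm]
    · rw [law_append, hS.law_eq]
      refine push_step (TS := D.trans) (TT := (multiqueue D e M₀ idx).trans (.remove x)) (os := [])
        fun s hs => ?_
      rw [lawAfter, push_pure]
      exact (remove_yields_of_none hA hA' (stores_of_simulates hD hS hs) hx).stateLaw_eq
  | some v =>
    obtain ⟨M', loc', y, hM', hy, hd, hq, hyield⟩ :=
      exists_remove_yields (M₀ := M₀) (idx := idx) (D := D) (e := e) hA hA' hS.valid hx
    refine ⟨dops ++ [.assign y (enc A v), .erase x], M', loc', ?_, hM', ?_, ?_, ?_⟩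
    · rw [allowed_append]
      exact ⟨hS.allowed, trivial, trivial, trivial⟩
    · rw [hd]
      have h1 := hS.dict_eq
      simp only [dictAfter, List.foldl_append, List.foldl_cons, List.foldl_nil,
        DictOp.apply] at h1 ⊢
      rw [h1]
      obtain ⟨w, hw⟩ := Option.isSome_iff_exists.1 hy
      funext z
      simp only [Function.update_apply]
      split_ifs with h2 h3
      · rfl
      · rw [hw]; rfl
      · rfl
    · rw [hq, queuesAfter_append, hS.queue_eq]
      funext z
      simp only [QueueOp.apply, Function.update_apply]
      split_ifs <;> rfl
    · rw [law_append, dict_law_append, hS.law_eq]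
      refine push_step (TS := D.trans) (TT := (multiqueue D e M₀ idx).trans (.remove x))
        fun s hs => ?_
      have h1 : lawAfter D.trans [.assign y (enc A v), .erase x] (PMF.pure s) = PMF.pure
          ((D.rewrite x (fun c => (none, c.2)) (D.rewrite y (fun c => (c.1, enc A v)) s.1), s.2) :
            State U A B D.g D.r D.Addr) := by
        rw [show [DictOp.assign y (enc A v), DictOp.erase x] =
            [DictOp.assign y (enc A v)] ++ [DictOp.erase x] from rfl, lawAfter_append,
          lawAfter_singleton_pure]
        exact lawAfter_singleton_pure D.trans (.erase x) _
      rw [h1, push_pure]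
      exact (hyield s.1 s.2 (stores_of_simulates hD hS hs)).stateLaw_eq

lemma exists_simulates (hA : Fits A G B P) (hA' : 64 + 1 < A) (hP : G * B + 3 * N < P * B)
    (hD : D.IsCuckooTable N) (hM : Valid M₀ fun _ => none) (ops : List (QueueOp U K))
    (hok : AllowedOps N ops) :
    ∃ dops M loc, Simulates D e M₀ idx N ops dops M loc := by
  induction ops using List.reverseRecOn with
  | nil => exact ⟨[], M₀, _, simulates_nil hM⟩
  | append_singleton ops o ih =>
    obtain ⟨dops, M, loc, hS⟩ := ih (allowedOps_append.1 hok).1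
    cases o with
    | enqueue x i => exact simulates_enqueue hA hA' hP hS hok
    | remove x => exact simulates_remove hA hA' hD hS x

/-! ### The states that can be reached -/

variable {d : Disk U A B D.Addr} {h : Hashes U D.g D.r}

lemma remove_correct (hA : Fits A G B P) (hA' : 64 + 1 < A)
    (hS : Simulates D e M₀ idx N ops dops M loc)
    (hs : D.Stores (d, h) fun x => (dict M loc x).map (enc A)) (x : U) :
    ∃ s', (multiqueue D e M₀ idx).remove.Yields 64
      ((multiqueue D e M₀ idx).remove.start x (fullDisk e M d, h))
      ⟨s', (queuesAfter ops x).isSome, []⟩ := by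
  rw [isSome_queuesAfter hS, ← isSome_dict M]
  cases hx : dict M loc x with
  | none => exact ⟨_, remove_yields_of_none hA hA' hs hx⟩
  | some v =>
    obtain ⟨M', loc', y, -, -, -, -, hyield⟩ :=
      exists_remove_yields (M₀ := M₀) (idx := idx) (D := D) (e := e) hA hA' hS.valid hx
    exact ⟨_, hyield d h hs⟩

lemma isMember_yields (hA : Fits A G B P) (hA' : 64 + 1 < A)
    (hS : Simulates D e M₀ idx N ops dops M loc)
    (hs : D.Stores (d, h) fun x => (dict M loc x).map (enc A)) (x : U) :
    (multiqueue D e M₀ idx).isMember.Yields 64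
      ((multiqueue D e M₀ idx).isMember.start x (fullDisk e M d, h))
      ⟨(fullDisk e M d, h), (queuesAfter ops x).isSome, []⟩ := by
  rw [isSome_queuesAfter hS, ← isSome_dict M]
  exact machine_yields_of_halt hA' _ [] _ (isMemberBody_spec e hA hs x 0)

lemma locate_yields (hA : Fits A G B P) (hA' : 64 + 1 < A)
    (hs : D.Stores (d, h) fun x => (dict M loc x).map (enc A)) (x : U) :
    (multiqueue D e M₀ idx).locate.Yields 64
      ((multiqueue D e M₀ idx).locate.start x (fullDisk e M d, h))
      ⟨(fullDisk e M d, h), (loc x).map fun z => e (.inr (.data z.1)), []⟩ :=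
  machine_yields_of_halt hA' _ [] _ (locateBody_spec e hA hs x 0)

lemma elements_eq (hidx : Function.Injective idx) (hS : Simulates D e M₀ idx N ops dops M loc)
    (i : Fin K) : elements (queuesAfter ops) i =
      Finset.univ.filter fun x => queueOf loc x = some (idx i) := by
  rw [hS.queue_eq]
  ext x
  simp only [elements, Finset.mem_filter, Finset.mem_univ, true_and, Option.map_eq_some_iff]
  constructor
  · exact fun hx => ⟨i, hx, rfl⟩
  · rintro ⟨k, hk, hki⟩
    rw [hk, hidx hki]

lemma le_div_add_one_of_mul_le {a b s : ℕ} (hb : 0 < b) (h : a * b ≤ s + b) :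
    a ≤ s / b + 1 := by
  rw [← Nat.add_div_right _ hb]
  exact (Nat.le_div_iff_mul_le hb).2 h

lemma traverse_correct (hA : Fits A G B P) (hA' : 64 + 1 < A) (hidx : Function.Injective idx)
    (hS : Simulates D e M₀ idx N ops dops M loc) (i : Fin K) :
    ∃ out : List U, (multiqueue D e M₀ idx).traverse.Yields
        (68 * ((elements (queuesAfter ops) i).card / B + 1))
        ((multiqueue D e M₀ idx).traverse.start i (fullDisk e M d, h))
        ⟨(fullDisk e M d, h), (), out⟩ ∧
      out.Nodup ∧ out.toFinset = elements (queuesAfter ops) i := by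
  obtain ⟨stk, fr, role, hL, hF, hT, hm⟩ := hS.valid
  refine ⟨queueItems M stk (idx i), ?_, nodup_queueItems hL hF _, ?_⟩
  · have h1 := hL.length_stk_mul_le hF (idx i)
    rw [← elements_eq hidx hS] at h1
    have h2 := le_div_add_one_of_mul_le (Nat.pos_of_neZero B) h1
    exact (traverse_yields e hA hA' hF (stk (idx i)) (traverseBody_inl e hA hF (idx i))
      (hL.stk_chain _) _ _ []).mono (by
        generalize (elements (queuesAfter ops) i).card / B = k at h2 ⊢
        omega)
  · rw [elements_eq hidx hS]
    ext x
    simp [mem_queueItems hL hF]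

/-- The home of an element is the data block that contains it. The homes of one queue are among its
base and its stack, whose length is controlled by the queue; the homes of all elements are among the
blocks in use. -/
lemma locationAware (hA : Fits A G B P) (hA' : 64 + 1 < A) (hidx : Function.Injective idx)
    (hG : G * B ≤ K + B) (hS : Simulates D e M₀ idx N ops dops M loc)
    (hs : D.Stores (d, h) fun x => (dict M loc x).map (enc A)) :
    (multiqueue D e M₀ idx).LocationAware 64 (fullDisk e M d, h) (queuesAfter ops) := by
  classical
  obtain ⟨stk, fr, role, hL, hF, hT, hm⟩ := hS.valid
  have hB : 0 < B := Nat.pos_of_neZero B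
  refine ⟨fun x => (loc x).map fun z => e (.inr (.data z.1)), fun x => ?_, fun x hx => ?_,
    fun x hx => ?_, fun i => ?_, ?_⟩
  · have hy := locate_yields (M₀ := M₀) (idx := idx) (e := e) hA hA' hs x
    refine ⟨hy.worstCase, fun o ho => ?_⟩
    rw [hy.eq_of_law_ne_zero ho]
    exact ⟨rfl, rfl⟩
  · have h1 := isSome_queuesAfter hS x
    rw [hx] at h1
    have : loc x = none := by simpa using h1.symm
    simp [this]
  · rw [isSome_queuesAfter hS, Option.isSome_iff_exists] at hx
    obtain ⟨⟨p, q⟩, hz⟩ := hx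
    obtain ⟨c, hc⟩ := exists_encData_eq (A := A) (hF.card_le p) ((hF.data_iff _ _ _).2 hz)
    refine ⟨e (.inr (.data p)), c, by simp [hz], ?_⟩
    change (fullDisk e M d (e (.inr (.data p))) c).1 = some x
    rw [fullDisk_mem]
    exact congrArg Prod.fst hc
  · have h1 := hL.length_stk_mul_le hF (idx i)
    rw [← elements_eq hidx hS] at h1
    have h2 := le_div_add_one_of_mul_le hB h1
    have h3 : (elements (queuesAfter ops) i).image
        (fun x => (loc x).map fun z => e (.inr (.data z.1))) ⊆
        (M.base (idx i).1 (idx i).2 :: stk (idx i)).toFinset.image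
          fun p => some (e (.inr (.data p))) := by
      intro a ha
      rw [elements_eq hidx hS] at ha
      simp only [Finset.mem_image, Finset.mem_filter, Finset.mem_univ, true_and, queueOf,
        Option.map_eq_some_iff] at ha
      obtain ⟨x, ⟨⟨p, q⟩, hz, hq⟩, rfl⟩ := ha
      simp only at hq
      subst hq
      rw [Finset.mem_image]
      refine ⟨p, ?_, by simp [hz]⟩
      rw [List.mem_toFinset, List.mem_cons]
      exact (hF.place hz).imp Eq.symm id
    have h4 := (Finset.card_le_card h3).trans
      (Finset.card_image_le.trans (List.toFinset_card_le _))
    rw [List.length_cons] at h4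
    refine h4.trans ?_
    generalize (elements (queuesAfter ops) i).card / B = k at h2 ⊢
    omega
  · have h1 := hL.card_used_mul_le hF hm
    have h2 : count (queuesAfter ops) =
        (Finset.univ.filter fun x => (loc x).isSome = true).card := by
      simp only [count, isSome_queuesAfter hS]
    rw [← h2] at h1
    have h3 : (Finset.univ.filter fun x => (queuesAfter ops x).isSome = true).image
        (fun x => (loc x).map fun z => e (.inr (.data z.1))) ⊆
        (Finset.univ.filter fun p => role p ≠ .free).image
          fun p => some (e (.inr (.data p))) := by
      intro a ha
      simp only [Finset.mem_image, Finset.mem_filter, Finset.mem_univ, true_and,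
        isSome_queuesAfter hS, Option.isSome_iff_exists] at ha
      obtain ⟨x, ⟨⟨p, q⟩, hz⟩, rfl⟩ := ha
      rw [Finset.mem_image]
      refine ⟨p, ?_, by simp [hz]⟩
      simp only [Finset.mem_filter, Finset.mem_univ, true_and]
      intro hp
      have := hL.data_free hF ((hL.mem_fr p).2 hp)
      have hd := (hF.data_iff _ _ _).2 hz
      rw [this] at hd
      simp at hd
    have h4 := (Finset.card_le_card h3).trans Finset.card_image_le
    -- With `n` elements, `G * B + 3 * n` is at most `K + B + 3 * n`; rounding down in the division
    -- loses less than `B`, so the factor 4 suffices.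
    have h5 : (Finset.univ.filter fun p => role p ≠ .free).card ≤
        4 * ((count (queuesAfter ops) + K) / B + 1) := by
      have h6 := Nat.lt_div_mul_add (a := count (queuesAfter ops) + K) hB
      refine Nat.le_of_mul_le_mul_right (c := B) ?_ hB
      refine h1.trans ?_
      have : 4 * ((count (queuesAfter ops) + K) / B + 1) * B =
        4 * ((count (queuesAfter ops) + K) / B * B) + 4 * B := by ring
      rw [this]
      omega
    exact h4.trans (h5.trans (by gcongr; norm_num))

end Multiqueue

end

end

end ExtMem

/-! ### The choice of the parameters -/

theorem theorem2 :
    ∃ C : ℕ, ∀ (U : Type) [Fintype U] [DecidableEq U] (B A N K γ : ℕ),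
      -- blocks are not void, and integer words have enough bits for pointers and counters
      0 < B → C * (γ + 1) * (N + K + B + 1) ≤ A →
      -- any external-memory cuckoo table of size `N` with `O(N / B)` blocks
      ∀ D : ExtMem.CuckooData U A B, D.IsCuckooTable N → D.blocks ≤ γ * (N / B + 1) →
      ∃ M : ExtMem.Multiqueue U A B K D.g D.r,
        -- space
        M.blocks ≤ C * (γ + 1) * ((N + K) / B + 1) ∧ M.m ≤ D.m + C ∧
        ∀ ops : List (ExtMem.QueueOp U K), ExtMem.AllowedOps N ops →
          -- all operations stop with probability one
          ∑' s, M.law ops s = 1 ∧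
          -- expected cost of the next `enqueue`
          (∀ x i, ExtMem.AllowedOps N (ops ++ [ExtMem.QueueOp.enqueue x i]) →
            ∑' s, M.law ops s * M.enqueue.expectedCost (x, i) s
              ≤ C * (1 + D.insertionCost N)) ∧
          -- whatever the random choices have been:
          ∀ s, M.law ops s ≠ 0 →
            (∀ x, M.remove.WorstCase x s C ∧
              ∀ o, M.remove.law x s o ≠ 0 →
                o.answer = (ExtMem.queuesAfter ops x).isSome) ∧
            (∀ x, M.isMember.WorstCase x s C ∧
              ∀ o, M.isMember.law x s o ≠ 0 →
                o.state = s ∧ o.answer = (ExtMem.queuesAfter ops x).isSome) ∧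
            (∀ i, M.traverse.WorstCase i s
                (C * ((ExtMem.elements (ExtMem.queuesAfter ops) i).card / B + 1)) ∧
              ∀ o, M.traverse.law i s o ≠ 0 →
                o.state = s ∧ o.out.Nodup ∧
                  o.out.toFinset = ExtMem.elements (ExtMem.queuesAfter ops) i) ∧
            M.LocationAware C s (ExtMem.queuesAfter ops) := by
  -- One generous constant for everything: 66 blocks of cache, 64 or 65 transfers, 68 per block of a
  -- listing, the number of blocks, and the size of words.
  refine ⟨100, fun U _ _ B A N K γ hB hA D hD hblocks => ?_⟩
  have hbase : 100 * (N + K + B + 1) ≤ A := by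
    refine le_trans ?_ hA
    gcongr
    omega
  have : NeZero B := ⟨hB.ne'⟩
  have : NeZero A := ⟨by omega⟩
  -- Enough groups to give each of the `K` queues a slot, with at most `B` slots to spare.
  let G := K / B + 1
  -- The pool is larger than the number of blocks that can be in use; rounding up `N / B` makes the
  -- inequality strict, so that a free block exists.
  let P := G + 3 * (N / B + 1)
  have : NeZero G := ⟨by simp [G]⟩
  have : NeZero P := ⟨by simp [P, G]⟩
  have hKB : G * B ≤ K + B := by
    have := Nat.div_mul_le_self K B
    simp only [G, add_mul, one_mul]
    omega
  have hKG : K < G * B := by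
    have := Nat.lt_div_mul_add (a := K) hB
    simp only [G, add_mul, one_mul]
    omega
  have hP : G * B + 3 * N < P * B := by
    have := Nat.lt_div_mul_add (a := N) hB
    have h2 : P * B = G * B + 3 * (N / B * B) + 3 * B := by simp only [P]; ring
    omega
  have hKle := Nat.div_le_self K B
  have hNle := Nat.div_le_self N B
  have hPle : P ≤ K + 3 * N + 4 := by
    simp only [P, G]
    omega
  have hfits : ExtMem.Fits A G B P := by
    simp only [ExtMem.Fits]
    omega
  have hA' : 64 + 1 < A := by omega
  let e := Fintype.equivFin (D.Addr ⊕ ExtMem.MemAddr G P)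
  let idx : Fin K → ExtMem.QueueId G B := fun i =>
    (⟨i / B, by rw [Nat.div_lt_iff_lt_mul hB]; exact i.2.trans hKG⟩, ⟨i % B, Nat.mod_lt _ hB⟩)
  have hidx : Function.Injective idx := by
    intro i k h
    simp only [idx, Prod.mk.injEq, Fin.mk.injEq] at h
    refine Fin.ext ?_
    rw [← Nat.div_add_mod i.val B, ← Nat.div_add_mod k.val B, h.1, h.2]
  obtain ⟨M₀, fr₀, role₀, hM₀⟩ := ExtMem.exists_initial U (G := G) (P := P) hB (by simp [P])
  have hV₀ : ExtMem.Valid M₀ fun _ => none := ⟨_, fr₀, role₀, hM₀⟩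
  refine ⟨ExtMem.multiqueue D e M₀ idx, ?_, by simp, fun ops hops => ?_⟩
  -- Three table blocks for each group, the head of the free list, and for each block of the pool
  -- one block for its link and one for its data.
  · have hcard : Fintype.card (D.Addr ⊕ ExtMem.MemAddr G P) =
        D.blocks + (3 * G + 1 + 2 * P) := by
      simp [ExtMem.CuckooData.blocks]
      ring
    change Fintype.card (D.Addr ⊕ ExtMem.MemAddr G P) ≤ _
    rw [hcard]
    have h1 : K / B ≤ (N + K) / B := Nat.div_le_div_right (by omega)
    have h2 : N / B ≤ (N + K) / B := Nat.div_le_div_right (by omega)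
    generalize (N + K) / B = X at h1 h2
    have h3 : γ * (N / B + 1) ≤ γ * (X + 1) := by gcongr
    have h4 : 100 * (γ + 1) * (X + 1) = 100 * (γ * (X + 1)) + 100 * (X + 1) := by ring
    rw [h4]
    simp only [P, G]
    generalize K / B = Y at h1
    generalize N / B = Z at h2 h3 hblocks
    omega
  · obtain ⟨dops, M, loc, hS⟩ :=
      ExtMem.exists_simulates (e := e) (idx := idx) hfits hA' hP hD hV₀ ops hops
    refine ⟨?_, fun x i hok => ?_, fun s hs => ?_⟩
    · rw [hS.law_eq, ExtMem.tsum_push]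
      exact (hD dops hS.allowed).1
    · refine (ExtMem.expectedCost_enqueue_le hfits hA' hP hD hS hok).trans ?_
      rw [mul_add, mul_one]
      gcongr
      · norm_num
      · exact le_mul_of_one_le_left' (by norm_num)
    · rw [hS.law_eq] at hs
      obtain ⟨⟨d, h⟩, rfl, hd⟩ := ExtMem.exists_of_push_ne_zero hs
      have hst := ExtMem.stores_of_simulates hD hS hd
      refine ⟨fun x => ?_, fun x => ?_, fun i => ?_, ?_⟩
      · obtain ⟨s', hy⟩ := ExtMem.remove_correct hfits hA' hS hst x
        exact ⟨(hy.mono (by norm_num)).worstCase, fun o ho => by rw [hy.eq_of_law_ne_zero ho]⟩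
      · have hy := ExtMem.isMember_yields hfits hA' hS hst x
        refine ⟨(hy.mono (by norm_num)).worstCase, fun o ho => ?_⟩
        rw [hy.eq_of_law_ne_zero ho]
        exact ⟨rfl, rfl⟩
      · obtain ⟨out, hy, hnd, hout⟩ := ExtMem.traverse_correct (d := d) (h := h) hfits hA' hidx hS i
        refine ⟨(hy.mono (by gcongr; norm_num)).worstCase, fun o ho => ?_⟩
        rw [hy.eq_of_law_ne_zero ho]
        exact ⟨rfl, hnd, hout⟩
      · obtain ⟨home, h1, h2, h3, h4, h5⟩ := ExtMem.locationAware hfits hA' hidx hKB hS hst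
        refine ⟨home, fun x => ⟨(h1 x).1.mono (by norm_num), (h1 x).2⟩, h2, h3,
          fun i => (h4 i).trans ?_, h5.trans ?_⟩ <;> gcongr <;> norm_num
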